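/- Let $k$ be an algebraically closed field (of arbitrary characteristic) and let $N=\mathbb Z^n$. Let $v_1,\dots,v_{n+1}\in N$ be primitive vectors with $N_{\mathbb R}=\sum_{i=1}^{n+1}\mathbb R_{\ge 0}v_i$. For $1\le i\le n+1$ let $\sigma_i$ be the cone generated by all $v_j$ with $j\ne i$, let $\Delta$ be the complete simplicial fan consisting of the $\sigma_i$ and their faces, and let $X=X(\Delta)$ be the corresponding toric variety over $k$ (a "$\mathbb Q$-factorial toric Fano variety with Picard number one"). For $i\neq j$ put $\mu_{i,j}=\sigma_i\cap\sigma_j$, an $(n-1)$-dimensional cone, and let $V(\mu_{i,j})\subset X$ be the corresponding torus-invariant curve, i.e. the closure of the torus orbit of $\mu_{i,j}$. Let $K_X$ denote the canonical divisor of $X$, which is $\mathbb Q$-Cartier. If $X\not\simeq\mathbb P^n$ (as varieties over $k$), then there is a pair $(l,m)$ with $l\ne m$ such that $$-K_X\cdot V(\mu_{l,m})\le n .$$ -/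

import Mathlib

open CategoryTheory CategoryTheory.Limits AlgebraicGeometry

universe u

/-- Primitive vectors `v_0, …, v_n` in `N = ℤⁿ` with `N_ℝ = ∑ ℝ_{≥ 0} v_i`: the rays of the complete
simplicial fan whose cones are `σ_I = ∑_{i ∈ I} ℝ_{≥ 0} v_i` for the proper subsets `I`. -/
structure SimplexFan (n : ℕ) where
  ray : Fin (n + 1) → (Fin n → ℤ)
  primitive : ∀ (i : Fin (n + 1)) (d : ℤ) (w : Fin n → ℤ), ray i = d • w → IsUnit d
  spanning : ∀ x : Fin n → ℝ, ∃ c : Fin (n + 1) → ℝ, (∀ i, 0 ≤ c i) ∧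
    x = ∑ i, c i • (fun j => (ray i j : ℝ))

namespace SimplexFan

variable {n : ℕ}

/-- The cones `σ_I` of the fan, indexed by the proper subsets `I` of the set of rays and ordered by
the face relation `I ⊆ J`. -/
abbrev Cone (n : ℕ) : Type := {I : Finset (Fin (n + 1)) // I ≠ Finset.univ}

/-- The semigroup `σ_I^∨ ∩ M`, where `M = ℤⁿ` is the dual lattice, paired with `N` by the dot
product. -/
def dualMonoid (Δ : SimplexFan n) (I : Cone n) : AddSubmonoid (Fin n → ℤ) where
  carrier := {m | ∀ i ∈ I.1, 0 ≤ m ⬝ᵥ Δ.ray i}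
  zero_mem' := by simp
  add_mem' := by
    intro a b ha hb i hi
    rw [add_dotProduct]
    exact add_nonneg (ha i hi) (hb i hi)

lemma dualMonoid_anti (Δ : SimplexFan n) {I J : Cone n} (h : I ≤ J) :
    Δ.dualMonoid J ≤ Δ.dualMonoid I :=
  fun _ hm i hi => hm i (h hi)

lemma det_ne_zero (Δ : SimplexFan n) (l : Fin (n + 1)) :
    (Matrix.of fun i : Fin n => Δ.ray (l.succAbove i)).det ≠ 0 := by
  intro h
  obtain ⟨y, hy0, hy⟩ := Matrix.exists_mulVec_eq_zero_iff.mpr h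
  have hz : ∀ i, i ≠ l → ∑ j, (Δ.ray i j : ℝ) * (y j : ℝ) = 0 := by
    intro i hi
    obtain ⟨t, rfl⟩ := Fin.exists_succAbove_eq hi
    have := congrFun hy t
    simp only [Matrix.mulVec, dotProduct, Matrix.of_apply, Pi.zero_apply] at this
    exact_mod_cast this
  have key : ∀ x : Fin n → ℝ, ∃ c : ℝ, 0 ≤ c ∧
      ∑ j, x j * (y j : ℝ) = c * ∑ j, (Δ.ray l j : ℝ) * (y j : ℝ) := by
    intro x
    obtain ⟨c, hc, hx⟩ := Δ.spanning x
    refine ⟨c l, hc l, ?_⟩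
    have : ∀ j, x j = ∑ i, c i * (Δ.ray i j : ℝ) := by
      intro j; rw [hx]; simp
    simp_rw [this, Finset.sum_mul, mul_assoc]
    rw [Finset.sum_comm]
    simp_rw [← Finset.mul_sum]
    rw [Finset.sum_eq_single l]
    · intro i _ hi; rw [hz i hi, mul_zero]
    · simp
  obtain ⟨c, hc, h1⟩ := key (fun j => (y j : ℝ))
  obtain ⟨c', hc', h2⟩ := key (fun j => -(y j : ℝ))
  have hpos : 0 < ∑ j, (y j : ℝ) * (y j : ℝ) := by
    obtain ⟨j, hj⟩ := Function.ne_iff.mp hy0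
    refine Finset.sum_pos' (fun i _ => mul_self_nonneg _) ⟨j, Finset.mem_univ _, ?_⟩
    exact mul_self_pos.mpr (by exact_mod_cast hj)
  simp only [neg_mul, Finset.sum_neg_distrib] at h2
  set s := ∑ j, (Δ.ray l j : ℝ) * (y j : ℝ)
  rcases le_total 0 s with hs | hs
  · nlinarith [mul_nonneg hc' hs]
  · nlinarith [mul_nonneg hc (neg_nonneg.mpr hs)]

/-- A lattice point of the dual cone cutting out a given face. -/
lemma exists_face (Δ : SimplexFan n) {I J : Cone n} (h : I ≤ J) :
    ∃ m : Fin n → ℤ, (∀ i ∈ I.1, m ⬝ᵥ Δ.ray i = 0) ∧ ∀ i ∈ J.1, i ∉ I.1 → 0 < m ⬝ᵥ Δ.ray i := by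
  obtain ⟨l, hl⟩ : ∃ l, l ∉ J.1 := by
    by_contra! hc
    exact J.2 (Finset.eq_univ_iff_forall.mpr hc)
  set A := Matrix.of fun i : Fin n => Δ.ray (l.succAbove i) with hA
  have hd : A.det ≠ 0 := Δ.det_ne_zero l
  let w : Fin n → ℤ := fun i => if l.succAbove i ∈ I.1 then 0 else A.det
  have hm : ∀ t, (A.adjugate.mulVec w) ⬝ᵥ Δ.ray (l.succAbove t) = A.det * w t := by
    intro t
    have h1 : A.mulVec (A.adjugate.mulVec w) = A.det • w := by
      rw [Matrix.mulVec_mulVec, Matrix.mul_adjugate, Matrix.smul_mulVec, Matrix.one_mulVec]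
    have := congrFun h1 t
    rw [dotProduct_comm]
    exact this
  refine ⟨A.adjugate.mulVec w, fun i hi => ?_, fun i hi hi' => ?_⟩
  · obtain ⟨t, rfl⟩ := Fin.exists_succAbove_eq (show i ≠ l from fun e => hl (e ▸ h hi))
    rw [hm]
    simp [w, hi]
  · obtain ⟨t, rfl⟩ := Fin.exists_succAbove_eq (show i ≠ l from fun e => hl (e ▸ hi))
    rw [hm]
    simp only [w, hi', if_false]
    exact mul_self_pos.mpr hd

variable (k : Type u) [Field k]

/-- The coordinate ring `k[σ_I^∨ ∩ M]` of the affine chart. -/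
abbrev chartRing (Δ : SimplexFan n) (I : Cone n) : Type u :=
  AddMonoidAlgebra k (Δ.dualMonoid I)

/-- The inclusion `k[σ_J^∨ ∩ M] → k[σ_I^∨ ∩ M]` for a face `σ_I` of `σ_J`. -/
noncomputable def chartRingMap (Δ : SimplexFan n) {I J : Cone n} (h : I ≤ J) :
    Δ.chartRing k J →ₐ[k] Δ.chartRing k I :=
  AddMonoidAlgebra.mapDomainAlgHom k k (AddSubmonoid.inclusion (Δ.dualMonoid_anti h))

lemma chartRingMap_single (Δ : SimplexFan n) {I J : Cone n} (h : I ≤ J) (m : Δ.dualMonoid J)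
    (a : k) : Δ.chartRingMap k h (AddMonoidAlgebra.single m a) =
      AddMonoidAlgebra.single (AddSubmonoid.inclusion (Δ.dualMonoid_anti h) m) a := by
  simp [chartRingMap]

lemma chartRingMap_injective (Δ : SimplexFan n) {I J : Cone n} (h : I ≤ J) :
    Function.Injective (Δ.chartRingMap k h) :=
  AddMonoidAlgebra.mapDomain_injective (AddSubmonoid.inclusion_injective _)

lemma exists_pow_mul_mem (Δ : SimplexFan n) {I J : Cone n} (h : I ≤ J) (m : Δ.dualMonoid J)
    (hm : ∀ i ∈ J.1, i ∉ I.1 → 0 < m.1 ⬝ᵥ Δ.ray i) (f : Δ.chartRing k I) :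
    ∃ (N : ℕ) (g : Δ.chartRing k J),
      Δ.chartRingMap k h (AddMonoidAlgebra.single m 1) ^ N * f = Δ.chartRingMap k h g := by
  induction f using AddMonoidAlgebra.induction_linear with
  | zero => exact ⟨0, 0, by simp⟩
  | add f f' hf hf' =>
    obtain ⟨N, g, hg⟩ := hf
    obtain ⟨N', g', hg'⟩ := hf'
    refine ⟨N + N', AddMonoidAlgebra.single m 1 ^ N' * g + AddMonoidAlgebra.single m 1 ^ N * g', ?_⟩
    rw [map_add, map_mul, map_mul, ← hg, ← hg', map_pow, map_pow]
    ring
  | single s a =>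
    let N : ℕ := ∑ i ∈ J.1, (s.1 ⬝ᵥ Δ.ray i).natAbs
    have hmem : N • m.1 + s.1 ∈ Δ.dualMonoid J := by
      intro i hi
      rw [add_dotProduct, smul_dotProduct, nsmul_eq_mul]
      by_cases hI : i ∈ I.1
      · have h1 := s.2 i hI
        have h2 := m.2 i hi
        positivity
      · have h1 := hm i hi hI
        have h2 : (s.1 ⬝ᵥ Δ.ray i).natAbs ≤ N :=
          Finset.single_le_sum (f := fun i => (s.1 ⬝ᵥ Δ.ray i).natAbs)
            (fun _ _ => Nat.zero_le _) hi
        have h3 : (N : ℤ) ≤ N * (m.1 ⬝ᵥ Δ.ray i) := by nlinarith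
        omega
    refine ⟨N, AddMonoidAlgebra.single ⟨_, hmem⟩ a, ?_⟩
    rw [chartRingMap_single, chartRingMap_single, AddMonoidAlgebra.single_pow,
      AddMonoidAlgebra.single_mul_single]
    simp only [one_pow, one_mul]
    congr 1

lemma isLocalization_chartRingMap (Δ : SimplexFan n) {I J : Cone n} (h : I ≤ J)
    (m : Δ.dualMonoid J) (h0 : ∀ i ∈ I.1, m.1 ⬝ᵥ Δ.ray i = 0)
    (hm : ∀ i ∈ J.1, i ∉ I.1 → 0 < m.1 ⬝ᵥ Δ.ray i) :
    letI := (Δ.chartRingMap k h).toRingHom.toAlgebra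
    IsLocalization.Away (AddMonoidAlgebra.single m 1 : Δ.chartRing k J) (Δ.chartRing k I) := by
  let _ := (Δ.chartRingMap k h).toRingHom.toAlgebra
  have halg : ∀ x, algebraMap (Δ.chartRing k J) (Δ.chartRing k I) x = Δ.chartRingMap k h x :=
    fun _ => rfl
  have hneg : -m.1 ∈ Δ.dualMonoid I := by
    intro i hi
    rw [neg_dotProduct, h0 i hi, neg_zero]
  refine IsLocalization.Away.mk _ ?_ (fun s => ?_) (fun a b hab => ?_)
  · refine IsUnit.of_mul_eq_one (AddMonoidAlgebra.single ⟨-m.1, hneg⟩ 1) ?_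
    rw [halg, chartRingMap_single, AddMonoidAlgebra.single_mul_single, AddMonoidAlgebra.one_def]
    congr 1
    · ext1; simp
    · simp
  · obtain ⟨N, g, hg⟩ := Δ.exists_pow_mul_mem k h m hm s
    exact ⟨N, g, by rw [mul_comm, halg, halg, hg]⟩
  · exact ⟨0, by rw [Δ.chartRingMap_injective k h hab]⟩

/-- The charts `U_I = Spec k[σ_I^∨ ∩ M]` with the inclusions `U_I ⟶ U_J` of faces `I ⊆ J`. -/
noncomputable def charts (Δ : SimplexFan n) : Cone n ⥤ Scheme.{u} where
  obj I := Spec (.of (Δ.chartRing k I))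
  map h := Spec.map (CommRingCat.ofHom (Δ.chartRingMap k (leOfHom h)).toRingHom)
  map_id I := by
    rw [← Spec.map_id]
    congr 1
    refine CommRingCat.hom_ext (RingHom.ext fun x => ?_)
    induction x using AddMonoidAlgebra.induction_linear with
    | zero => rw [map_zero, map_zero]
    | add f g hf hg => rw [map_add, map_add, hf, hg]
    | single m a => exact Δ.chartRingMap_single k le_rfl m a
  map_comp {I J K} f g := by
    rw [← Spec.map_comp]
    congr 1
    refine CommRingCat.hom_ext (RingHom.ext fun x => ?_)
    induction x using AddMonoidAlgebra.induction_linear with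
    | zero => rw [map_zero, map_zero]
    | add f g hf hg => rw [map_add, map_add, hf, hg]
    | single m a =>
      change Δ.chartRingMap k (leOfHom (f ≫ g)) _ =
        Δ.chartRingMap k (leOfHom f) (Δ.chartRingMap k (leOfHom g) _)
      simp only [chartRingMap_single]
      rfl

instance (Δ : SimplexFan n) {I J : Cone n} (f : I ⟶ J) : IsOpenImmersion ((Δ.charts k).map f) := by
  obtain ⟨m, h0, hm⟩ := Δ.exists_face (leOfHom f)
  have hmem : m ∈ Δ.dualMonoid J := by
    intro i hi
    by_cases hI : i ∈ I.1
    · exact (h0 i hI).ge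
    · exact (hm i hi hI).le
  let _ := (Δ.chartRingMap k (leOfHom f)).toRingHom.toAlgebra
  have := Δ.isLocalization_chartRingMap k (leOfHom f) ⟨m, hmem⟩ h0 hm
  exact IsOpenImmersion.of_isLocalization (S := Δ.chartRing k I)
    (AddMonoidAlgebra.single ⟨m, hmem⟩ 1 : Δ.chartRing k J)

lemma range_charts_map (Δ : SimplexFan n) {I J : Cone n} (f : I ⟶ J)
    (m : Δ.dualMonoid J) (h0 : ∀ i ∈ I.1, m.1 ⬝ᵥ Δ.ray i = 0)
    (hm : ∀ i ∈ J.1, i ∉ I.1 → 0 < m.1 ⬝ᵥ Δ.ray i) :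
    Set.range ((Δ.charts k).map f) = {x : PrimeSpectrum (Δ.chartRing k J) |
      (AddMonoidAlgebra.single m 1 : Δ.chartRing k J) ∉ x.asIdeal} := by
  let _ := (Δ.chartRingMap k (leOfHom f)).toRingHom.toAlgebra
  have := Δ.isLocalization_chartRingMap k (leOfHom f) m h0 hm
  exact PrimeSpectrum.localization_away_comap_range (Δ.chartRing k I)
    (AddMonoidAlgebra.single m 1 : Δ.chartRing k J)

instance (Δ : SimplexFan n) : (Δ.charts k ⋙ Scheme.forget).IsLocallyDirected where
  cond {I J K} fi fj xi xj hx := by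
    have hx' : (Δ.charts k).map fi xi = (Δ.charts k).map fj xj := hx
    obtain ⟨m, h0, hm⟩ := Δ.exists_face (leOfHom fi)
    obtain ⟨m', h0', hm'⟩ := Δ.exists_face (leOfHom fj)
    have hmem : m ∈ Δ.dualMonoid K := by
      intro i hi
      by_cases hI : i ∈ I.1
      · exact (h0 i hI).ge
      · exact (hm i hi hI).le
    have hmem' : m' ∈ Δ.dualMonoid K := by
      intro i hi
      by_cases hJ : i ∈ J.1
      · exact (h0' i hJ).ge
      · exact (hm' i hi hJ).le
    let L : Cone n := ⟨I.1 ∩ J.1, fun h => I.2 (Finset.eq_univ_of_forall fun i =>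
      (Finset.mem_inter.mp (h ▸ Finset.mem_univ i)).1)⟩
    let fl : L ⟶ I := homOfLE Finset.inter_subset_left
    let fl' : L ⟶ J := homOfLE Finset.inter_subset_right
    have hr := Δ.range_charts_map k fi ⟨m, hmem⟩ h0 hm
    have hr' := Δ.range_charts_map k fj ⟨m', hmem'⟩ h0' hm'
    have hrl := Δ.range_charts_map k (fl ≫ fi) (⟨m, hmem⟩ + ⟨m', hmem'⟩)
      (fun i hi => by
        have hi := Finset.mem_inter.mp hi
        simp [add_dotProduct, h0 i hi.1, h0' i hi.2])
      (fun i hi hi' => by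
        have e1 := hmem i hi
        have e2 := hmem' i hi
        change 0 < (m + m') ⬝ᵥ Δ.ray i
        rw [add_dotProduct]
        by_cases hI : i ∈ I.1
        · have := hm' i hi (fun hJ => hi' (Finset.mem_inter.mpr ⟨hI, hJ⟩))
          omega
        · have := hm i hi hI
          omega)
    have hx1 : (Δ.charts k).map fi xi ∈ Set.range ((Δ.charts k).map fi) := ⟨xi, rfl⟩
    have hx2 : (Δ.charts k).map fi xi ∈ Set.range ((Δ.charts k).map fj) := ⟨xj, hx'.symm⟩
    have hx3 : (Δ.charts k).map fi xi ∈ Set.range ((Δ.charts k).map (fl ≫ fi)) := by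
      rw [hr] at hx1
      rw [hr'] at hx2
      rw [hrl]
      have hp : (AddMonoidAlgebra.single (⟨m, hmem⟩ + ⟨m', hmem'⟩) 1 : Δ.chartRing k K) =
          AddMonoidAlgebra.single ⟨m, hmem⟩ 1 * AddMonoidAlgebra.single ⟨m', hmem'⟩ 1 := by
        rw [AddMonoidAlgebra.single_mul_single, one_mul]
      intro hmem3
      rw [hp] at hmem3
      exact (((Δ.charts k).map fi xi).isPrime.mem_or_mem hmem3).elim hx1 hx2
    obtain ⟨x, hxx⟩ := hx3
    have e1 : (Δ.charts k).map fl x = xi := by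
      apply ((Δ.charts k).map fi).isOpenEmbedding.injective
      rw [← hxx, Functor.map_comp, Scheme.Hom.comp_apply]
    refine ⟨L, fl, fl', x, e1, ?_⟩
    change (Δ.charts k).map fl' x = xj
    apply ((Δ.charts k).map fj).isOpenEmbedding.injective
    rw [← hx', ← hxx, ← Scheme.Hom.comp_apply, ← Functor.map_comp]
    rfl

/-- The toric variety `X(Δ)`: the charts `U_I` glued along common faces. -/
noncomputable def toricVariety (Δ : SimplexFan n) : Scheme.{u} := colimit (Δ.charts k)

/-- The open immersion of the chart `U_I` into `X(Δ)`. -/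
noncomputable def chartι (Δ : SimplexFan n) (I : Cone n) :
    Spec (.of (Δ.chartRing k I)) ⟶ Δ.toricVariety k :=
  colimit.ι (Δ.charts k) I

/-- The structure morphism `X(Δ) ⟶ Spec k`. -/
noncomputable def toSpec (Δ : SimplexFan n) : Δ.toricVariety k ⟶ Spec (.of k) :=
  colimit.desc (Δ.charts k)
    { pt := Spec (.of k)
      ι := { app := fun I => Spec.map (CommRingCat.ofHom (algebraMap k (Δ.chartRing k I)))
             naturality := fun I J f => by
               change Spec.map _ ≫ Spec.map _ = Spec.map _ ≫ 𝟙 _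
               rw [Category.comp_id, ← Spec.map_comp, ← CommRingCat.ofHom_comp]
               congr 2
               exact (Δ.chartRingMap k (leOfHom f)).comp_algebraMap } }

instance (Δ : SimplexFan n) (I : Cone n) : IsDomain (Δ.chartRing k I) :=
  Function.Injective.isDomain
    (AddMonoidAlgebra.mapDomainRingHom k (Δ.dualMonoid I).subtype)
    (AddMonoidAlgebra.mapDomain_injective Subtype.val_injective)

instance (Δ : SimplexFan n) (I : Cone n) : IsIntegral ((Δ.charts k).obj I) :=
  inferInstanceAs (IsIntegral (Spec (.of (Δ.chartRing k I))))

instance (Δ : SimplexFan n) : IsIntegral (Δ.toricVariety k) := by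
  have hred : AlgebraicGeometry.IsReduced (Δ.toricVariety k) :=
    have h₀ (j : Cone n) : AlgebraicGeometry.IsReduced ((Δ.charts k).obj j) :=
      isReduced_of_isIntegral _
    have h (i : (Scheme.IsLocallyDirected.openCover (Δ.charts k)).I₀) :
        AlgebraicGeometry.IsReduced ((Scheme.IsLocallyDirected.openCover (Δ.charts k)).X i) :=
      h₀ i
    .of_openCover _ (Scheme.IsLocallyDirected.openCover (Δ.charts k))
  let O : Cone n := ⟨∅, (Finset.univ_nonempty (α := Fin (n + 1))).ne_empty.symm⟩
  have key : ∀ x : Δ.toricVariety k,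
      colimit.ι (Δ.charts k) O (genericPoint ((Δ.charts k).obj O)) ⤳ x := by
    intro x
    obtain ⟨I, y, rfl⟩ := Scheme.IsLocallyDirected.ι_jointly_surjective (Δ.charts k) x
    let f : O ⟶ I := homOfLE (Finset.empty_subset _)
    rw [← colimit.w (Δ.charts k) f, Scheme.Hom.comp_apply, genericPoint_eq_of_isOpenImmersion]
    exact (genericPoint_specializes y).map (colimit.ι (Δ.charts k) I).continuous
  have hirr : IrreducibleSpace (Δ.toricVariety k) := by
    rw [irreducibleSpace_def]
    have : (Set.univ : Set (Δ.toricVariety k)) =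
        closure {colimit.ι (Δ.charts k) O (genericPoint ((Δ.charts k).obj O))} :=
      (Set.eq_univ_of_forall fun x => (key x).mem_closure).symm
    rw [Set.top_eq_univ, this]
    exact isIrreducible_singleton.closure
  exact isIntegral_of_irreducibleSpace_of_isReduced _

/-- The orbit closure `V(σ_I)`: the closure of the torus orbit `O_I`, which is the closed subset of
the chart `U_I` on which the characters `χ^m`, `m ∈ σ_I^∨ ∩ M`, `m ∉ σ_I^⊥`, vanish. -/
noncomputable def orbitClosure (Δ : SimplexFan n) (I : Cone n) : Set (Δ.toricVariety k) :=
  closure ((Δ.chartι k I) '' PrimeSpectrum.zeroLocus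
    {f : Δ.chartRing k I | ∃ m : Δ.dualMonoid I, (∃ i ∈ I.1, m.1 ⬝ᵥ Δ.ray i ≠ 0) ∧
      f = AddMonoidAlgebra.single m 1})

/-- The maximal cone `σ_l`, spanned by the rays `v_i` with `i ≠ l`. -/
def maxCone (l : Fin (n + 1)) : Cone n := ⟨{l}ᶜ, by simp⟩

/-- The wall `μ_{l,m} = σ_l ∩ σ_m`, spanned by the rays `v_i` with `i ≠ l, m`. -/
def wall (l m : Fin (n + 1)) : Cone n :=
  ⟨(maxCone l).1 ∩ (maxCone m).1, fun h => by
    have := h ▸ Finset.mem_univ l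
    simp [maxCone] at this⟩

end SimplexFan

namespace ToricGeometry

/-- `HasOrd A a e`: the order of vanishing along the one-dimensional local domain `A` of the element
`a ≠ 0` of its fraction field `L` is `e`, i.e. `a = x / y` with `x, y ∈ A` nonzero and
`e = length (A / x) - length (A / y)`. -/
def HasOrd (A : Type*) [CommRing A] {L : Type*} [Field L] [Algebra A L] (a : L) (e : ℤ) : Prop :=
  ∃ (x y : A) (p q : ℕ), algebraMap A L x ≠ 0 ∧ algebraMap A L y ≠ 0 ∧
    a * algebraMap A L y = algebraMap A L x ∧ Ring.ord A x = p ∧ Ring.ord A y = q ∧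
    e = (p : ℤ) - q

/-- A Cartier divisor on an integral scheme `X`, i.e. a global section of `𝒦ˣ / 𝒪ˣ`: a local
equation at every point `p` which is also a local equation at all points near `p`. -/
structure CartierDivisor (X : Scheme.{u}) [IsIntegral X] where
  eqn : X → X.functionFieldˣ
  locally_eq : ∀ p : X, ∃ U : X.Opens, p ∈ U ∧ ∀ q ∈ U, ∃ w : (X.presheaf.stalk q)ˣ,
    algebraMap (X.presheaf.stalk q) X.functionField w * (eqn p : X.functionField) = eqn q

/-- `D`, as a function on the points of codimension one, is the Weil divisor of `E`. -/
def CartierDivisor.IsWeil {X : Scheme.{u}} [IsIntegral X] (E : CartierDivisor X) (D : X → ℤ) :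
    Prop :=
  ∀ z : X, Order.coheight z = 1 →
    HasOrd (X.presheaf.stalk z) (E.eqn z : X.functionField) (D z)

/-- For `c ⤳ p`, the local ring `𝒪_{C,p} ⊆ κ(c)` at `p` of the integral closed subscheme `C` of `X`
with generic point `c`: the image of `𝒪_{X,p}` in the residue field `κ(c)`, the function field
of `C`. -/
noncomputable def curveLocalRing {X : Scheme.{u}} {c p : X} (h : c ⤳ p) :
    Subring (X.residueField c) :=
  ((X.residue c).hom.comp (X.presheaf.stalkSpecializes h).hom).range

/-- `E.HasDegree f C e`: the integral curve `C ⊆ X`, over the field with spectrum `S`, has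
`E · C = deg (E|_C) = e`. Here `c` is the generic point of `C`; dividing the local equations of `E`
by the one at `c` (i.e. replacing `E` by a linearly equivalent divisor whose support does not
contain `C`) makes them units at `c`, which restrict to rational functions on `C`; the zero-cycle
`d` collects their orders at the closed points of `C`, and `e` is its degree. -/
def CartierDivisor.HasDegree {X S : Scheme.{u}} [IsIntegral X] (f : X ⟶ S) (E : CartierDivisor X)
    (C : Set X) (e : ℤ) : Prop :=
  ∃ (c : X) (d : X →₀ ℤ), IsGenericPoint c C ∧ (∀ p ∈ d.support, c ⤳ p ∧ p ≠ c) ∧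
    (∀ (p : X) (h : c ⤳ p), p ≠ c → ∃ w : (X.presheaf.stalk c)ˣ,
      algebraMap (X.presheaf.stalk c) X.functionField w * (E.eqn c : X.functionField) = E.eqn p ∧
      HasOrd (curveLocalRing h) ((X.residue c).hom w) (d p)) ∧
    e = d.sum fun p r => r * (f.residueDegree p : ℤ)

/-- `D · C = q` for a `ℚ`-Cartier Weil divisor `D` on a normal variety `X` and a complete integral
curve `C` in it: `q = (E · C) / r` with a Cartier divisor `E` whose Weil divisor is `r D`. -/
def IsIntersectionNumber {X S : Scheme.{u}} [IsIntegral X] (f : X ⟶ S) (D : X → ℤ) (C : Set X)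
    (q : ℚ) : Prop :=
  ∃ (r : ℕ) (E : CartierDivisor X) (e : ℤ), 0 < r ∧ E.IsWeil (fun z => r * D z) ∧
    E.HasDegree f C e ∧ q = (e : ℚ) / r

section Canonical

variable {k : Type u} [Field k] {X : Scheme.{u}} (f : X ⟶ Spec (.of k))

/-- The structure map `k → 𝒪_{X,x}` of a `k`-scheme. -/
noncomputable def baseToStalk (x : X) : k →+* X.presheaf.stalk x :=
  ((Scheme.ΓSpecIso (.of k)).inv ≫ f.appTop ≫ X.presheaf.germ ⊤ x (TopologicalSpace.Opens.mem_top x)).hom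

lemma algebraMap_comp_baseToStalk [IsIntegral X] (z : X) :
    (algebraMap (X.presheaf.stalk z) X.functionField).comp (baseToStalk f z) =
      baseToStalk f (genericPoint X) := by
  have h : genericPoint X ⤳ z := (genericPoint_spec X).specializes trivial
  change (((Scheme.ΓSpecIso (.of k)).inv ≫ f.appTop ≫
    X.presheaf.germ ⊤ z (TopologicalSpace.Opens.mem_top z)) ≫ X.presheaf.stalkSpecializes h).hom = _
  rw [Category.assoc, Category.assoc, TopCat.Presheaf.germ_stalkSpecializes]
  rfl

/-- The map `Ω_{𝒪_{X,z}/k} → Ω_{K(X)/k}`. -/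
noncomputable def stalkDifferentialMap [IsIntegral X] (z : X) :
    letI := (baseToStalk f z).toAlgebra
    letI := (baseToStalk f (genericPoint X)).toAlgebra
    Ω[X.presheaf.stalk z⁄k] →ₗ[X.presheaf.stalk z] Ω[X.functionField⁄k] :=
  letI := (baseToStalk f z).toAlgebra
  letI := (baseToStalk f (genericPoint X)).toAlgebra
  haveI : IsScalarTower k (X.presheaf.stalk z) X.functionField :=
    .of_algebraMap_eq' (algebraMap_comp_baseToStalk f z).symm
  KaehlerDifferential.map k k (X.presheaf.stalk z) X.functionField

/-- `K`, as a function on the points of codimension one, is a canonical divisor of the normal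
`n`-dimensional variety `X` over `k`: the divisor of a nonzero rational `n`-form, written as
`ω_1 ∧ ⋯ ∧ ω_n` with a basis `ω` of `Ω_{K(X)/k}`. At a point `z` of codimension one, if `b` is a
basis of `Ω_{𝒪_{X,z}/k}` and `ω_i = ∑ J_{ij} b_j`, then the form is `det J • b_1 ∧ ⋯ ∧ b_n` and
its order at `z` is the order of `det J`. -/
def IsCanonicalDivisor [IsIntegral X] (n : ℕ) (K : X → ℤ) : Prop :=
  letI := (baseToStalk f (genericPoint X)).toAlgebra
  ∃ ω : Module.Basis (Fin n) X.functionField Ω[X.functionField⁄k],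
    ∀ z : X, Order.coheight z = 1 →
      letI := (baseToStalk f z).toAlgebra
      ∃ (b : Module.Basis (Fin n) (X.presheaf.stalk z) Ω[X.presheaf.stalk z⁄k])
        (J : Matrix (Fin n) (Fin n) X.functionField),
        (∀ i, ω i = ∑ j, J i j • stalkDifferentialMap f z (b j)) ∧
        HasOrd (X.presheaf.stalk z) J.det (K z)

end Canonical

/-- `-K_X · C = q`: canonical divisors exist, and `(-K) · C = q` for each of them. -/
def IsAnticanonicalDegree {k : Type u} [Field k] {X : Scheme.{u}} [IsIntegral X]
    (f : X ⟶ Spec (.of k)) (n : ℕ) (C : Set X) (q : ℚ) : Prop :=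
  (∃ K : X → ℤ, IsCanonicalDivisor f n K) ∧
    ∀ K : X → ℤ, IsCanonicalDivisor f n K → IsIntersectionNumber f (fun z => -K z) C q

/-- Projective space `ℙⁿ = Proj k[x_0, …, x_n]` as a scheme over `k`. -/
noncomputable def projectiveSpace (n : ℕ) (k : Type u) [Field k] : Over (Spec (.of k)) :=
  letI := MvPolynomial.gradedAlgebra (σ := Fin (n + 1)) (R := k)
  Over.mk (Proj.toSpecZero (MvPolynomial.homogeneousSubmodule (Fin (n + 1)) k) ≫
    Spec.map (CommRingCat.ofHom
      (algebraMap k (MvPolynomial.homogeneousSubmodule (Fin (n + 1)) k 0))))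

end ToricGeometry

/-! ### Lattice combinatorics of the simplex fan: weights, wall generators and the dichotomy. -/

namespace SimplexFan

variable {n : ℕ}

/-! The rays satisfy one relation `∑ w_i v_i = 0` with all `w_i > 0`, normalised by `∑ w_i = 1`
(`exists_weights`). For a wall `μ_{l,m}` let `u` generate `μ_{l,m}^⊥ ∩ M` with `⟨u, v_l⟩ > 0`. The
class of `-K_X` is that of `∑ D_i`. If `φ_j` takes the value `r` on the rays of `σ_j`, then `φ_m -
φ_l = s u`, and `s` is the degree of `r ∑ D_i` on `V(μ_{l,m})`. Pairing the relation with `φ_l`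
yields `-K_X · V(μ_{l,m}) = s / r = 1 / (⟨u, v_l⟩ w_l)`.

The inequality is thus `1 ≤ n ⟨u, v_l⟩ w_l`. Suppose it fails for every wall. If `w_l` is maximal,
then `w_l ≥ 1/(n+1)`, which forces `⟨u, v_l⟩ = 1`; hence `w_l / w_m = -⟨u, v_m⟩` is a positive
integer for every `m`, and `n w_l < 1`. Two weights different from `w_l` would each be at most `w_l
/ 2` and give `1 ≤ n w_l`. A single different weight would make its ray a proper multiple of a
lattice vector, against primitivity. So all weights agree, every `⟨u, v_l⟩` is `1`, and the fan is
that of projective space (`exists_wall_or_isUnimodular`).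

Two geometric bridges complete the argument. `IsWallGenerator.isAnticanonicalDegree` computes the
intersection number: a rational `n`-form made of characters identifies `-rK` with an explicit
Cartier divisor, whose restriction to the curve is a power of the coordinate `χ^u`.
`IsUnimodular.nonempty_iso_projectiveSpace` glues the isomorphisms of the charts with the standard
opens of `Proj`, both being viewed inside Laurent polynomials in `n + 1` variables. -/

lemma dim_pos (Δ : SimplexFan n) : 0 < n := by
  rcases Nat.eq_zero_or_pos n with rfl | h
  · have := Δ.primitive 0 0 0 (Subsingleton.elim _ _)
    simp at this
  · exact h

lemma ext_of_dotProduct_ray (Δ : SimplexFan n) (j : Fin (n + 1)) {m m' : Fin n → ℤ}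
    (h : ∀ i, i ≠ j → m ⬝ᵥ Δ.ray i = m' ⬝ᵥ Δ.ray i) : m = m' := by
  rw [← sub_eq_zero]
  refine Matrix.eq_zero_of_mulVec_eq_zero (Δ.det_ne_zero j) (funext fun t => ?_)
  have := h (j.succAbove t) (Fin.succAbove_ne _ _)
  change Δ.ray (j.succAbove t) ⬝ᵥ (m - m') = 0
  rw [dotProduct_comm, sub_dotProduct, this, sub_self]

lemma exists_dotProduct_ray_eq (Δ : SimplexFan n) (j : Fin (n + 1)) :
    ∃ m : Fin n → ℤ, ∃ d : ℕ, 0 < d ∧ ∀ i, i ≠ j → m ⬝ᵥ Δ.ray i = d := by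
  set A := Matrix.of fun i : Fin n => Δ.ray (j.succAbove i) with hA
  have hd : A.det ≠ 0 := Δ.det_ne_zero j
  -- Cramer's rule for the constant right-hand side `det A`: the common value becomes `(det A)²`,
  -- positive whatever the sign of the determinant.
  refine ⟨A.adjugate.mulVec fun _ => A.det, (A.det * A.det).natAbs, ?_, fun i hi => ?_⟩
  · exact Int.natAbs_pos.mpr (mul_ne_zero hd hd)
  · obtain ⟨t, rfl⟩ := Fin.exists_succAbove_eq hi
    have h1 : A.mulVec (A.adjugate.mulVec fun _ => A.det) = A.det • fun _ => A.det := by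
      rw [Matrix.mulVec_mulVec, Matrix.mul_adjugate, Matrix.smul_mulVec, Matrix.one_mulVec]
    have h2 := congrFun h1 t
    rw [dotProduct_comm, Int.natAbs_of_nonneg (mul_self_nonneg _)]
    exact h2

/-- For some `r > 0` the divisor `r ∑ D_i` is given on each chart `U_{σ_j}` by a character. -/
lemma exists_support (Δ : SimplexFan n) :
    ∃ (r : ℕ) (φ : Fin (n + 1) → Fin n → ℤ), 0 < r ∧ ∀ j i, i ≠ j → φ j ⬝ᵥ Δ.ray i = r := by
  choose m d hd h using Δ.exists_dotProduct_ray_eq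
  refine ⟨∏ j, d j, fun j => (∏ t ∈ Finset.univ.erase j, d t) • m j,
    Finset.prod_pos fun j _ => hd j, fun j i hi => ?_⟩
  rw [smul_dotProduct, h j i hi, nsmul_eq_mul, ← Nat.cast_mul,
    Finset.prod_erase_mul _ _ (Finset.mem_univ j)]

/-- Since the rays span positively, `-∑ v_i = ∑ c_i v_i` with `c_i ≥ 0`. Hence `∑ (1 + c_i) v_i = 0`
is a relation with strictly positive coefficients, which can be normalised. -/
lemma exists_weights (Δ : SimplexFan n) :
    ∃ w : Fin (n + 1) → ℝ, (∀ i, 0 < w i) ∧ ∑ i, w i = 1 ∧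
      ∀ m : Fin n → ℤ, ∑ i, w i * ((m ⬝ᵥ Δ.ray i : ℤ) : ℝ) = 0 := by
  obtain ⟨c, hc, h⟩ := Δ.spanning (-∑ i, fun j => (Δ.ray i j : ℝ))
  have hpos : 0 < ∑ i, (1 + c i) :=
    Finset.sum_pos (fun i _ => by linarith [hc i]) Finset.univ_nonempty
  refine ⟨fun i => (1 + c i) / ∑ i, (1 + c i), fun i => ?_, ?_, fun m => ?_⟩
  · have := hc i
    positivity
  · rw [← Finset.sum_div, div_self hpos.ne']
  · have hj : ∀ j, ∑ i, (1 + c i) * (Δ.ray i j : ℝ) = 0 := by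
      intro j
      have := congrFun h j
      simp only [Pi.neg_apply, Finset.sum_apply, Pi.smul_apply, smul_eq_mul] at this
      simp only [add_mul, one_mul, Finset.sum_add_distrib]
      linarith
    have : ∑ i, (1 + c i) * ((m ⬝ᵥ Δ.ray i : ℤ) : ℝ) = 0 := by
      simp only [dotProduct, Int.cast_sum, Int.cast_mul, Finset.mul_sum]
      rw [Finset.sum_comm]
      refine Finset.sum_eq_zero fun j _ => ?_
      calc _ = (m j : ℝ) * ∑ i, (1 + c i) * (Δ.ray i j : ℝ) := by
            rw [Finset.mul_sum]; exact Finset.sum_congr rfl fun _ _ => by ring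
        _ = 0 := by rw [hj, mul_zero]
    simp_rw [div_mul_eq_mul_div]
    rw [← Finset.sum_div, this, zero_div]

/-- `u` is the generator of `μ_{l,m}^⊥ ∩ M` which is positive on `v_l`. -/
structure IsWallGenerator (Δ : SimplexFan n) (l m : Fin (n + 1)) (u : Fin n → ℤ) : Prop where
  eq_zero : ∀ i, i ≠ l → i ≠ m → u ⬝ᵥ Δ.ray i = 0
  pos : 0 < u ⬝ᵥ Δ.ray l
  exists_smul : ∀ m' : Fin n → ℤ, (∀ i, i ≠ l → i ≠ m → m' ⬝ᵥ Δ.ray i = 0) → ∃ c : ℤ, m' = c • u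

/-- Pairing with `v_l` embeds `μ_{l,m}^⊥ ∩ M` into `ℤ`, because the rays of `σ_m` determine a
character. So this group is cyclic. It is nonzero, because some character cuts the wall out of
`σ_m`; the sign of the generator is then adjusted. -/
lemma exists_isWallGenerator (Δ : SimplexFan n) {l m : Fin (n + 1)} (h : l ≠ m) :
    ∃ u, Δ.IsWallGenerator l m u := by
  let H : AddSubgroup (Fin n → ℤ) :=
    { carrier := {x | ∀ i, i ≠ l → i ≠ m → x ⬝ᵥ Δ.ray i = 0}
      zero_mem' := by simp
      add_mem' := fun ha hb i h1 h2 => by rw [add_dotProduct, ha i h1 h2, hb i h1 h2, add_zero]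
      neg_mem' := fun ha i h1 h2 => by rw [neg_dotProduct, ha i h1 h2, neg_zero] }
  let ev : (Fin n → ℤ) →+ ℤ :=
    { toFun := fun x => x ⬝ᵥ Δ.ray l
      map_zero' := by simp
      map_add' := fun a b => add_dotProduct _ _ _ }
  obtain ⟨a, ha⟩ := Int.subgroup_cyclic (H.map ev)
  have hwall : wall l m ≤ maxCone m := Finset.inter_subset_right
  obtain ⟨x, hx0, hx1⟩ := Δ.exists_face hwall
  have hxH : x ∈ H := fun i h1 h2 => hx0 i (by simp [wall, maxCone, h1, h2])
  have hxl : 0 < x ⬝ᵥ Δ.ray l := hx1 l (by simp [maxCone, h]) (by simp [wall, maxCone])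
  have haH : a ∈ H.map ev := by rw [ha]; exact AddSubgroup.subset_closure rfl
  obtain ⟨u₀, hu₀, hu₀a⟩ := haH
  have key : ∀ y ∈ H, ∃ c : ℤ, y = c • u₀ := by
    intro y hy
    have : ev y ∈ H.map ev := ⟨y, hy, rfl⟩
    rw [ha, AddSubgroup.mem_closure_singleton] at this
    obtain ⟨c, hc⟩ := this
    refine ⟨c, Δ.ext_of_dotProduct_ray m fun i hi => ?_⟩
    by_cases hil : i = l
    · subst hil
      change ev y = ev (c • u₀)
      rw [map_zsmul, hu₀a, hc]
    · rw [hy i hil hi, smul_dotProduct, hu₀ i hil hi, smul_zero]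
  obtain ⟨c, hc⟩ := key x hxH
  have hne : u₀ ⬝ᵥ Δ.ray l ≠ 0 := by
    intro h0
    rw [hc, smul_dotProduct, h0, smul_zero] at hxl
    exact lt_irrefl _ hxl
  rcases lt_or_gt_of_ne hne with hneg | hpos
  · refine ⟨-u₀, fun i h1 h2 => by rw [neg_dotProduct, hu₀ i h1 h2, neg_zero], ?_, fun y hy => ?_⟩
    · rw [neg_dotProduct]; omega
    · obtain ⟨c, rfl⟩ := key y hy
      exact ⟨-c, by simp⟩
  · exact ⟨u₀, hu₀, hpos, key⟩

/-- Only the terms of `l` and `m` survive when the relation `∑ w_i v_i = 0` is paired with `u`. -/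
lemma IsWallGenerator.weight_mul {Δ : SimplexFan n} {l m : Fin (n + 1)} (hlm : l ≠ m)
    {u : Fin n → ℤ} (h : Δ.IsWallGenerator l m u) {w : Fin (n + 1) → ℝ}
    (hw : ∀ m : Fin n → ℤ, ∑ i, w i * ((m ⬝ᵥ Δ.ray i : ℤ) : ℝ) = 0) :
    w l * (u ⬝ᵥ Δ.ray l : ℤ) = w m * (-(u ⬝ᵥ Δ.ray m) : ℤ) := by
  have := hw u
  rw [← Finset.add_sum_erase _ _ (Finset.mem_univ l),
    ← Finset.add_sum_erase _ _ (show m ∈ Finset.univ.erase l by simp [hlm.symm]),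
    Finset.sum_eq_zero (s := (Finset.univ.erase l).erase m)] at this
  · push_cast
    linarith
  · intro i hi
    simp only [Finset.mem_erase, Finset.mem_univ, and_true] at hi
    rw [h.eq_zero i hi.2 hi.1, Int.cast_zero, mul_zero]

/-- The degree of `r ∑ D_i` on `V(μ_{l,m})`, in terms of the weights. -/
lemma IsWallGenerator.mul_eq {Δ : SimplexFan n} {l m : Fin (n + 1)} (hlm : l ≠ m)
    {u : Fin n → ℤ} {w : Fin (n + 1) → ℝ} (hw1 : ∑ i, w i = 1)
    (hw : ∀ m : Fin n → ℤ, ∑ i, w i * ((m ⬝ᵥ Δ.ray i : ℤ) : ℝ) = 0)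
    {r : ℕ} {φ : Fin (n + 1) → Fin n → ℤ} (hφ : ∀ j i, i ≠ j → φ j ⬝ᵥ Δ.ray i = r)
    {s : ℤ} (hs : φ m - φ l = s • u) :
    (s : ℝ) * (u ⬝ᵥ Δ.ray l : ℤ) * w l = r := by
  -- Paired with `φ_l`, the relation reads `w_l ⟨φ_l, v_l⟩ + (1 - w_l) r = 0`. It is combined with
  -- `r - ⟨φ_l, v_l⟩ = s ⟨u, v_l⟩`, which is `φ_m - φ_l = s u` evaluated at `v_l`.
  have h1 := hw (φ l)
  rw [← Finset.add_sum_erase _ _ (Finset.mem_univ l),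
    Finset.sum_congr rfl (g := fun i => w i * (r : ℝ))] at h1
  · rw [← Finset.add_sum_erase _ _ (Finset.mem_univ l)] at hw1
    rw [← Finset.sum_mul] at h1
    have h2 := congrArg (fun x => x ⬝ᵥ Δ.ray l) hs
    simp only [sub_dotProduct, smul_dotProduct, hφ m l hlm, smul_eq_mul] at h2
    have h3 : (r : ℝ) - (φ l ⬝ᵥ Δ.ray l : ℤ) = s * (u ⬝ᵥ Δ.ray l : ℤ) := by exact_mod_cast h2
    have h4 : ∑ x ∈ Finset.univ.erase l, w x = 1 - w l := by linarith
    rw [h4] at h1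
    rw [← h3]
    linarith
  · intro i hi
    rw [hφ l i (Finset.ne_of_mem_erase hi)]
    simp

/-- The fan of projective space: `v_0 + ⋯ + v_n = 0` and the `v_i` generate `N`. -/
structure IsUnimodular (Δ : SimplexFan n) : Prop where
  sum_ray : ∑ i, Δ.ray i = 0
  exists_dotProduct : ∀ α : Fin (n + 1) → ℤ, ∑ i, α i = 0 →
    ∃ m : Fin n → ℤ, ∀ i, m ⬝ᵥ Δ.ray i = α i

/-- The arithmetic core. The first alternative is the desired degree bound rewritten through
`IsWallGenerator.mul_eq`; its failure at all walls leaves only the fan of projective space. -/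
lemma exists_wall_or_isUnimodular (Δ : SimplexFan n) {w : Fin (n + 1) → ℝ}
    (hpos : ∀ i, 0 < w i) (hw1 : ∑ i, w i = 1)
    (hw : ∀ m : Fin n → ℤ, ∑ i, w i * ((m ⬝ᵥ Δ.ray i : ℤ) : ℝ) = 0) :
    (∃ l m u, l ≠ m ∧ Δ.IsWallGenerator l m u ∧ 1 ≤ n * ((u ⬝ᵥ Δ.ray l : ℤ) * w l)) ∨
      Δ.IsUnimodular := by
  rw [or_iff_not_imp_left]
  intro hcon
  push Not at hcon
  have hn : (1 : ℝ) ≤ n := by exact_mod_cast Δ.dim_pos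
  obtain ⟨l, hl⟩ := Finite.exists_max w
  have hbig : ∀ l', (∀ i, w i ≤ w l') → 1 ≤ (n + 1) * w l' := by
    intro l' h
    calc 1 = ∑ i, w i := hw1.symm
      _ ≤ ∑ _i : Fin (n + 1), w l' := Finset.sum_le_sum fun i _ => h i
      _ = _ := by simp
  -- A pairing of at least `2` would give `⟨u, v_{l'}⟩ w_{l'} ≥ 2/(n+1) ≥ 1/n`. This holds for every
  -- index of maximal weight, and is used again once all weights are known to be equal.
  have hone : ∀ l', (∀ i, w i ≤ w l') → ∀ m u, l' ≠ m → Δ.IsWallGenerator l' m u →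
      u ⬝ᵥ Δ.ray l' = 1 := by
    intro l' h m u hlm hu
    have h1 := hcon l' m u hlm hu
    have h2 := hbig l' h
    by_contra hne
    have h3 : (2 : ℤ) ≤ u ⬝ᵥ Δ.ray l' := by have := hu.pos; omega
    have h4 : (2 : ℝ) ≤ (u ⬝ᵥ Δ.ray l' : ℤ) := by exact_mod_cast h3
    have h5 := hpos l'
    have h6 : 2 * w l' ≤ (u ⬝ᵥ Δ.ray l' : ℤ) * w l' := by gcongr
    nlinarith
  -- The integer `b` is `-⟨u, v_m⟩`, positive because both weights are.
  have hb : ∀ m, m ≠ l → ∃ b : ℤ, 1 ≤ b ∧ w l = w m * b := by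
    intro m hm
    obtain ⟨u, hu⟩ := Δ.exists_isWallGenerator hm.symm
    have h1 := hu.weight_mul hm.symm hw
    rw [hone l hl m u hm.symm hu, Int.cast_one, mul_one] at h1
    refine ⟨_, ?_, h1⟩
    by_contra hlt
    have h2 : (-(u ⬝ᵥ Δ.ray m) : ℤ) ≤ 0 := by omega
    have h3 : ((-(u ⬝ᵥ Δ.ray m) : ℤ) : ℝ) ≤ 0 := by exact_mod_cast h2
    nlinarith [hpos l, hpos m]
  have hlt : n * w l < 1 := by
    have hne : l ≠ l + 1 := by
      have := Δ.dim_pos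
      obtain ⟨n', rfl⟩ := Nat.exists_eq_succ_of_ne_zero this.ne'
      intro h
      have : (1 : Fin (n' + 1 + 1)) = 0 := by simpa using h.symm
      simp at this
    obtain ⟨u, hu⟩ := Δ.exists_isWallGenerator hne
    have := hcon l _ u hne hu
    rwa [hone l hl _ u hne hu, Int.cast_one, one_mul] at this
  have hall : ∀ m, w m = w l := by
    by_contra! hex
    obtain ⟨m₀, hm₀⟩ := hex
    have half : ∀ m, w m ≠ w l → w m ≤ w l / 2 := by
      intro m hm
      obtain ⟨b, hb1, hb2⟩ := hb m (fun h => hm (h ▸ rfl))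
      have h2 : (2 : ℤ) ≤ b := by
        by_contra h
        obtain rfl : b = 1 := by omega
        exact hm (by rw [hb2, Int.cast_one, mul_one])
      have h3 : (2 : ℝ) ≤ b := by exact_mod_cast h2
      nlinarith [hpos m]
    -- Two weights of at most `w_l / 2` lower the total by at least `w_l` from `(n + 1) w_l`, so `1
    -- ≤ n w_l`, against `hlt`.
    have hrest : ∀ m, m ≠ m₀ → w m = w l := by
      intro m hm
      by_contra h
      have h1 : ∑ i, (w l - w i) = (n + 1) * w l - 1 := by
        rw [Finset.sum_sub_distrib, hw1]; simp
      have h2 : (w l - w m₀) + (w l - w m) ≤ ∑ i, (w l - w i) := by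
        rw [← Finset.sum_pair (f := fun i => w l - w i) hm.symm]
        exact Finset.sum_le_sum_of_subset_of_nonneg (Finset.subset_univ _)
          fun i _ _ => sub_nonneg.mpr (hl i)
      linarith [half m₀ hm₀, half m h]
    obtain ⟨b, hb1, hb2⟩ := hb m₀ (fun h => hm₀ (h ▸ rfl))
    -- With all other weights equal to `w_l = b w_{m₀}`, the relation divided by `w_{m₀}` exhibits
    -- `v_{m₀}` as `b` times a lattice vector. Primitivity then gives `b = ±1`, and both signs are
    -- impossible.
    have hray : Δ.ray m₀ = b • (-∑ i ∈ Finset.univ.erase m₀, Δ.ray i) := by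
      funext j
      have h1 := hw (Pi.single j 1)
      simp only [single_dotProduct, one_mul] at h1
      rw [← Finset.add_sum_erase _ _ (Finset.mem_univ m₀),
        Finset.sum_congr rfl (g := fun i => w m₀ * (b * (Δ.ray i j : ℝ))), ← Finset.mul_sum,
        ← mul_add, mul_eq_zero, or_iff_right (hpos m₀).ne', ← Finset.mul_sum] at h1
      · have h2 : Δ.ray m₀ j + b * ∑ i ∈ Finset.univ.erase m₀, Δ.ray i j = 0 := by
          exact_mod_cast h1
        simp only [Pi.smul_apply, Pi.neg_apply, Finset.sum_apply, smul_eq_mul]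
        linarith
      · intro i hi
        rw [hrest i (Finset.ne_of_mem_erase hi), hb2, mul_assoc]
    have := Δ.primitive m₀ b _ hray
    rcases Int.isUnit_iff.mp this with rfl | rfl
    · exact hm₀ (by simpa using hb2.symm)
    · omega
  refine ⟨?_, fun α hα => ?_⟩
  · funext j
    have h1 := hw (Pi.single j 1)
    simp only [single_dotProduct, one_mul, hall] at h1
    rw [← Finset.mul_sum, mul_eq_zero, or_iff_right (hpos l).ne'] at h1
    rw [Finset.sum_apply]
    exact_mod_cast h1
  -- The generators for the walls omitting `v_0` and `v_{t+1}` form a basis dual to `v_1, …, v_n`,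
  -- with value `-1` on `v_0`. Hence `∑ α_{t+1} u_t` realises `α`, the condition `∑ α_i = 0` taking
  -- care of index `0`.
  · choose u hu using fun t : Fin n => Δ.exists_isWallGenerator (Fin.succ_ne_zero t)
    have hu1 : ∀ t, u t ⬝ᵥ Δ.ray t.succ = 1 := fun t =>
      hone _ (fun i => by rw [hall i, hall t.succ]) 0 _ (Fin.succ_ne_zero t) (hu t)
    have hu2 : ∀ t, u t ⬝ᵥ Δ.ray 0 = -1 := fun t => by
      have := (hu t).weight_mul (Fin.succ_ne_zero t) hw
      rw [hall, hall 0, hu1] at this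
      have h2 := mul_left_cancel₀ (hpos l).ne' this
      have h3 : (1 : ℤ) = -(u t ⬝ᵥ Δ.ray 0) := by exact_mod_cast h2
      omega
    refine ⟨∑ t, α t.succ • u t, fun i => ?_⟩
    rw [sum_dotProduct]
    simp only [smul_dotProduct, smul_eq_mul]
    induction i using Fin.cases with
    | zero =>
      simp only [hu2]
      rw [Fin.sum_univ_succ] at hα
      simp only [mul_neg, mul_one, Finset.sum_neg_distrib]
      omega
    | succ i =>
      rw [Finset.sum_eq_single i, hu1, mul_one]
      · intro t _ ht
        rw [(hu t).eq_zero i.succ (fun h => ht (Fin.succ_injective _ h).symm)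
          (Fin.succ_ne_zero i), mul_zero]
      · simp

end SimplexFan

/-! ### Local rings of a scheme through an affine chart. -/

namespace ToricGeometry

variable {R R' : Type u} [CommRing R] [CommRing R'] {X : Scheme.{u}}

/-- For an affine chart `g : Spec R ⟶ X` and a point `z` in it, the map `R → 𝒪_{X,z}`. -/
noncomputable def chartToStalk (g : Spec (.of R) ⟶ X) [IsOpenImmersion g] (z : X)
    (hz : z ∈ g ''ᵁ ⊤) : R →+* X.presheaf.stalk z :=
  ((Scheme.ΓSpecIso (.of R)).inv ≫ (g.appIso ⊤).inv ≫ X.presheaf.germ (g ''ᵁ ⊤) z hz).hom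

/-- The point of `X` given by a prime ideal of the ring of an affine chart `g : Spec R ⟶ X`. -/
noncomputable def chartPoint (g : Spec (.of R) ⟶ X) (y : PrimeSpectrum R) : X :=
  g (show Spec (.of R) from y)

lemma chartPoint_mem (g : Spec (.of R) ⟶ X) [IsOpenImmersion g] (y : PrimeSpectrum R) :
    chartPoint g y ∈ g ''ᵁ ⊤ := ⟨y, trivial, rfl⟩

lemma exists_chartPoint {g : Spec (.of R) ⟶ X} [IsOpenImmersion g] {z : X} (hz : z ∈ g ''ᵁ ⊤) :
    ∃ y, chartPoint g y = z := by
  obtain ⟨y, -, hy⟩ := hz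
  exact ⟨y, hy⟩

lemma stalkSpecializes_chartToStalk (g : Spec (.of R) ⟶ X) [IsOpenImmersion g] {z z' : X}
    (h : z' ⤳ z) (hz : z ∈ g ''ᵁ ⊤) (hz' : z' ∈ g ''ᵁ ⊤) (r : R) :
    (X.presheaf.stalkSpecializes h).hom (chartToStalk g z hz r) = chartToStalk g z' hz' r := by
  rw [chartToStalk, chartToStalk, ← CommRingCat.comp_apply, Category.assoc, Category.assoc,
    TopCat.Presheaf.germ_stalkSpecializes]

lemma chartToStalk_comp (g : Spec (.of R) ⟶ X) [IsOpenImmersion g]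
    (g' : Spec (.of R') ⟶ X) [IsOpenImmersion g'] (φ : R →+* R')
    (h : Spec.map (CommRingCat.ofHom φ) ≫ g = g') (z : X) (hz : z ∈ g ''ᵁ ⊤)
    (hz' : z ∈ g' ''ᵁ ⊤) (r : R) :
    chartToStalk g' z hz' (φ r) = chartToStalk g z hz r := by
  have hle : g' ''ᵁ ⊤ ≤ g ''ᵁ ⊤ := by
    rintro _ ⟨y, -, rfl⟩
    refine ⟨Spec.map (CommRingCat.ofHom φ) y, trivial, ?_⟩
    rw [← h]; rfl
  have key : CommRingCat.ofHom φ ≫ (Scheme.ΓSpecIso (.of R')).inv ≫ (g'.appIso ⊤).inv =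
      (Scheme.ΓSpecIso (.of R)).inv ≫ (g.appIso ⊤).inv ≫ X.presheaf.map (homOfLE hle).op := by
    rw [← cancel_mono (g'.appIso ⊤).hom]
    simp only [Category.assoc, Iso.inv_hom_id, Category.comp_id]
    subst h
    rw [Scheme.Hom.appIso_hom', Scheme.Hom.map_appLE,
      ← Scheme.Hom.appLE_comp_appLE _ g (g ''ᵁ ⊤) ⊤ ⊤ (Scheme.Hom.preimage_image_eq g ⊤).ge le_top,
      ← Scheme.Hom.appIso_hom', Iso.inv_hom_id_assoc, Scheme.ΓSpecIso_inv_naturality]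
    congr 1
  rw [chartToStalk, chartToStalk, ← X.presheaf.germ_res (homOfLE hle) z hz']
  have := congrArg (fun f => (f ≫ X.presheaf.germ (g' ''ᵁ ⊤) z hz').hom r) key
  simp only [Category.assoc] at this
  exact this

lemma chartToStalk_stalkMap (g : Spec (.of R) ⟶ X) [IsOpenImmersion g] (y : Spec (.of R)) :
    CommRingCat.ofHom (chartToStalk g (g y) (chartPoint_mem g y)) ≫ g.stalkMap y =
      StructureSheaf.toStalk R y := by
  have hy : g y ∈ g ''ᵁ ⊤ := chartPoint_mem g y
  have hy' : y ∈ g ⁻¹ᵁ g ''ᵁ ⊤ := chartPoint_mem g y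
  have h2 := (Spec (.of R)).presheaf.germ_res (eqToHom (Scheme.Hom.preimage_image_eq g ⊤)) y hy'
  calc _ = (Scheme.ΓSpecIso (.of R)).inv ≫ (g.appIso ⊤).inv ≫
        X.presheaf.germ (g ''ᵁ ⊤) (g y) hy ≫ g.stalkMap y := by
        change (_ ≫ _ ≫ _) ≫ _ = _
        rw [Category.assoc, Category.assoc]
    _ = (Scheme.ΓSpecIso (.of R)).inv ≫ (g.appIso ⊤).inv ≫ g.app (g ''ᵁ ⊤) ≫
        (Spec (.of R)).presheaf.germ (g ⁻¹ᵁ g ''ᵁ ⊤) y hy' := by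
        rw [Scheme.Hom.germ_stalkMap]
    _ = (Scheme.ΓSpecIso (.of R)).inv ≫
        (Spec (.of R)).presheaf.map (eqToHom (Scheme.Hom.preimage_image_eq g ⊤)).op ≫
        (Spec (.of R)).presheaf.germ (g ⁻¹ᵁ g ''ᵁ ⊤) y hy' := by
        rw [Scheme.Hom.appIso_inv_app_assoc]
    _ = _ := congrArg ((Scheme.ΓSpecIso (.of R)).inv ≫ ·) h2

/-- An open immersion induces isomorphisms of stalks, so the known localization `𝒪_{Spec R, y} =
R_y` is transported along `stalkMap`. -/
lemma isLocalization_chartToStalk_of_prime (g : Spec (.of R) ⟶ X) [IsOpenImmersion g]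
    (y : PrimeSpectrum R) :
    letI := (chartToStalk g (chartPoint g y) (chartPoint_mem g y)).toAlgebra
    IsLocalization.AtPrime (X.presheaf.stalk (chartPoint g y)) y.asIdeal := by
  let y' : Spec (.of R) := y
  let _ := (chartToStalk g (g y') (chartPoint_mem g y)).toAlgebra
  refine (IsLocalization.isLocalization_iff_of_ringEquiv (S := X.presheaf.stalk (g y'))
    y.asIdeal.primeCompl (asIso (g.stalkMap y')).commRingCatIsoToRingEquiv).mpr ?_
  have h := congrArg CommRingCat.Hom.hom (chartToStalk_stalkMap g y')
  -- Quantifying over `f` lets the algebra structure be replaced by substitution, as the two ring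
  -- maps are equal only propositionally.
  have h2 : ∀ f : R →+* (Spec (.of R)).presheaf.stalk y', f = (StructureSheaf.toStalk R y').hom →
      @IsLocalization R _ y.asIdeal.primeCompl ((Spec (.of R)).presheaf.stalk y') _
        f.toAlgebra := by
    rintro _ rfl
    exact StructureSheaf.IsLocalization.to_stalk R y
  exact h2 _ h

lemma comap_maximalIdeal_chartToStalk (g : Spec (.of R) ⟶ X) [IsOpenImmersion g]
    (y : PrimeSpectrum R) :
    (IsLocalRing.maximalIdeal (X.presheaf.stalk (chartPoint g y))).comap
      (chartToStalk g (chartPoint g y) (chartPoint_mem g y)) = y.asIdeal := by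
  let _ := (chartToStalk g (chartPoint g y) (chartPoint_mem g y)).toAlgebra
  have := isLocalization_chartToStalk_of_prime g y
  exact IsLocalization.AtPrime.under_maximalIdeal (X.presheaf.stalk (chartPoint g y)) y.asIdeal

lemma isUnit_chartToStalk_iff (g : Spec (.of R) ⟶ X) [IsOpenImmersion g]
    (y : PrimeSpectrum R) (r : R) :
    IsUnit (chartToStalk g (chartPoint g y) (chartPoint_mem g y) r) ↔ r ∉ y.asIdeal := by
  rw [← comap_maximalIdeal_chartToStalk g y, Ideal.mem_comap, IsLocalRing.mem_maximalIdeal,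
    mem_nonunits_iff, not_not]

lemma isLocalization_chartToStalk (g : Spec (.of R) ⟶ X) [IsOpenImmersion g]
    (z : X) (hz : z ∈ g ''ᵁ ⊤) :
    letI := (chartToStalk g z hz).toAlgebra
    IsLocalization.AtPrime (X.presheaf.stalk z)
      ((IsLocalRing.maximalIdeal (X.presheaf.stalk z)).comap (chartToStalk g z hz)) := by
  obtain ⟨y, rfl⟩ := exists_chartPoint hz
  have := isLocalization_chartToStalk_of_prime g y
  convert this
  exact comap_maximalIdeal_chartToStalk g y

lemma exists_chartToStalk_mul (g : Spec (.of R) ⟶ X) [IsOpenImmersion g]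
    (z : X) (hz : z ∈ g ''ᵁ ⊤) (a : X.presheaf.stalk z) :
    ∃ f s : R, IsUnit (chartToStalk g z hz s) ∧
      a * chartToStalk g z hz s = chartToStalk g z hz f := by
  let _ := (chartToStalk g z hz).toAlgebra
  have := isLocalization_chartToStalk g z hz
  obtain ⟨⟨f, s⟩, h⟩ := IsLocalization.surj
    ((IsLocalRing.maximalIdeal (X.presheaf.stalk z)).comap (chartToStalk g z hz)).primeCompl a
  exact ⟨f, s, IsLocalization.map_units (X.presheaf.stalk z) s, h⟩

lemma chartPoint_specializes_iff (g : Spec (.of R) ⟶ X) [IsOpenImmersion g]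
    (y y' : PrimeSpectrum R) : chartPoint g y' ⤳ chartPoint g y ↔ y'.asIdeal ≤ y.asIdeal :=
  (g.isOpenEmbedding.isInducing.specializes_iff).trans (PrimeSpectrum.le_iff_specializes _ _).symm

lemma chartPoint_comp (g : Spec (.of R) ⟶ X) (g' : Spec (.of R') ⟶ X) (φ : R →+* R')
    (h : Spec.map (CommRingCat.ofHom φ) ≫ g = g') (y : PrimeSpectrum R') :
    chartPoint g' y = chartPoint g (y.comap φ) := by
  subst h
  rfl

lemma chartToStalk_algebraMap {k : Type u} [Field k] [Algebra k R] (g : Spec (.of R) ⟶ X)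
    [IsOpenImmersion g] (f : X ⟶ Spec (.of k))
    (h : g ≫ f = Spec.map (CommRingCat.ofHom (algebraMap k R))) (z : X) (hz : z ∈ g ''ᵁ ⊤) (a : k) :
    chartToStalk g z hz (algebraMap k R a) = baseToStalk f z a := by
  have key : CommRingCat.ofHom (algebraMap k R) ≫ (Scheme.ΓSpecIso (.of R)).inv ≫
      (g.appIso ⊤).inv = (Scheme.ΓSpecIso (.of k)).inv ≫ f.appTop ≫
        X.presheaf.map (homOfLE le_top).op := by
    rw [← cancel_mono (g.appIso ⊤).hom]
    simp only [Category.assoc, Iso.inv_hom_id, Category.comp_id]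
    rw [Scheme.ΓSpecIso_inv_naturality, ← h, Scheme.Hom.appIso_hom', Scheme.Hom.map_appLE,
      Scheme.Hom.comp_appTop]
    congr 2
  rw [chartToStalk, baseToStalk, ← X.presheaf.germ_res (homOfLE le_top) z hz]
  have := congrArg (fun f => (f ≫ X.presheaf.germ (g ''ᵁ ⊤) z hz).hom a) key
  simp only [Category.assoc] at this
  exact this

end ToricGeometry

/-! ### Charts of the toric variety and their intersections. -/

namespace SimplexFan

open ToricGeometry

variable {n : ℕ} (k : Type u) [Field k]

section Charts

variable (Δ : SimplexFan n)

instance (I : Cone n) : IsOpenImmersion (Δ.chartι k I) :=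
  inferInstanceAs (IsOpenImmersion (colimit.ι (Δ.charts k) I))

/-- The chart `U_I` as an open subset of `X(Δ)`. -/
noncomputable abbrev chartOpen (I : Cone n) : (Δ.toricVariety k).Opens := Δ.chartι k I ''ᵁ ⊤

lemma chartι_comp {I J : Cone n} (h : I ≤ J) :
    Spec.map (CommRingCat.ofHom (Δ.chartRingMap k h).toRingHom) ≫ Δ.chartι k J = Δ.chartι k I :=
  colimit.w (Δ.charts k) (homOfLE h)

lemma chartι_toSpec (I : Cone n) :
    Δ.chartι k I ≫ Δ.toSpec k = Spec.map (CommRingCat.ofHom (algebraMap k (Δ.chartRing k I))) :=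
  colimit.ι_desc _ _

variable {k Δ}

lemma chartOpen_mono {I J : Cone n} (h : I ≤ J) : Δ.chartOpen k I ≤ Δ.chartOpen k J := by
  rintro _ ⟨y, -, rfl⟩
  change Δ.chartι k I y ∈ Δ.chartOpen k J
  rw [← Δ.chartι_comp k h]
  exact ⟨_, trivial, rfl⟩

lemma exists_mem_chartOpen (z : Δ.toricVariety k) : ∃ I, z ∈ Δ.chartOpen k I := by
  obtain ⟨I, y, rfl⟩ := Scheme.IsLocallyDirected.ι_jointly_surjective (Δ.charts k) z
  exact ⟨I, y, trivial, rfl⟩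

lemma exists_le_maxCone (I : Cone n) : ∃ j, I ≤ maxCone j := by
  obtain ⟨j, hj⟩ : ∃ j, j ∉ I.1 := by
    by_contra! hc
    exact I.2 (Finset.eq_univ_iff_forall.mpr hc)
  refine ⟨j, fun i hi => ?_⟩
  simp only [maxCone, Finset.mem_compl, Finset.mem_singleton]
  rintro rfl
  exact hj hi

lemma exists_mem_maxCone (z : Δ.toricVariety k) : ∃ j, z ∈ Δ.chartOpen k (maxCone j) := by
  obtain ⟨I, hI⟩ := exists_mem_chartOpen z
  obtain ⟨j, hj⟩ := exists_le_maxCone I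
  exact ⟨j, chartOpen_mono hj hI⟩

/-- Points of two charts that become equal after gluing come from a common smaller chart `U_L`, with
`L` contained in both index sets and hence in `K`. -/
lemma mem_chartOpen_of_inter {z : Δ.toricVariety k} {I J K : Cone n} (hI : z ∈ Δ.chartOpen k I)
    (hJ : z ∈ Δ.chartOpen k J) (hK : ∀ i ∈ I.1, i ∈ J.1 → i ∈ K.1) : z ∈ Δ.chartOpen k K := by
  obtain ⟨y, -, rfl⟩ := hI
  obtain ⟨y', -, h⟩ := hJ
  obtain ⟨L, fi, fj, x, rfl, -⟩ :=
    (Scheme.IsLocallyDirected.ι_eq_ι_iff (Δ.charts k) (xi := y) (xj := y')).mp h.symm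
  refine chartOpen_mono (fun i hi => hK i (leOfHom fi hi) (leOfHom fj hi)) ⟨x, trivial, ?_⟩
  change colimit.ι (Δ.charts k) L x = colimit.ι (Δ.charts k) I _
  rw [← Scheme.Hom.comp_apply, colimit.w]

variable (Δ) in
/-- The map `k[σ_I^∨ ∩ M] → 𝒪_{X,z}` for a point `z` of the chart `U_I`. -/
noncomputable def toStalk (I : Cone n) (z : Δ.toricVariety k) (hz : z ∈ Δ.chartOpen k I) :
    Δ.chartRing k I →+* (Δ.toricVariety k).presheaf.stalk z :=
  chartToStalk (Δ.chartι k I) z hz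

lemma toStalk_chartRingMap {I J : Cone n} (h : I ≤ J) {z : Δ.toricVariety k}
    (hz : z ∈ Δ.chartOpen k I) (f : Δ.chartRing k J) :
    Δ.toStalk I z hz (Δ.chartRingMap k h f) = Δ.toStalk J z (chartOpen_mono h hz) f :=
  chartToStalk_comp (Δ.chartι k J) (Δ.chartι k I) (Δ.chartRingMap k h).toRingHom
    (Δ.chartι_comp k h) z _ hz f

lemma toStalk_algebraMap {I : Cone n} {z : Δ.toricVariety k} (hz : z ∈ Δ.chartOpen k I) (a : k) :
    Δ.toStalk I z hz (algebraMap k _ a) = baseToStalk (Δ.toSpec k) z a :=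
  chartToStalk_algebraMap (Δ.chartι k I) (Δ.toSpec k) (Δ.chartι_toSpec k I) z hz a

lemma isUnit_single {I : Cone n} {m : Δ.dualMonoid I} (hm : ∀ i ∈ I.1, m.1 ⬝ᵥ Δ.ray i = 0) :
    IsUnit (AddMonoidAlgebra.single m 1 : Δ.chartRing k I) := by
  have hneg : -m.1 ∈ Δ.dualMonoid I := by
    intro i hi
    rw [neg_dotProduct, hm i hi, neg_zero]
  refine IsUnit.of_mul_eq_one (AddMonoidAlgebra.single ⟨-m.1, hneg⟩ 1) ?_
  rw [AddMonoidAlgebra.single_mul_single, AddMonoidAlgebra.one_def]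
  congr 1
  · ext1; simp
  · simp

/-- A character vanishing on `σ_K` and positive on the remaining rays of `σ_I` has `U_K` as its
nonvanishing locus in `U_I`. -/
lemma mem_chartOpen_of_isUnit {I K : Cone n} (h : K ≤ I) {m : Δ.dualMonoid I}
    (h0 : ∀ i ∈ K.1, m.1 ⬝ᵥ Δ.ray i = 0) (hm : ∀ i ∈ I.1, i ∉ K.1 → 0 < m.1 ⬝ᵥ Δ.ray i)
    {z : Δ.toricVariety k} (hz : z ∈ Δ.chartOpen k I)
    (hu : IsUnit (Δ.toStalk I z hz (AddMonoidAlgebra.single m 1))) : z ∈ Δ.chartOpen k K := by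
  obtain ⟨y, rfl⟩ := exists_chartPoint hz
  have h1 := (isUnit_chartToStalk_iff (Δ.chartι k I) y _).mp hu
  have h2 := Δ.range_charts_map k (homOfLE h) m h0 hm
  have h3 : y ∈ {x : PrimeSpectrum (Δ.chartRing k I) |
      (AddMonoidAlgebra.single m 1 : Δ.chartRing k I) ∉ x.asIdeal} := h1
  rw [← h2] at h3
  obtain ⟨x, hx⟩ := h3
  refine ⟨x, trivial, ?_⟩
  change colimit.ι (Δ.charts k) K x = Δ.chartι k I _
  rw [← colimit.w (Δ.charts k) (homOfLE h), Scheme.Hom.comp_apply, hx]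
  rfl

end Charts

/-! ### Orbit closures and their generic points. -/

section Faces

variable (Δ : SimplexFan n)

/-- Nonnegative integers add up to zero only if both are zero. Thus `K^⊥` is a face of the
semigroup, which makes `faceHom` multiplicative. -/
lemma eq_zero_of_add {I K : Cone n} (h : K ≤ I) (m m' : Δ.dualMonoid I) :
    (∀ i ∈ K.1, (m + m').1 ⬝ᵥ Δ.ray i = 0) ↔
      (∀ i ∈ K.1, m.1 ⬝ᵥ Δ.ray i = 0) ∧ ∀ i ∈ K.1, m'.1 ⬝ᵥ Δ.ray i = 0 := by
  rw [← forall₂_and]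
  refine forall₂_congr fun i hi => ?_
  have h1 := m.2 i (h hi)
  have h2 := m'.2 i (h hi)
  change (m.1 + m'.1) ⬝ᵥ _ = 0 ↔ _
  rw [add_dotProduct]
  omega

open Classical in
/-- The restriction of functions on `U_I` to the closure in `U_I` of the orbit of `σ_K`:
the characters which are not orthogonal to `σ_K` are sent to zero. -/
noncomputable def faceHom {I K : Cone n} (h : K ≤ I) :
    Δ.chartRing k I →ₐ[k] AddMonoidAlgebra k (Fin n → ℤ) :=
  AddMonoidAlgebra.lift k (AddMonoidAlgebra k (Fin n → ℤ)) (Δ.dualMonoid I)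
    { toFun := fun m => if ∀ i ∈ K.1, m.toAdd.1 ⬝ᵥ Δ.ray i = 0 then
        AddMonoidAlgebra.single m.toAdd.1 1 else 0
      map_one' := by
        rw [if_pos]
        · rfl
        · exact fun i _ => zero_dotProduct _
      map_mul' := fun a b => by
        rw [toAdd_mul]
        simp only [Δ.eq_zero_of_add h]
        by_cases h1 : ∀ i ∈ K.1, a.toAdd.1 ⬝ᵥ Δ.ray i = 0
        · by_cases h2 : ∀ i ∈ K.1, b.toAdd.1 ⬝ᵥ Δ.ray i = 0
          · rw [if_pos ⟨h1, h2⟩, if_pos h1, if_pos h2, AddMonoidAlgebra.single_mul_single, one_mul]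
            rfl
          · rw [if_neg (fun h => h2 h.2), if_neg h2, mul_zero]
        · rw [if_neg (fun h => h1 h.1), if_neg h1, zero_mul] }

open Classical in
lemma faceHom_single {I K : Cone n} (h : K ≤ I) (m : Δ.dualMonoid I) (a : k) :
    Δ.faceHom k h (AddMonoidAlgebra.single m a) =
      if ∀ i ∈ K.1, m.1 ⬝ᵥ Δ.ray i = 0 then AddMonoidAlgebra.single m.1 a else 0 := by
  rw [faceHom, AddMonoidAlgebra.lift_single]
  change a • (if ∀ i ∈ K.1, m.1 ⬝ᵥ Δ.ray i = 0 then
        (AddMonoidAlgebra.single m.1 1 : AddMonoidAlgebra k (Fin n → ℤ)) else 0) = _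
  split_ifs
  · simp
  · simp

lemma faceHom_single_of_forall {I K : Cone n} (h : K ≤ I) {m : Δ.dualMonoid I} (a : k)
    (hm : ∀ i ∈ K.1, m.1 ⬝ᵥ Δ.ray i = 0) :
    Δ.faceHom k h (AddMonoidAlgebra.single m a) = AddMonoidAlgebra.single m.1 a := by
  classical rw [faceHom_single, if_pos hm]

lemma faceHom_single_of_exists {I K : Cone n} (h : K ≤ I) {m : Δ.dualMonoid I} (a : k)
    (hm : ∃ i ∈ K.1, m.1 ⬝ᵥ Δ.ray i ≠ 0) :
    Δ.faceHom k h (AddMonoidAlgebra.single m a) = 0 := by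
  classical
  rw [faceHom_single, if_neg]
  push Not
  exact hm

lemma faceHom_chartRingMap {I J K : Cone n} (h : K ≤ I) (h' : I ≤ J) (f : Δ.chartRing k J) :
    Δ.faceHom k h (Δ.chartRingMap k h' f) = Δ.faceHom k (h.trans h') f := by
  classical
  induction f using AddMonoidAlgebra.induction_linear with
  | zero => simp
  | add f g hf hg => rw [map_add, map_add, map_add, hf, hg]
  | single m a =>
    rw [chartRingMap_single, faceHom_single, faceHom_single]
    rfl

/-- An ideal which contains the characters not orthogonal to `σ_K` contains all functions
vanishing on the orbit closure of `σ_K`. -/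
lemma mem_of_faceHom_eq_zero {I K : Cone n} (h : K ≤ I) {P : Ideal (Δ.chartRing k I)}
    (hP : ∀ m : Δ.dualMonoid I, (∃ i ∈ K.1, m.1 ⬝ᵥ Δ.ray i ≠ 0) →
      AddMonoidAlgebra.single m 1 ∈ P)
    {f : Δ.chartRing k I} (hf : Δ.faceHom k h f = 0) : f ∈ P := by
  -- Each `f` splits into terms not orthogonal to `σ_K`, which lie in `P`, and a rest `f₀` that
  -- `faceHom` merely views in `k[M]`. The latter inclusion is injective, so `f₀ = 0` when `faceHom`
  -- kills `f`.
  have key : ∀ f : Δ.chartRing k I, ∃ g ∈ P, ∃ f₀ : Δ.chartRing k I, f = g + f₀ ∧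
      AddMonoidAlgebra.mapDomainRingHom k (Δ.dualMonoid I).subtype f₀ = Δ.faceHom k h f := by
    intro f
    induction f using AddMonoidAlgebra.induction_linear with
    | zero => exact ⟨0, P.zero_mem, 0, by simp, by simp⟩
    | add f f' hf hf' =>
      obtain ⟨g, hg, f₀, rfl, hf₀⟩ := hf
      obtain ⟨g', hg', f₀', rfl, hf₀'⟩ := hf'
      exact ⟨g + g', P.add_mem hg hg', f₀ + f₀', by ring, by rw [map_add, hf₀, hf₀', ← map_add]⟩
    | single m a =>
      by_cases hm : ∀ i ∈ K.1, m.1 ⬝ᵥ Δ.ray i = 0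
      · refine ⟨0, P.zero_mem, AddMonoidAlgebra.single m a, by simp, ?_⟩
        rw [Δ.faceHom_single_of_forall k h a hm]
        simp
      · push Not at hm
        refine ⟨AddMonoidAlgebra.single m a, ?_, 0, by simp, ?_⟩
        · have := P.mul_mem_left (algebraMap k _ a) (hP m hm)
          simpa [AddMonoidAlgebra.single_mul_single] using this
        · rw [Δ.faceHom_single_of_exists k h a hm, map_zero]
  obtain ⟨g, hg, f₀, rfl, hf₀⟩ := key f
  rw [hf] at hf₀
  have : f₀ = 0 := AddMonoidAlgebra.mapDomain_injective Subtype.val_injective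
    (hf₀.trans (map_zero (AddMonoidAlgebra.mapDomainRingHom k (Δ.dualMonoid I).subtype)).symm)
  rwa [this, add_zero]

/-- The prime ideal of the orbit closure of `σ_K` in the chart `U_I`. -/
noncomputable def facePrime {I K : Cone n} (h : K ≤ I) : PrimeSpectrum (Δ.chartRing k I) :=
  ⟨RingHom.ker (Δ.faceHom k h), RingHom.ker_isPrime _⟩

lemma mem_facePrime {I K : Cone n} (h : K ≤ I) (f : Δ.chartRing k I) :
    f ∈ (Δ.facePrime k h).asIdeal ↔ Δ.faceHom k h f = 0 := RingHom.mem_ker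

/-- The generic point of the orbit of `σ_K`. -/
noncomputable def orbitPoint (K : Cone n) : Δ.toricVariety k :=
  chartPoint (Δ.chartι k K) (Δ.facePrime k le_rfl)

lemma orbitPoint_eq {I K : Cone n} (h : K ≤ I) :
    Δ.orbitPoint k K = chartPoint (Δ.chartι k I) (Δ.facePrime k h) := by
  rw [orbitPoint, chartPoint_comp (Δ.chartι k I) (Δ.chartι k K) (Δ.chartRingMap k h).toRingHom
    (Δ.chartι_comp k h)]
  congr 1
  ext f
  change Δ.chartRingMap k h f ∈ (Δ.facePrime k le_rfl).asIdeal ↔ _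
  rw [mem_facePrime, mem_facePrime, faceHom_chartRingMap]

lemma orbitPoint_mem {I K : Cone n} (h : K ≤ I) : Δ.orbitPoint k K ∈ Δ.chartOpen k I := by
  rw [Δ.orbitPoint_eq k h]
  exact chartPoint_mem _ _

lemma isUnit_toStalk_orbitPoint {I K : Cone n} (h : K ≤ I) (f : Δ.chartRing k I) :
    IsUnit (Δ.toStalk I (Δ.orbitPoint k K) (Δ.orbitPoint_mem k h) f) ↔ Δ.faceHom k h f ≠ 0 := by
  have := isUnit_chartToStalk_iff (Δ.chartι k I) (Δ.facePrime k h) f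
  rw [mem_facePrime] at this
  have h2 : ∀ (z : Δ.toricVariety k) (hz : z ∈ Δ.chartOpen k I),
      z = chartPoint (Δ.chartι k I) (Δ.facePrime k h) →
      (IsUnit (Δ.toStalk I z hz f) ↔ Δ.faceHom k h f ≠ 0) := by
    rintro _ _ rfl
    exact this
  exact h2 _ _ (Δ.orbitPoint_eq k h)

/-- Otherwise the point would lie in the chart of the proper face `K ∩ I` of `K`. A character
cutting out this face is invertible on that chart, but it is not orthogonal to `σ_K` and so vanishes
at the orbit point. -/
lemma le_of_orbitPoint_mem {I K : Cone n} (h : Δ.orbitPoint k K ∈ Δ.chartOpen k I) : K ≤ I := by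
  by_contra hle
  obtain ⟨i, hiK, hiI⟩ := Finset.not_subset.mp hle
  let L : Cone n := ⟨K.1 ∩ I.1, fun h => hiI (Finset.mem_inter.mp (h ▸ Finset.mem_univ i)).2⟩
  have hL : L ≤ K := Finset.inter_subset_left
  have hmem : Δ.orbitPoint k K ∈ Δ.chartOpen k L :=
    mem_chartOpen_of_inter (Δ.orbitPoint_mem k le_rfl) h fun j h1 h2 => Finset.mem_inter.mpr ⟨h1, h2⟩
  obtain ⟨m, h0, hm⟩ := Δ.exists_face hL
  have hmK : m ∈ Δ.dualMonoid K := by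
    intro j hj
    by_cases hjL : j ∈ L.1
    · exact (h0 j hjL).ge
    · exact (hm j hj hjL).le
  have h1 := (isUnit_single (k := k) (I := L)
    (m := AddSubmonoid.inclusion (Δ.dualMonoid_anti hL) ⟨m, hmK⟩) h0).map (Δ.toStalk L _ hmem)
  rw [← Δ.chartRingMap_single k hL, toStalk_chartRingMap,
    Δ.isUnit_toStalk_orbitPoint k le_rfl] at h1
  refine h1 (Δ.faceHom_single_of_exists k _ _ ⟨i, hiK, (hm i hiK fun h => hiI ?_).ne'⟩)
  exact (Finset.mem_inter.mp h).2

/-- A prime in the zero locus defining the orbit contains every character not orthogonal to `σ_I`,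
hence contains `facePrime`. -/
lemma isGenericPoint_orbitPoint (I : Cone n) :
    IsGenericPoint (Δ.orbitPoint k I) (Δ.orbitClosure k I) := by
  refine le_antisymm (closure_mono ?_) (closure_minimal ?_ isClosed_closure)
  · rw [Set.singleton_subset_iff]
    refine ⟨Δ.facePrime k le_rfl, ?_, rfl⟩
    rintro f ⟨m, hm, rfl⟩
    exact (Δ.mem_facePrime k _ _).mpr (Δ.faceHom_single_of_exists k _ _ hm)
  · rintro _ ⟨y, hy, rfl⟩
    refine Specializes.mem_closure ?_
    refine (chartPoint_specializes_iff (Δ.chartι k I) y (Δ.facePrime k le_rfl)).mpr fun f hf => ?_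
    exact Δ.mem_of_faceHom_eq_zero k _ (fun m hm => hy ⟨m, hm, rfl⟩) ((Δ.mem_facePrime k _ _).mp hf)

end Faces

end SimplexFan

/-! ### Characters as rational functions, and the points of codimension one. -/

namespace SimplexFan

open ToricGeometry

variable {n : ℕ} (k : Type u) [Field k] (Δ : SimplexFan n)

lemma stalkSpecializes_toStalk {I : Cone n} {z z' : Δ.toricVariety k} (h : z' ⤳ z)
    (hz : z ∈ Δ.chartOpen k I) (hz' : z' ∈ Δ.chartOpen k I) (f : Δ.chartRing k I) :
    ((Δ.toricVariety k).presheaf.stalkSpecializes h).hom (Δ.toStalk I z hz f) =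
      Δ.toStalk I z' hz' f :=
  stalkSpecializes_chartToStalk (Δ.chartι k I) h hz hz' f

lemma genericPoint_mem (I : Cone n) : genericPoint (Δ.toricVariety k) ∈ Δ.chartOpen k I :=
  (genericPoint_specializes (Δ.orbitPoint k I)).mem_open (Δ.chartOpen k I).isOpen
    (Δ.orbitPoint_mem k le_rfl)

/-- The cone `{0}`. -/
def zeroCone (n : ℕ) : Cone n := ⟨∅, (Finset.univ_nonempty (α := Fin (n + 1))).ne_empty.symm⟩

lemma zeroCone_le (I : Cone n) : zeroCone n ≤ I := Finset.empty_subset _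

lemma mem_dualMonoid_zeroCone (m : Fin n → ℤ) : m ∈ Δ.dualMonoid (zeroCone n) := by
  intro i hi
  simp [zeroCone] at hi

/-- The character `χ^m` as a rational function on `X(Δ)`. -/
noncomputable def chi (m : Fin n → ℤ) : (Δ.toricVariety k).functionField :=
  Δ.toStalk (zeroCone n) (genericPoint (Δ.toricVariety k)) (Δ.genericPoint_mem k _)
    (AddMonoidAlgebra.single ⟨m, Δ.mem_dualMonoid_zeroCone m⟩ 1)

variable {k} in
lemma algebraMap_toStalk {I : Cone n} {z : Δ.toricVariety k} (hz : z ∈ Δ.chartOpen k I)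
    (f : Δ.chartRing k I) :
    algebraMap _ (Δ.toricVariety k).functionField (Δ.toStalk I z hz f) =
      Δ.toStalk I _ (Δ.genericPoint_mem k I) f :=
  Δ.stalkSpecializes_toStalk k (genericPoint_specializes z) hz (Δ.genericPoint_mem k I) f

lemma toStalk_genericPoint_single {I : Cone n} (m : Δ.dualMonoid I) :
    Δ.toStalk I _ (Δ.genericPoint_mem k I) (AddMonoidAlgebra.single m 1) = Δ.chi k m.1 := by
  rw [← toStalk_chartRingMap (zeroCone_le I) (Δ.genericPoint_mem k (zeroCone n)),
    chartRingMap_single]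
  rfl

lemma algebraMap_toStalk_single {I : Cone n} {z : Δ.toricVariety k} (hz : z ∈ Δ.chartOpen k I)
    (m : Δ.dualMonoid I) :
    algebraMap _ (Δ.toricVariety k).functionField
      (Δ.toStalk I z hz (AddMonoidAlgebra.single m 1)) = Δ.chi k m.1 := by
  rw [algebraMap_toStalk, toStalk_genericPoint_single]

lemma chi_zero : Δ.chi k 0 = 1 :=
  map_one (Δ.toStalk (zeroCone n) (genericPoint (Δ.toricVariety k)) (Δ.genericPoint_mem k _))

lemma chi_add (m m' : Fin n → ℤ) : Δ.chi k (m + m') = Δ.chi k m * Δ.chi k m' := by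
  rw [chi, chi, chi, ← map_mul, AddMonoidAlgebra.single_mul_single, one_mul]
  rfl

lemma chi_ne_zero (m : Fin n → ℤ) : Δ.chi k m ≠ 0 := by
  intro h
  have := Δ.chi_add k m (-m)
  rw [add_neg_cancel, chi_zero, h, zero_mul] at this
  exact one_ne_zero this

/-- Characters as units of the function field. -/
noncomputable def chiHom : Multiplicative (Fin n → ℤ) →* (Δ.toricVariety k).functionFieldˣ where
  toFun m := Units.mk0 (Δ.chi k m.toAdd) (Δ.chi_ne_zero k _)
  map_one' := Units.ext (Δ.chi_zero k)
  map_mul' a b := Units.ext (Δ.chi_add k a.toAdd b.toAdd)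

lemma chiHom_apply (m : Fin n → ℤ) : (Δ.chiHom k (.ofAdd m) : (Δ.toricVariety k).functionField) =
    Δ.chi k m := rfl

lemma chi_zsmul (c : ℤ) (m : Fin n → ℤ) : Δ.chi k (c • m) = Δ.chi k m ^ c := by
  rw [← chiHom_apply, ofAdd_zsmul, map_zpow, Units.val_zpow_eq_zpow_val, chiHom_apply]

lemma chi_sum {ι : Type*} (s : Finset ι) (c : ι → ℤ) (m : ι → Fin n → ℤ) :
    Δ.chi k (∑ i ∈ s, c i • m i) = ∏ i ∈ s, Δ.chi k (m i) ^ c i := by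
  classical
  induction s using Finset.induction_on with
  | empty => simpa using Δ.chi_zero k
  | insert a s ha ih => rw [Finset.sum_insert ha, Finset.prod_insert ha, chi_add, chi_zsmul, ih]

lemma exists_unit_eq_chi {I : Cone n} {z : Δ.toricVariety k} (hz : z ∈ Δ.chartOpen k I)
    {m : Fin n → ℤ} (hm : ∀ i ∈ I.1, m ⬝ᵥ Δ.ray i = 0) :
    ∃ w : ((Δ.toricVariety k).presheaf.stalk z)ˣ,
      algebraMap _ (Δ.toricVariety k).functionField (w : (Δ.toricVariety k).presheaf.stalk z) =
        Δ.chi k m := by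
  have hmI : m ∈ Δ.dualMonoid I := fun i hi => (hm i hi).ge
  obtain ⟨w, hw⟩ := (isUnit_single (k := k) (m := ⟨m, hmI⟩) hm).map (Δ.toStalk I z hz)
  exact ⟨w, by rw [hw, algebraMap_toStalk_single]⟩

/-- The cone spanned by the ray `v_i`. -/
def rayCone (i : Fin (n + 1)) : Cone n :=
  ⟨{i}, fun h => by
    have h0 := Δ.dim_pos
    have := congrArg Finset.card h
    simp at this
    omega⟩

lemma not_orbitPoint_specializes_genericPoint (i : Fin (n + 1)) :
    ¬ Δ.orbitPoint k (Δ.rayCone i) ⤳ genericPoint (Δ.toricVariety k) := by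
  intro h
  have := h.mem_open (Δ.chartOpen k (zeroCone n)).isOpen (Δ.genericPoint_mem k _)
  have h2 := Δ.le_of_orbitPoint_mem k this (Finset.mem_singleton_self i)
  simp [zeroCone] at h2

/-- The points of codimension one outside the torus are the generic points of the divisors `D_i`. -/
lemma mem_or_eq_orbitPoint_of_coheight_eq_one {z : Δ.toricVariety k} (hz : Order.coheight z = 1) :
    z ∈ Δ.chartOpen k (zeroCone n) ∨ ∃ i, z = Δ.orbitPoint k (Δ.rayCone i) := by
  -- A minimal chart containing `z`: no character of it that is nonzero on some ray of `I` can be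
  -- invertible at `z`, as otherwise `z` would lie in the chart of the smaller face where that
  -- character vanishes.
  obtain ⟨I, hI⟩ := (Set.toFinite {I : Cone n | z ∈ Δ.chartOpen k I}).exists_minimal
    (exists_mem_chartOpen z)
  have hzI : z ∈ Δ.chartOpen k I := hI.1
  rcases Finset.eq_empty_or_nonempty I.1 with h0 | ⟨i, hi⟩
  · left
    exact chartOpen_mono (fun i hi => by simp [h0] at hi) hzI
  right
  refine ⟨i, ?_⟩
  have hle : Δ.rayCone i ≤ I := Finset.singleton_subset_iff.mpr hi
  have hspec : Δ.orbitPoint k (Δ.rayCone i) ⤳ z := by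
    obtain ⟨y, hy⟩ := exists_chartPoint hzI
    rw [Δ.orbitPoint_eq k hle, ← hy, chartPoint_specializes_iff]
    intro f hf
    refine Δ.mem_of_faceHom_eq_zero k hle (fun m hm => ?_) ((Δ.mem_facePrime k _ _).mp hf)
    obtain ⟨j, hj, hmj⟩ := hm
    obtain rfl : j = i := Finset.mem_singleton.mp hj
    by_contra hmy
    let K : Cone n := ⟨I.1.filter fun t => m.1 ⬝ᵥ Δ.ray t = 0, fun h => by
      have hjK := Finset.mem_univ j
      rw [← h] at hjK
      exact hmj (Finset.mem_filter.mp hjK).2⟩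
    have hK : K ≤ I := Finset.filter_subset _ _
    have hzK : z ∈ Δ.chartOpen k K := by
      refine mem_chartOpen_of_isUnit hK (m := m) (fun t ht => (Finset.mem_filter.mp ht).2)
        (fun t ht ht' => ?_) hzI ?_
      · exact (m.2 t ht).lt_of_ne fun h => ht' (Finset.mem_filter.mpr ⟨ht, h.symm⟩)
      · subst hy
        exact (isUnit_chartToStalk_iff (Δ.chartι k I) y _).mpr hmy
    exact hmj (Finset.mem_filter.mp (hI.2 hzK hK hi)).2
  -- If `z` were a proper specialization of the generic point of `D_i`, the chain through the
  -- generic point of `X` would give coheight at least `2`.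
  by_contra hne
  have h1 : z < Δ.orbitPoint k (Δ.rayCone i) :=
    ⟨hspec, fun h => hne (Specializes.antisymm h hspec).eq⟩
  have h2 : Δ.orbitPoint k (Δ.rayCone i) < genericPoint (Δ.toricVariety k) :=
    ⟨genericPoint_specializes _, Δ.not_orbitPoint_specializes_genericPoint k i⟩
  have h3 := Order.coheight_add_one_le h1
  have h4 := Order.coheight_add_one_le h2
  rw [hz] at h3
  have h5 : (1 : ℕ∞) ≤ Order.coheight (Δ.orbitPoint k (Δ.rayCone i)) := le_trans (by simp) h4
  have h6 : (1 : ℕ∞) + 1 ≤ 1 := le_trans (by gcongr) h3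
  exact absurd h6 (by decide)

end SimplexFan

/-! ### Kähler differentials of the local rings in coordinates adapted to a ray. -/

namespace ToricGeometry

/-- Kähler differentials commute with localization, so the basis `dX_j` of a polynomial ring remains
a basis. -/
lemma exists_kaehlerBasis {k O : Type*} [Field k] [CommRing O] [Algebra k O] {n : ℕ}
    (ψ : MvPolynomial (Fin n) k →ₐ[k] O) (S : Submonoid (MvPolynomial (Fin n) k))
    (h : letI := ψ.toRingHom.toAlgebra; IsLocalization S O) :
    ∃ b : Module.Basis (Fin n) O Ω[O⁄k], ∀ j, b j = KaehlerDifferential.D k O (ψ (.X j)) := by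
  let _ := ψ.toRingHom.toAlgebra
  have : IsScalarTower k (MvPolynomial (Fin n) k) O := .of_algebraMap_eq' ψ.comp_algebraMap.symm
  have := h
  refine ⟨(KaehlerDifferential.mvPolynomialBasis k (Fin n)).ofIsLocalizedModule O S
    (KaehlerDifferential.map k k (MvPolynomial (Fin n) k) O), fun j => ?_⟩
  rw [Module.Basis.ofIsLocalizedModule_apply, KaehlerDifferential.mvPolynomialBasis_apply,
    KaehlerDifferential.map_D]
  rfl

end ToricGeometry

namespace SimplexFan

open ToricGeometry

variable {n : ℕ} (k : Type u) [Field k] (Δ : SimplexFan n)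

/-- The values of the pairing with `v_i` form a subgroup `dℤ`. Each coordinate of `v_i` is then
divisible by `d`, and primitivity makes `d` a unit. -/
lemma exists_dotProduct_ray_eq_one (i : Fin (n + 1)) : ∃ m : Fin n → ℤ, m ⬝ᵥ Δ.ray i = 1 := by
  let ev : (Fin n → ℤ) →+ ℤ :=
    { toFun := fun x => x ⬝ᵥ Δ.ray i
      map_zero' := by simp
      map_add' := fun a b => add_dotProduct _ _ _ }
  obtain ⟨d, hd⟩ := Int.subgroup_cyclic ev.range
  have hw : ∀ j, ∃ c : ℤ, c * d = Δ.ray i j := by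
    intro j
    have : ev (Pi.single j 1) ∈ ev.range := ⟨_, rfl⟩
    rw [hd, AddSubgroup.mem_closure_singleton] at this
    obtain ⟨c, hc⟩ := this
    refine ⟨c, ?_⟩
    rw [← smul_eq_mul, hc]
    simp [ev]
  choose c hc using hw
  have hu := Δ.primitive i d c (funext fun j => by simp [← hc j, mul_comm])
  obtain ⟨m, hm⟩ : d ∈ ev.range := by rw [hd]; exact AddSubgroup.subset_closure rfl
  obtain ⟨e, he⟩ := hu.exists_left_inv
  refine ⟨e • m, ?_⟩
  rw [smul_dotProduct]
  exact (congrArg (e * ·) hm).trans he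

/-- A basis of `M` whose pairings with the primitive vector `v_i` are `1, 0, …, 0`. -/
lemma exists_adapted_basis (i : Fin (n + 1)) :
    ∃ (B : Module.Basis (Fin n) ℤ (Fin n → ℤ)) (j₀ : Fin n),
      ∀ j, B j ⬝ᵥ Δ.ray i = if j = j₀ then 1 else 0 := by
  obtain ⟨y, hy⟩ := Δ.exists_dotProduct_ray_eq_one i
  let ev : (Fin n → ℤ) →ₗ[ℤ] ℤ :=
    { toFun := fun x => x ⬝ᵥ Δ.ray i
      map_add' := fun a b => add_dotProduct _ _ _
      map_smul' := fun c a => smul_dotProduct _ _ _ }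
  -- The kernel of the pairing is free, and `y`, of value `1`, splits the pairing; so `y` followed
  -- by a basis of the kernel is a basis of `M`.
  obtain ⟨n', b⟩ := Submodule.basisOfPid (Pi.basisFun ℤ (Fin n)) (LinearMap.ker ev)
  let B := b.mkFinCons y
    (fun c x hx h => by
      have := congrArg ev h
      rw [map_add, map_smul, LinearMap.mem_ker.mp hx, map_zero] at this
      simpa [ev, hy] using this)
    (fun z => ⟨-ev z, by
      rw [LinearMap.mem_ker, map_add, map_smul]
      simp [ev, hy]⟩)
  have hB0 : B 0 = y := by simp [B]
  have hBs : ∀ t, ev (B (Fin.succ t)) = 0 := fun t => by simp [B]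
  obtain rfl : n = n' + 1 := by
    have h1 := Module.finrank_eq_card_basis B
    simpa using h1
  refine ⟨B, 0, fun j => ?_⟩
  induction j using Fin.cases with
  | zero => rw [hB0, hy, if_pos rfl]
  | succ t => rw [if_neg (Fin.succ_ne_zero t)]; exact hBs t

variable {Δ} {i : Fin (n + 1)} {B : Module.Basis (Fin n) ℤ (Fin n → ℤ)} {j₀ : Fin n}

lemma sum_smul_dotProduct (hB : ∀ j, B j ⬝ᵥ Δ.ray i = if j = j₀ then 1 else 0) (c : Fin n → ℤ) :
    (∑ j, c j • B j) ⬝ᵥ Δ.ray i = c j₀ := by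
  simp only [sum_dotProduct, smul_dotProduct, hB, smul_eq_mul, mul_ite, mul_one, mul_zero,
    Finset.sum_ite_eq', Finset.mem_univ, if_true]

/-- The monomials in an adapted basis, as characters on `U_{v_i}`. -/
noncomputable def adaptedMonomial (hB : ∀ j, B j ⬝ᵥ Δ.ray i = if j = j₀ then 1 else 0) :
    (Fin n →₀ ℕ) →+ Δ.dualMonoid (Δ.rayCone i) where
  toFun α := ⟨∑ j, (α j : ℤ) • B j, fun t ht => by
    obtain rfl := Finset.mem_singleton.mp ht
    rw [sum_smul_dotProduct hB]
    positivity⟩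
  map_zero' := by ext1; simp
  map_add' α β := by
    ext1
    simp [add_smul, Finset.sum_add_distrib]

lemma adaptedMonomial_injective (hB : ∀ j, B j ⬝ᵥ Δ.ray i = if j = j₀ then 1 else 0) :
    Function.Injective (adaptedMonomial hB) := by
  intro α β h
  ext j
  have := congrArg (fun m => B.repr m.1 j) h
  simp only [adaptedMonomial, AddMonoidHom.coe_mk, ZeroHom.coe_mk, B.repr_sum_self] at this
  exact_mod_cast this

/-- Polynomials in the characters of an adapted basis, as functions on `U_{v_i}`. -/
noncomputable def adaptedHom (hB : ∀ j, B j ⬝ᵥ Δ.ray i = if j = j₀ then 1 else 0) :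
    MvPolynomial (Fin n) k →ₐ[k] Δ.chartRing k (Δ.rayCone i) :=
  AddMonoidAlgebra.mapDomainAlgHom k k (adaptedMonomial hB)

lemma adaptedHom_monomial (hB : ∀ j, B j ⬝ᵥ Δ.ray i = if j = j₀ then 1 else 0) (α : Fin n →₀ ℕ)
    (a : k) : adaptedHom k hB (MvPolynomial.monomial α a) =
      AddMonoidAlgebra.single (adaptedMonomial hB α) a := by
  rw [← MvPolynomial.single_eq_monomial]
  exact AddMonoidAlgebra.mapDomain_single

lemma adapted_mem (hB : ∀ j, B j ⬝ᵥ Δ.ray i = if j = j₀ then 1 else 0) (j : Fin n) :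
    B j ∈ Δ.dualMonoid (Δ.rayCone i) := fun t ht => by
  obtain rfl := Finset.mem_singleton.mp ht
  rw [hB]
  split_ifs <;> simp

lemma adaptedHom_X (hB : ∀ j, B j ⬝ᵥ Δ.ray i = if j = j₀ then 1 else 0) (j : Fin n) :
    adaptedHom k hB (MvPolynomial.X j) = AddMonoidAlgebra.single ⟨B j, adapted_mem hB j⟩ 1 := by
  rw [MvPolynomial.X, adaptedHom_monomial]
  congr 1
  ext1
  simp [adaptedMonomial, Finsupp.single_apply]

/-- In adapted coordinates `U_{v_i}` is an affine line times a torus: only the exponent of index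
`j₀` has to be nonnegative, so all variables but that one are inverted. -/
lemma isLocalization_adaptedHom (hB : ∀ j, B j ⬝ᵥ Δ.ray i = if j = j₀ then 1 else 0) :
    letI := (adaptedHom k hB).toRingHom.toAlgebra
    IsLocalization.Away (MvPolynomial.monomial (Finsupp.equivFunOnFinite.symm fun j =>
      if j = j₀ then 0 else 1) 1 : MvPolynomial (Fin n) k) (Δ.chartRing k (Δ.rayCone i)) := by
  let _ := (adaptedHom k hB).toRingHom.toAlgebra
  have halg : ∀ x, algebraMap (MvPolynomial (Fin n) k) (Δ.chartRing k (Δ.rayCone i)) x =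
    adaptedHom k hB x := fun _ => rfl
  refine IsLocalization.Away.mk _ ?_ (fun s => ?_) (fun a b hab => ?_)
  · rw [halg, adaptedHom_monomial]
    refine isUnit_single fun t ht => ?_
    obtain rfl := Finset.mem_singleton.mp ht
    exact (sum_smul_dotProduct hB _).trans (by simp)
  · induction s using AddMonoidAlgebra.induction_linear with
    | zero => exact ⟨0, 0, by simp⟩
    | add f f' hf hf' =>
      obtain ⟨N, g, hg⟩ := hf
      obtain ⟨N', g', hg'⟩ := hf'
      refine ⟨N + N', MvPolynomial.monomial (Finsupp.equivFunOnFinite.symm fun j =>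
        if j = j₀ then 0 else 1) 1 ^ N' * g + MvPolynomial.monomial (Finsupp.equivFunOnFinite.symm
          fun j => if j = j₀ then 0 else 1) 1 ^ N * g', ?_⟩
      rw [map_add, map_mul, map_mul, ← hg, ← hg', map_pow, map_pow]
      ring
    | single m a =>
      have hm : m.1 = ∑ j, B.repr m.1 j • B j := (B.sum_repr m.1).symm
      have h0 : 0 ≤ B.repr m.1 j₀ := by
        rw [← sum_smul_dotProduct hB (fun j => B.repr m.1 j), ← hm]
        exact m.2 i (Finset.mem_singleton_self i)
      -- This `N` bounds the absolute values of all exponents, so the `N`-th power of the inverted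
      -- monomial clears the negative ones.
      let N : ℕ := ∑ j, (B.repr m.1 j).natAbs
      have hN : ∀ j, (B.repr m.1 j).natAbs ≤ N := fun j =>
        Finset.single_le_sum (f := fun j => (B.repr m.1 j).natAbs) (fun _ _ => Nat.zero_le _)
          (Finset.mem_univ j)
      refine ⟨N, MvPolynomial.monomial (Finsupp.equivFunOnFinite.symm fun j =>
        (B.repr m.1 j + if j = j₀ then 0 else N).toNat) a, ?_⟩
      rw [halg, halg, adaptedHom_monomial, adaptedHom_monomial, AddMonoidAlgebra.single_pow,
        AddMonoidAlgebra.single_mul_single, one_pow, mul_one]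
      congr 1
      ext1
      rw [AddSubmonoid.coe_add, AddSubmonoidClass.coe_nsmul]
      nth_rewrite 1 [hm]
      simp only [adaptedMonomial, AddMonoidHom.coe_mk, ZeroHom.coe_mk,
        Finsupp.equivFunOnFinite_symm_apply_apply, Finset.smul_sum, ← Finset.sum_add_distrib]
      refine Finset.sum_congr rfl fun j _ => ?_
      rw [← natCast_zsmul, smul_smul, ← add_smul]
      congr 1
      have := hN j
      split_ifs with hj
      · subst hj
        simp [h0]
      · rw [Int.toNat_of_nonneg (by omega)]
        simp
  · refine ⟨0, ?_⟩
    have : a = b := AddMonoidAlgebra.mapDomain_injective (adaptedMonomial_injective hB) hab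
    rw [this]

/-- The differentials of the characters of an adapted basis form a basis of the differentials of
the local rings of `U_{v_i}`. -/
lemma exists_stalk_kaehlerBasis (hB : ∀ j, B j ⬝ᵥ Δ.ray i = if j = j₀ then 1 else 0)
    {z : Δ.toricVariety k} (hz : z ∈ Δ.chartOpen k (Δ.rayCone i)) :
    letI := (baseToStalk (Δ.toSpec k) z).toAlgebra
    ∃ b : Module.Basis (Fin n) ((Δ.toricVariety k).presheaf.stalk z)
        Ω[(Δ.toricVariety k).presheaf.stalk z⁄k],
      ∀ j, b j = KaehlerDifferential.D k _ (Δ.toStalk (Δ.rayCone i) z hz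
        (AddMonoidAlgebra.single ⟨B j, adapted_mem hB j⟩ 1)) := by
  let _ := (baseToStalk (Δ.toSpec k) z).toAlgebra
  let e : Δ.chartRing k (Δ.rayCone i) →ₐ[k] (Δ.toricVariety k).presheaf.stalk z :=
    { Δ.toStalk (Δ.rayCone i) z hz with
      commutes' := fun a => toStalk_algebraMap hz a }
  let ψ := e.comp (adaptedHom k hB)
  let _ := (adaptedHom k hB).toRingHom.toAlgebra
  let _ := (chartToStalk (Δ.chartι k (Δ.rayCone i)) z hz).toAlgebra
  let _ := ψ.toRingHom.toAlgebra
  have : IsScalarTower (MvPolynomial (Fin n) k) (Δ.chartRing k (Δ.rayCone i))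
    ((Δ.toricVariety k).presheaf.stalk z) := .of_algebraMap_eq fun _ => rfl
  have h1 := isLocalization_adaptedHom k hB
  have h2 : IsLocalization ((IsLocalRing.maximalIdeal
      ((Δ.toricVariety k).presheaf.stalk z)).comap
      (chartToStalk (Δ.chartι k (Δ.rayCone i)) z hz)).primeCompl
      ((Δ.toricVariety k).presheaf.stalk z) :=
    isLocalization_chartToStalk (Δ.chartι k (Δ.rayCone i)) z hz
  -- The local ring localizes the chart ring, which localizes a polynomial ring; the composite has
  -- the form needed by `exists_kaehlerBasis`.
  have h3 := IsLocalization.localization_localization_isLocalization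
    (Submonoid.powers (MvPolynomial.monomial (Finsupp.equivFunOnFinite.symm fun j =>
      if j = j₀ then 0 else 1) 1 : MvPolynomial (Fin n) k))
    ((IsLocalRing.maximalIdeal ((Δ.toricVariety k).presheaf.stalk z)).comap
      (chartToStalk (Δ.chartι k (Δ.rayCone i)) z hz)).primeCompl
    ((Δ.toricVariety k).presheaf.stalk z)
  obtain ⟨b, hb⟩ := exists_kaehlerBasis ψ _ h3
  refine ⟨b, fun j => ?_⟩
  rw [hb]
  change KaehlerDifferential.D k _ (Δ.toStalk (Δ.rayCone i) z hz (adaptedHom k hB _)) = _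
  rw [adaptedHom_X]

end SimplexFan

/-! ### Calculus of orders of vanishing. -/

namespace ToricGeometry

section HasOrd

variable {A L : Type*} [CommRing A] [Field L] [Algebra A L]

lemma HasOrd.mul [IsDomain A] {a b : L} {e f : ℤ} (ha : HasOrd A a e) (hb : HasOrd A b f) :
    HasOrd A (a * b) (e + f) := by
  obtain ⟨x, y, p, q, hx, hy, h, hp, hq, rfl⟩ := ha
  obtain ⟨x', y', p', q', hx', hy', h', hp', hq', rfl⟩ := hb
  have hx0 : x' ∈ nonZeroDivisors A :=
    mem_nonZeroDivisors_of_ne_zero fun h0 => hx' (by rw [h0, map_zero])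
  have hy0 : y' ∈ nonZeroDivisors A :=
    mem_nonZeroDivisors_of_ne_zero fun h0 => hy' (by rw [h0, map_zero])
  refine ⟨x * x', y * y', p + p', q + q', ?_, ?_, ?_, ?_, ?_, ?_⟩
  · rw [map_mul]; exact mul_ne_zero hx hx'
  · rw [map_mul]; exact mul_ne_zero hy hy'
  · rw [map_mul, map_mul, ← h, ← h']; ring
  · rw [Ring.ord_mul A hx0, hp, hp']; rfl
  · rw [Ring.ord_mul A hy0, hq, hq']; rfl
  · push_cast; ring

lemma HasOrd.inv {a : L} {e : ℤ} (ha : HasOrd A a e) : HasOrd A a⁻¹ (-e) := by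
  obtain ⟨x, y, p, q, hx, hy, h, hp, hq, rfl⟩ := ha
  have ha0 : a ≠ 0 := by
    rintro rfl
    rw [zero_mul] at h
    exact hx h.symm
  refine ⟨y, x, q, p, hy, hx, ?_, hq, hp, by ring⟩
  rw [← h, inv_mul_cancel_left₀ ha0]

lemma hasOrd_of_isUnit [Nontrivial A] {x : A} (hx : IsUnit x) : HasOrd A (algebraMap A L x) 0 :=
  ⟨x, 1, 0, 0, (hx.map _).ne_zero, by simp, by simp, by simpa using Ring.ord_of_isUnit hx,
    by simp, by simp⟩

lemma hasOrd_of_unit [Nontrivial A] (w : Aˣ) : HasOrd A (algebraMap A L w) 0 :=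
  hasOrd_of_isUnit w.isUnit

lemma HasOrd.pow [IsDomain A] {a : L} {e : ℤ} (ha : HasOrd A a e) (s : ℕ) :
    HasOrd A (a ^ s) (s * e) := by
  induction s with
  | zero => simpa using hasOrd_of_unit (A := A) (L := L) 1
  | succ s ih =>
    rw [pow_succ, Nat.cast_succ, add_mul, one_mul]
    exact ih.mul ha

lemma HasOrd.zpow [IsDomain A] {a : L} {e : ℤ} (ha : HasOrd A a e) (s : ℤ) :
    HasOrd A (a ^ s) (s * e) := by
  cases s with
  | ofNat s => simpa using ha.pow s
  | negSucc s =>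
    rw [zpow_negSucc, Int.negSucc_eq, neg_mul]
    exact_mod_cast (ha.pow (s + 1)).inv

/-- The quotient by `x` is a field, hence a simple module, of length one. -/
lemma hasOrd_one_of_isMaximal {x : A} (hx : algebraMap A L x ≠ 0) (h : (Ideal.span {x}).IsMaximal) :
    HasOrd A (algebraMap A L x) 1 := by
  refine ⟨x, 1, 1, 0, hx, by simp, by simp, ?_, by simp, by simp⟩
  rw [Ring.ord, Nat.cast_one, Module.length_eq_one_iff,
    isSimpleModule_iff_isSimpleModule_of_algebraMap_surjective (S := A ⧸ Ideal.span {x})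
    Ideal.Quotient.mk_surjective]
  let := Ideal.Quotient.field (Ideal.span {x})
  exact instIsSimpleModule _

end HasOrd

end ToricGeometry

/-! ### Rational `n`-forms from characters, and existence of a canonical divisor. -/

namespace SimplexFan

open ToricGeometry

variable {n : ℕ} (k : Type u) [Field k] (Δ : SimplexFan n)

/-- The `k`-algebra structure of the local rings of `X(Δ)`. -/
noncomputable abbrev stalkAlgebra (z : Δ.toricVariety k) :
    Algebra k ((Δ.toricVariety k).presheaf.stalk z) :=
  (baseToStalk (Δ.toSpec k) z).toAlgebra

attribute [local instance] stalkAlgebra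

/-- The differential form `dχ^m / χ^m`. -/
noncomputable def dlog : (Fin n → ℤ) →+ Ω[(Δ.toricVariety k).functionField⁄k] where
  toFun m := (Δ.chi k m)⁻¹ • KaehlerDifferential.D k _ (Δ.chi k m)
  map_zero' := by rw [chi_zero, Derivation.map_one_eq_zero, smul_zero]
  map_add' a b := by
    rw [chi_add, Derivation.leibniz, smul_add, smul_smul, smul_smul, mul_inv, add_comm]
    congr 2
    · rw [mul_assoc, inv_mul_cancel₀ (Δ.chi_ne_zero k b), mul_one]
    · rw [mul_comm _ (Δ.chi k b)⁻¹, mul_assoc, inv_mul_cancel₀ (Δ.chi_ne_zero k a), mul_one]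

lemma D_chi (m : Fin n → ℤ) :
    KaehlerDifferential.D k (Δ.toricVariety k).functionField (Δ.chi k m) =
      Δ.chi k m • Δ.dlog k m := by
  change _ = Δ.chi k m • (Δ.chi k m)⁻¹ • KaehlerDifferential.D k _ (Δ.chi k m)
  rw [smul_smul, mul_inv_cancel₀ (Δ.chi_ne_zero k m), one_smul]

/-- The logarithmic differential is additive in `m`, so it expands with the integer coordinates of
`m` in `B`. -/
lemma D_chi_eq_sum (B : Module.Basis (Fin n) ℤ (Fin n → ℤ)) (m : Fin n → ℤ) :
    KaehlerDifferential.D k (Δ.toricVariety k).functionField (Δ.chi k m) =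
      ∑ l, (Δ.chi k m * ((Δ.chi k (B l))⁻¹ * (B.repr m l : (Δ.toricVariety k).functionField))) •
        KaehlerDifferential.D k (Δ.toricVariety k).functionField (Δ.chi k (B l)) := by
  have h : Δ.dlog k m = ∑ l, B.repr m l • Δ.dlog k (B l) := by
    conv_lhs => rw [← B.sum_repr m, map_sum]
    exact Finset.sum_congr rfl fun l _ => map_zsmul _ _ _
  rw [D_chi, h, Finset.smul_sum]
  refine Finset.sum_congr rfl fun l _ => ?_
  rw [D_chi, mul_smul, mul_smul, smul_comm (B.repr m l : (Δ.toricVariety k).functionField),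
    smul_smul (Δ.chi k (B l))⁻¹, inv_mul_cancel₀ (Δ.chi_ne_zero k _), one_smul, Int.cast_smul_eq_zsmul]

/-- Characters factor out of the rows and columns, leaving the integral change-of-basis matrix, of
determinant `±1`. This compares the forms `dχ^{B_1} ∧ ⋯ ∧ dχ^{B_n}` for two bases of `M`. -/
lemma det_chi_eq (B B' : Module.Basis (Fin n) ℤ (Fin n → ℤ)) :
    ∃ ε : ℤˣ, (Matrix.of fun j l => Δ.chi k (B' j) * ((Δ.chi k (B l))⁻¹ *
        (B.repr (B' j) l : (Δ.toricVariety k).functionField))).det =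
      ((ε : ℤ) : (Δ.toricVariety k).functionField) * Δ.chi k (∑ j, B' j - ∑ j, B j) := by
  obtain ⟨ε, hε⟩ := B.isUnit_det B'
  refine ⟨ε, ?_⟩
  have h1 := Matrix.det_mul_column (fun j => Δ.chi k (B' j)) (Matrix.of fun j l =>
    (Δ.chi k (B l))⁻¹ * (B.repr (B' j) l : (Δ.toricVariety k).functionField))
  have h2 := Matrix.det_mul_row (fun l => (Δ.chi k (B l))⁻¹)
    (Matrix.of fun j l => (B.repr (B' j) l : (Δ.toricVariety k).functionField))
  simp only [Matrix.of_apply] at h1 h2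
  have h3 : (Matrix.of fun j l => (B.repr (B' j) l : (Δ.toricVariety k).functionField)) =
      ((B.toMatrix B').transpose.map (Int.castRingHom (Δ.toricVariety k).functionField)) := by
    ext; rfl
  have h4 : ∀ C : Module.Basis (Fin n) ℤ (Fin n → ℤ), ∏ j, Δ.chi k (C j) = Δ.chi k (∑ j, C j) := by
    intro C
    have := Δ.chi_sum k Finset.univ (fun _ => 1) C
    simpa using this.symm
  have h5 : Δ.chi k (∑ j, B' j - ∑ j, B j) * Δ.chi k (∑ j, B j) = Δ.chi k (∑ j, B' j) := by
    rw [← chi_add, sub_add_cancel]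
  rw [h1, h2, h3, ← RingHom.mapMatrix_apply, ← RingHom.map_det, Matrix.det_transpose,
    ← Module.Basis.det_apply, ← hε, Finset.prod_inv_distrib, h4, h4, ← h5]
  have := Δ.chi_ne_zero k (∑ j, B j)
  rw [eq_intCast]
  field_simp

lemma stalkDifferentialMap_D (z : Δ.toricVariety k)
    (a : (Δ.toricVariety k).presheaf.stalk z) :
    stalkDifferentialMap (Δ.toSpec k) z (KaehlerDifferential.D k _ a) =
      KaehlerDifferential.D k _ (algebraMap _ (Δ.toricVariety k).functionField a) := by
  have : IsScalarTower k ((Δ.toricVariety k).presheaf.stalk z) (Δ.toricVariety k).functionField :=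
    .of_algebraMap_eq' (algebraMap_comp_baseToStalk (Δ.toSpec k) z).symm
  exact KaehlerDifferential.map_D k k _ _ a

/-- A basis of the differentials of the function field by differentials of characters. -/
lemma exists_chi_kaehlerBasis {i : Fin (n + 1)} {B : Module.Basis (Fin n) ℤ (Fin n → ℤ)}
    {j₀ : Fin n} (hB : ∀ j, B j ⬝ᵥ Δ.ray i = if j = j₀ then 1 else 0) :
    ∃ b : Module.Basis (Fin n) (Δ.toricVariety k).functionField
        Ω[(Δ.toricVariety k).functionField⁄k],
      ∀ j, b j = KaehlerDifferential.D k _ (Δ.chi k (B j)) := by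
  obtain ⟨b, hb⟩ := exists_stalk_kaehlerBasis k hB (Δ.genericPoint_mem k _)
  refine ⟨b, fun j => ?_⟩
  rw [hb, toStalk_genericPoint_single]

/-- At a point of codimension one, the form `dχ^{B_1} ∧ ⋯ ∧ dχ^{B_n}` differs from a generator of
the top forms by a character. -/
lemma exists_local_kaehlerBasis (B₀ : Module.Basis (Fin n) ℤ (Fin n → ℤ))
    {z : Δ.toricVariety k} (hz : Order.coheight z = 1) :
    ∃ (i : Fin (n + 1)) (ρ : Fin n → ℤ), z ∈ Δ.chartOpen k (Δ.rayCone i) ∧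
      (z ∈ Δ.chartOpen k (zeroCone n) ∨ z = Δ.orbitPoint k (Δ.rayCone i)) ∧
      ρ ⬝ᵥ Δ.ray i = 1 ∧
      ∃ (b : Module.Basis (Fin n) ((Δ.toricVariety k).presheaf.stalk z)
          Ω[(Δ.toricVariety k).presheaf.stalk z⁄k])
        (b' : Module.Basis (Fin n) (Δ.toricVariety k).functionField
          Ω[(Δ.toricVariety k).functionField⁄k])
        (H : Matrix (Fin n) (Fin n) (Δ.toricVariety k).functionField) (ε : ℤˣ),
        (∀ j, stalkDifferentialMap (Δ.toSpec k) z (b j) = b' j) ∧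
        (∀ j, KaehlerDifferential.D k _ (Δ.chi k (B₀ j)) = ∑ l, H j l • b' l) ∧
        H.det = ((ε : ℤ) : (Δ.toricVariety k).functionField) * Δ.chi k (∑ j, B₀ j - ρ) := by
  obtain ⟨i, hzi, hor⟩ : ∃ i, z ∈ Δ.chartOpen k (Δ.rayCone i) ∧
      (z ∈ Δ.chartOpen k (zeroCone n) ∨ z = Δ.orbitPoint k (Δ.rayCone i)) := by
    rcases Δ.mem_or_eq_orbitPoint_of_coheight_eq_one k hz with h | ⟨i, h⟩
    -- The torus lies in the chart of every ray, so the index `0` is an arbitrary choice.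
    · exact ⟨0, chartOpen_mono (zeroCone_le _) h, Or.inl h⟩
    · exact ⟨i, h ▸ Δ.orbitPoint_mem k le_rfl, Or.inr h⟩
  obtain ⟨B, j₀, hB⟩ := Δ.exists_adapted_basis i
  obtain ⟨b, hb⟩ := exists_stalk_kaehlerBasis k hB hzi
  obtain ⟨b', hb'⟩ := Δ.exists_chi_kaehlerBasis k hB
  obtain ⟨ε, hε⟩ := Δ.det_chi_eq k B B₀
  refine ⟨i, ∑ j, B j, hzi, hor, ?_, b, b', _, ε, fun j => ?_, fun j => ?_, hε⟩
  · have := sum_smul_dotProduct hB fun _ => 1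
    simpa using this
  · rw [hb, hb', stalkDifferentialMap_D, algebraMap_toStalk_single]
  · rw [D_chi_eq_sum k Δ B]
    exact Finset.sum_congr rfl fun l _ => by rw [hb']; rfl

/-- Characters are units on the torus. At the generic point of `D_i`, `χ^ρ` is a uniformizer, and
`χ^m` is a unit times its power with exponent `⟨m, v_i⟩`. -/
lemma exists_hasOrd_chi {z : Δ.toricVariety k} {i : Fin (n + 1)} {ρ : Fin n → ℤ}
    (h : z ∈ Δ.chartOpen k (zeroCone n) ∨ z = Δ.orbitPoint k (Δ.rayCone i))
    (hρ : ρ ⬝ᵥ Δ.ray i = 1) (m : Fin n → ℤ) :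
    ∃ e : ℤ, HasOrd ((Δ.toricVariety k).presheaf.stalk z) (Δ.chi k m) e := by
  rcases h with h | rfl
  · obtain ⟨w, hw⟩ := Δ.exists_unit_eq_chi k h (m := m) (fun i hi => by simp [zeroCone] at hi)
    exact ⟨0, hw ▸ hasOrd_of_unit w⟩
  · have hmem := Δ.orbitPoint_mem k (le_refl (Δ.rayCone i))
    have hρm : ρ ∈ Δ.dualMonoid (Δ.rayCone i) := fun t ht => by
      obtain rfl := Finset.mem_singleton.mp ht
      omega
    set x : Δ.chartRing k (Δ.rayCone i) := AddMonoidAlgebra.single ⟨ρ, hρm⟩ 1 with hx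
    have hchi : Δ.chi k m = Δ.chi k (m - (m ⬝ᵥ Δ.ray i) • ρ) * Δ.chi k ρ ^ (m ⬝ᵥ Δ.ray i) := by
      rw [← chi_zsmul, ← chi_add, sub_add_cancel]
    obtain ⟨w, hw⟩ := Δ.exists_unit_eq_chi k hmem (m := m - (m ⬝ᵥ Δ.ray i) • ρ) (fun t ht => by
      obtain rfl := Finset.mem_singleton.mp ht
      rw [sub_dotProduct, smul_dotProduct, hρ, smul_eq_mul, mul_one, sub_self])
    have hx' : algebraMap _ (Δ.toricVariety k).functionField (Δ.toStalk (Δ.rayCone i) _ hmem x) =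
        Δ.chi k ρ := Δ.algebraMap_toStalk_single k hmem _
    have hnon : ¬ IsUnit (Δ.toStalk (Δ.rayCone i) _ hmem x) := by
      rw [Δ.isUnit_toStalk_orbitPoint k le_rfl, not_not]
      exact Δ.faceHom_single_of_exists k _ _
        ⟨i, Finset.mem_singleton_self i, by change ρ ⬝ᵥ _ ≠ 0; omega⟩
    have hmax : (Ideal.span {Δ.toStalk (Δ.rayCone i) _ hmem x}).IsMaximal := by
      -- Up to a unit, a non-unit germ is a chart function vanishing on `D_i`. Its characters are
      -- positive on `v_i`, so each is divisible by `χ^ρ`.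
      have heq : Ideal.span {Δ.toStalk (Δ.rayCone i) _ hmem x} = IsLocalRing.maximalIdeal _ := by
        refine le_antisymm ?_ fun a ha => ?_
        · rw [Ideal.span_singleton_le_iff_mem]
          exact hnon
        · obtain ⟨f, s, hs, hfs⟩ := exists_chartToStalk_mul (Δ.chartι k (Δ.rayCone i)) _ hmem a
          have hf : ¬ IsUnit (Δ.toStalk (Δ.rayCone i) _ hmem f) := by
            intro hu
            have : IsUnit (a * chartToStalk (Δ.chartι k (Δ.rayCone i)) _ hmem s) := hfs ▸ hu
            exact ha (isUnit_of_mul_isUnit_left this)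
          rw [Δ.isUnit_toStalk_orbitPoint k le_rfl, not_not] at hf
          have hfx : f ∈ Ideal.span {x} := by
            refine Δ.mem_of_faceHom_eq_zero k le_rfl (fun m' hm' => ?_) hf
            obtain ⟨t, ht, hm'⟩ := hm'
            obtain rfl := Finset.mem_singleton.mp ht
            have hge := m'.2 t ht
            have hsub : m'.1 - ρ ∈ Δ.dualMonoid (Δ.rayCone t) := fun s hs => by
              obtain rfl := Finset.mem_singleton.mp hs
              rw [sub_dotProduct]
              omega
            rw [Ideal.mem_span_singleton]
            refine ⟨AddMonoidAlgebra.single ⟨m'.1 - ρ, hsub⟩ 1, ?_⟩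
            rw [hx, AddMonoidAlgebra.single_mul_single, one_mul]
            congr 1
            ext1
            simp
          rw [Ideal.mem_span_singleton] at hfx ⊢
          have h2 := map_dvd (Δ.toStalk (Δ.rayCone i) _ hmem) hfx
          exact (hs.dvd_mul_right).mp (hfs ▸ h2)
      rw [heq]
      infer_instance
    have h1 := hasOrd_one_of_isMaximal (L := (Δ.toricVariety k).functionField)
      (by rw [hx']; exact Δ.chi_ne_zero k ρ) hmax
    rw [hx'] at h1
    exact ⟨_, hchi ▸ (hw ▸ hasOrd_of_unit w).mul (h1.zpow _)⟩

lemma hasOrd_intUnit {z : Δ.toricVariety k} (ε : ℤˣ) :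
    HasOrd ((Δ.toricVariety k).presheaf.stalk z)
      ((ε : ℤ) : (Δ.toricVariety k).functionField) 0 := by
  have := hasOrd_of_unit (L := (Δ.toricVariety k).functionField)
    (Units.map (Int.castRingHom ((Δ.toricVariety k).presheaf.stalk z)).toMonoidHom ε)
  simpa using this

lemma exists_isCanonicalDivisor : ∃ K, IsCanonicalDivisor (Δ.toSpec k) n K := by
  obtain ⟨B₀, j₀, hB₀⟩ := Δ.exists_adapted_basis 0
  obtain ⟨ω, hω⟩ := Δ.exists_chi_kaehlerBasis k hB₀
  have key : ∀ z : Δ.toricVariety k, ∃ e : ℤ, Order.coheight z = 1 →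
      ∃ (b : Module.Basis (Fin n) ((Δ.toricVariety k).presheaf.stalk z)
          Ω[(Δ.toricVariety k).presheaf.stalk z⁄k])
        (J : Matrix (Fin n) (Fin n) (Δ.toricVariety k).functionField),
        (∀ i, ω i = ∑ j, J i j • stalkDifferentialMap (Δ.toSpec k) z (b j)) ∧
        HasOrd ((Δ.toricVariety k).presheaf.stalk z) J.det e := by
    intro z
    by_cases hz : Order.coheight z = 1
    · obtain ⟨i, ρ, -, hor, hρ, b, b', H, ε, hb, hH, hdet⟩ := Δ.exists_local_kaehlerBasis k B₀ hz
      obtain ⟨e, he⟩ := Δ.exists_hasOrd_chi k hor hρ (∑ j, B₀ j - ρ)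
      refine ⟨_, fun _ => ⟨b, H, fun j => ?_, hdet ▸ (Δ.hasOrd_intUnit k ε).mul he⟩⟩
      rw [hω, hH]
      simp only [hb]
    -- A canonical divisor is constrained only in codimension one; elsewhere its value is arbitrary.
    · exact ⟨0, fun h => absurd h hz⟩
  choose K hK using key
  exact ⟨K, ω, hK⟩

end SimplexFan

/-! ### Points with residue field `k`. -/

namespace ToricGeometry

/-- Every germ agrees with a constant modulo the maximal ideal, so the residue field is spanned by
`1`. -/
lemma residueDegree_eq_one {k : Type u} [Field k] {X : Scheme.{u}} (f : X ⟶ Spec (.of k)) (p : X)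
    (h : ∀ a : X.presheaf.stalk p, ∃ c : k, ¬ IsUnit (a - baseToStalk f p c)) :
    f.residueDegree p = 1 := by
  let _ := (f.residueFieldMap p).hom.toAlgebra
  refine (finrank_eq_one_iff_of_nonzero' (K := (Spec (.of k)).residueField (f p))
    (1 : X.residueField p) one_ne_zero).mpr fun x => ?_
  obtain ⟨a, rfl⟩ := X.residue_surjective p x
  obtain ⟨c, hc⟩ := h a
  have h1 : (X.residue p).hom (a - baseToStalk f p c) = 0 :=
    (IsLocalRing.residue_eq_zero_iff _).mpr hc
  rw [map_sub, sub_eq_zero] at h1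
  have key : f.appTop ≫ X.presheaf.germ ⊤ p (TopologicalSpace.Opens.mem_top p) ≫ X.residue p =
      (Spec (.of k)).presheaf.germ ⊤ (f p) trivial ≫ (Spec (.of k)).residue (f p) ≫
        f.residueFieldMap p := by
    rw [Scheme.residue_residueFieldMap]
    exact (Scheme.Hom.germ_stalkMap_assoc f ⊤ p trivial (X.residue p)).symm
  refine ⟨((Scheme.ΓSpecIso (.of k)).inv ≫ (Spec (.of k)).presheaf.germ ⊤ (f p) trivial ≫
    (Spec (.of k)).residue (f p)).hom c, ?_⟩
  rw [Algebra.smul_def, mul_one]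
  refine Eq.trans ?_ h1.symm
  exact congrArg (fun φ => ((Scheme.ΓSpecIso (.of k)).inv ≫ φ).hom c) key.symm

end ToricGeometry

/-! ### The Cartier divisor `r ∑ D_i + div g` and its Weil divisor. -/

namespace SimplexFan

open ToricGeometry

variable {n : ℕ} (k : Type u) [Field k] (Δ : SimplexFan n)

lemma mem_maxCone {i j : Fin (n + 1)} : i ∈ (maxCone j).1 ↔ i ≠ j := by simp [maxCone]

lemma mem_wall {i l m : Fin (n + 1)} : i ∈ (wall l m).1 ↔ i ≠ l ∧ i ≠ m := by
  simp [wall, maxCone]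

variable {k Δ}

lemma mem_chartOpen_wall {z : Δ.toricVariety k} {l m : Fin (n + 1)}
    (hl : z ∈ Δ.chartOpen k (maxCone l)) (hm : z ∈ Δ.chartOpen k (maxCone m)) :
    z ∈ Δ.chartOpen k (wall l m) :=
  mem_chartOpen_of_inter hl hm fun _ h1 h2 => Finset.mem_inter.mpr ⟨h1, h2⟩

/-- The Cartier divisor `r ∑ D_i + div g`, where `φ_j` is the linear function which is `r` on the
rays of `σ_j`. -/
noncomputable def supportDivisor {r : ℕ} {φ : Fin (n + 1) → Fin n → ℤ}
    (hφ : ∀ j i, i ≠ j → φ j ⬝ᵥ Δ.ray i = r) (g : (Δ.toricVariety k).functionFieldˣ)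
    {jf : Δ.toricVariety k → Fin (n + 1)} (hjf : ∀ z, z ∈ Δ.chartOpen k (maxCone (jf z))) :
    CartierDivisor (Δ.toricVariety k) where
  eqn z := g * Δ.chiHom k (.ofAdd (φ (jf z)))
  locally_eq p := by
    -- The linear functions of two maximal cones agree on the common rays, so the quotient of the
    -- two equations is a unit on the chart of the intersection.
    refine ⟨Δ.chartOpen k (maxCone (jf p)), hjf p, fun q hq => ?_⟩
    obtain ⟨w, hw⟩ := Δ.exists_unit_eq_chi k (mem_chartOpen_wall hq (hjf q))
      (m := φ (jf q) - φ (jf p)) (fun i hi => by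
        rw [mem_wall] at hi
        rw [sub_dotProduct, hφ _ _ hi.1, hφ _ _ hi.2, sub_self])
    refine ⟨w, ?_⟩
    rw [hw, Units.val_mul, Units.val_mul, chiHom_apply, chiHom_apply, mul_left_comm, ← chi_add,
      sub_add_cancel]

section Weil

attribute [local instance] stalkAlgebra

/-- Let `γ` be the coefficient of the form defining `K` with respect to `dχ^{B_1} ∧ ⋯ ∧ dχ^{B_n}`,
where `B` is the basis `B₀`. Then `γ χ^{∑ B_j}` is its coefficient with respect to the invariant
logarithmic form, whose divisor is `-∑ D_i`. So the divisor of that function is `K + ∑ D_i`, and its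
power `-r` is the required `g`. This `g` is independent of the chosen cones `jf`. -/
lemma exists_isWeil_supportDivisor {r : ℕ} {φ : Fin (n + 1) → Fin n → ℤ}
    (hφ : ∀ j i, i ≠ j → φ j ⬝ᵥ Δ.ray i = r) {K : Δ.toricVariety k → ℤ}
    (hK : IsCanonicalDivisor (Δ.toSpec k) n K) :
    ∃ g : (Δ.toricVariety k).functionFieldˣ, ∀ (jf : Δ.toricVariety k → Fin (n + 1))
      (hjf : ∀ z, z ∈ Δ.chartOpen k (maxCone (jf z))),
      (supportDivisor hφ g hjf).IsWeil (fun z => r * -K z) := by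
  obtain ⟨ω, hω⟩ := hK
  obtain ⟨B₀, j₀, hB₀⟩ := Δ.exists_adapted_basis 0
  obtain ⟨ω₀, hω₀⟩ := Δ.exists_chi_kaehlerBasis k hB₀
  let G : Matrix (Fin n) (Fin n) (Δ.toricVariety k).functionField := (ω₀.toMatrix ω).transpose
  have hG : ∀ i, ω i = ∑ j, G i j • ω₀ j := fun i => (ω₀.sum_toMatrix_smul_self ω i).symm
  have hdet : IsUnit G.det := by
    rw [Matrix.det_transpose, ← Module.Basis.det_apply]
    exact ω₀.isUnit_det ω
  obtain ⟨γ, hγ⟩ := hdet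
  refine ⟨(γ * Δ.chiHom k (.ofAdd (∑ j, B₀ j)))⁻¹ ^ r, fun jf hjf z hz => ?_⟩
  obtain ⟨b₁, J, hJ, hord⟩ := hω z hz
  obtain ⟨i, ρ, hzi, hor, hρ, b, b', H, ε, hb, hH, hdetH⟩ := Δ.exists_local_kaehlerBasis k B₀ hz
  let T : Matrix (Fin n) (Fin n) ((Δ.toricVariety k).presheaf.stalk z) := (b.toMatrix b₁).transpose
  have hT : ∀ i, b₁ i = ∑ j, T i j • b j := fun i => (b.sum_toMatrix_smul_self b₁ i).symm
  have hdetT : IsUnit T.det := by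
    rw [Matrix.det_transpose, ← Module.Basis.det_apply]
    exact b.isUnit_det b₁
  obtain ⟨τ, hτ⟩ := hdetT
  let alg := algebraMap ((Δ.toricVariety k).presheaf.stalk z) (Δ.toricVariety k).functionField
  -- Both sides expand `ω` in the basis `b'`: through the local basis that witnesses `K`, and
  -- through the differentials of the characters `B₀`. The matrix `T` is invertible over the local
  -- ring, so it does not affect orders.
  have hmul : J * T.map alg = G * H := by
    ext i l
    have e1 : ω i = ∑ l, (J * T.map alg) i l • b' l := by
      rw [hJ i]
      simp only [hT, map_sum, map_smul, hb, Matrix.mul_apply, Finset.sum_smul, Finset.smul_sum]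
      rw [Finset.sum_comm]
      refine Finset.sum_congr rfl fun l _ => Finset.sum_congr rfl fun j _ => ?_
      rw [mul_smul, Matrix.map_apply, algebraMap_smul]
    have e2 : ω i = ∑ l, (G * H) i l • b' l := by
      rw [hG i]
      simp only [hω₀, hH, Matrix.mul_apply, Finset.sum_smul, Finset.smul_sum]
      rw [Finset.sum_comm]
      exact Finset.sum_congr rfl fun l _ => Finset.sum_congr rfl fun j _ => (mul_smul _ _ _).symm
    have e3 := congrArg (fun v => b'.repr v l) (e1.symm.trans e2)
    simpa only [b'.repr_sum_self] using e3
  have hdetJ : J.det * alg τ = γ * (((ε : ℤ) : (Δ.toricVariety k).functionField) *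
      Δ.chi k (∑ j, B₀ j - ρ)) := by
    rw [hτ, ← hdetH, hγ, ← Matrix.det_mul, ← hmul, Matrix.det_mul]
    congr 1
    exact RingHom.map_det alg T
  -- On `D_i` the exponent is orthogonal to `v_i`: the chart of `jf z` contains the generic point of
  -- `D_i`, so `v_i` is a ray of that cone and `φ` takes the value `r` there, while `⟨ρ, v_i⟩ = 1`.
  obtain ⟨w, hw⟩ : ∃ w : ((Δ.toricVariety k).presheaf.stalk z)ˣ,
      alg w = Δ.chi k (φ (jf z) - r • ρ) := by
    rcases hor with h | h
    · exact Δ.exists_unit_eq_chi k h (fun i hi => by simp [zeroCone] at hi)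
    · refine Δ.exists_unit_eq_chi k hzi fun t ht => ?_
      obtain rfl := Finset.mem_singleton.mp ht
      have hle : Δ.rayCone t ≤ maxCone (jf z) := Δ.le_of_orbitPoint_mem k (h ▸ hjf z)
      have hne := mem_maxCone.mp (hle (Finset.mem_singleton_self t))
      rw [sub_dotProduct, hφ _ _ hne, smul_dotProduct, hρ]
      simp
  have hchi : Δ.chi k (φ (jf z)) * (Δ.chi k (∑ j, B₀ j))⁻¹ ^ r =
      alg w * (Δ.chi k (∑ j, B₀ j - ρ))⁻¹ ^ r := by
    have e1 : Δ.chi k (φ (jf z)) = alg w * Δ.chi k ρ ^ r := by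
      rw [hw, ← zpow_natCast, ← chi_zsmul, ← chi_add, natCast_zsmul, sub_add_cancel]
    have e2 : Δ.chi k (∑ j, B₀ j) = Δ.chi k (∑ j, B₀ j - ρ) * Δ.chi k ρ := by
      rw [← chi_add, sub_add_cancel]
    have h0 := Δ.chi_ne_zero k ρ
    rw [e1, e2, mul_inv, mul_pow, inv_pow (Δ.chi k ρ)]
    field_simp
  have hε : HasOrd ((Δ.toricVariety k).presheaf.stalk z)
      (((ε : ℤ) : (Δ.toricVariety k).functionField)) 0 := Δ.hasOrd_intUnit k ε
  have hε0 : ((ε : ℤ) : (Δ.toricVariety k).functionField) ≠ 0 := by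
    rcases Int.units_eq_one_or ε with rfl | rfl <;> simp
  have hτ0 : alg τ ≠ 0 := (τ.isUnit.map alg).ne_zero
  -- The local equation equals `(det J)^{-r}` times a unit, so its order is `-r` times that of `det
  -- J`.
  have hfin : ((supportDivisor hφ ((γ * Δ.chiHom k (.ofAdd (∑ j, B₀ j)))⁻¹ ^ r) hjf).eqn z :
      (Δ.toricVariety k).functionField) =
      J.det⁻¹ ^ r * ((alg τ)⁻¹ ^ r * (((ε : ℤ) : (Δ.toricVariety k).functionField) ^ r * alg w)) := by
    change ((((γ * Δ.chiHom k (.ofAdd (∑ j, B₀ j)))⁻¹ ^ r * Δ.chiHom k (.ofAdd (φ (jf z))) :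
      (Δ.toricVariety k).functionFieldˣ)) : (Δ.toricVariety k).functionField) = _
    have e1 : J.det⁻¹ * (alg τ)⁻¹ * ((ε : ℤ) : (Δ.toricVariety k).functionField) =
        (γ : (Δ.toricVariety k).functionField)⁻¹ * (Δ.chi k (∑ j, B₀ j - ρ))⁻¹ := by
      rw [← mul_inv, hdetJ, mul_inv, mul_inv]
      field_simp
    calc _ = (γ : (Δ.toricVariety k).functionField)⁻¹ ^ r *
          (Δ.chi k (φ (jf z)) * (Δ.chi k (∑ j, B₀ j))⁻¹ ^ r) := by
          simp only [Units.val_mul, Units.val_pow_eq_pow_val, Units.val_inv_eq_inv_val, mul_inv,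
            chiHom_apply, mul_pow]
          ring
      _ = (J.det⁻¹ * (alg τ)⁻¹ * ((ε : ℤ) : (Δ.toricVariety k).functionField)) ^ r * alg w := by
          rw [hchi, e1, mul_pow]
          ring
      _ = _ := by
          rw [mul_pow, mul_pow]
          ring
  rw [hfin]
  have := (hord.inv.pow r).mul (((hasOrd_of_unit τ).inv.pow r).mul ((hε.pow r).mul (hasOrd_of_unit w)))
  simpa using this

end Weil

end SimplexFan

/-! ### The curve of a wall: its coordinate, its fixed points and the degree. -/

namespace SimplexFan

open ToricGeometry

variable {n : ℕ} (k : Type u) [Field k] (Δ : SimplexFan n)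

lemma orbitPoint_specializes {K L : Cone n} (h : K ≤ L) :
    Δ.orbitPoint k K ⤳ Δ.orbitPoint k L := by
  rw [Δ.orbitPoint_eq k h, orbitPoint, chartPoint_specializes_iff]
  refine fun f hf => Δ.mem_of_faceHom_eq_zero k h (fun m hm => ?_) ((Δ.mem_facePrime k h f).mp hf)
  obtain ⟨i, hi, hm⟩ := hm
  exact (Δ.mem_facePrime k _ _).mpr (Δ.faceHom_single_of_exists k _ _ ⟨i, h hi, hm⟩)

lemma faceHom_eq_zero_of_le {I K L : Cone n} (h : K ≤ L) (hL : L ≤ I) {f : Δ.chartRing k I}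
    (hf : Δ.faceHom k (h.trans hL) f = 0) : Δ.faceHom k hL f = 0 := by
  rw [← mem_facePrime]
  refine Δ.mem_of_faceHom_eq_zero k (h.trans hL) (fun m hm => ?_) hf
  obtain ⟨i, hi, hm⟩ := hm
  exact (Δ.mem_facePrime k _ _).mpr (Δ.faceHom_single_of_exists k _ _ ⟨i, h hi, hm⟩)

/-- Functions on the chart of a maximal cone have a value at the fixed point. -/
lemma exists_faceHom_sub_eq_zero (j : Fin (n + 1)) (f : Δ.chartRing k (maxCone j)) :
    ∃ a : k, Δ.faceHom k (le_refl (maxCone j)) (f - algebraMap k _ a) = 0 := by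
  induction f using AddMonoidAlgebra.induction_linear with
  | zero => exact ⟨0, by simp⟩
  | add f g hf hg =>
    obtain ⟨a, ha⟩ := hf
    obtain ⟨b, hb⟩ := hg
    refine ⟨a + b, ?_⟩
    rw [map_add, add_sub_add_comm, map_add, ha, hb, add_zero]
  | single m a =>
    by_cases hm : m = 0
    · subst hm
      refine ⟨a, ?_⟩
      have : (AddMonoidAlgebra.single 0 a : Δ.chartRing k (maxCone j)) = algebraMap k _ a := by simp
      rw [this, sub_self, map_zero]
    · refine ⟨0, ?_⟩
      rw [map_zero, sub_zero]
      refine Δ.faceHom_single_of_exists k _ a ?_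
      by_contra! h
      refine hm (Subtype.ext (Δ.ext_of_dotProduct_ray j fun i hi => ?_))
      rw [h i (mem_maxCone.mpr hi)]
      exact (zero_dotProduct _).symm

/-- A germ is a fraction `f / s` of chart functions. Each has a value at the fixed point, the value
of `s` being nonzero, and the quotient of the values is the value of the germ. -/
lemma residueDegree_orbitPoint (j : Fin (n + 1)) :
    (Δ.toSpec k).residueDegree (Δ.orbitPoint k (maxCone j)) = 1 := by
  have hmem := Δ.orbitPoint_mem k (le_refl (maxCone j))
  refine residueDegree_eq_one _ _ fun a => ?_
  obtain ⟨f, s, hs, hfs⟩ := exists_chartToStalk_mul (Δ.chartι k (maxCone j)) _ hmem a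
  obtain ⟨α, hα⟩ := Δ.exists_faceHom_sub_eq_zero k j f
  obtain ⟨β, hβ⟩ := Δ.exists_faceHom_sub_eq_zero k j s
  have hs' := (Δ.isUnit_toStalk_orbitPoint k le_rfl s).mp hs
  have hβ0 : β ≠ 0 := by
    rintro rfl
    rw [map_zero, sub_zero] at hβ
    exact hs' hβ
  refine ⟨α / β, fun hu => ?_⟩
  have h1 := hu.mul hs
  rw [← toStalk_algebraMap hmem] at h1
  change IsUnit ((a - Δ.toStalk (maxCone j) _ hmem _) * Δ.toStalk (maxCone j) _ hmem s) at h1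
  have h2 : (a - Δ.toStalk (maxCone j) _ hmem (algebraMap k _ (α / β))) *
      Δ.toStalk (maxCone j) _ hmem s =
      Δ.toStalk (maxCone j) _ hmem (f - algebraMap k _ (α / β) * s) := by
    rw [sub_mul, map_sub, map_mul]
    congr 1
  rw [h2, Δ.isUnit_toStalk_orbitPoint k le_rfl] at h1
  apply h1
  have h3 : f - algebraMap k _ (α / β) * s =
      (f - algebraMap k _ α) - algebraMap k _ (α / β) * (s - algebraMap k _ β) := by
    rw [mul_sub, ← map_mul, div_mul_cancel₀ _ hβ0]
    ring
  rw [h3, map_sub, map_mul, hα, hβ, mul_zero, sub_zero]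

variable {k Δ} {l m : Fin (n + 1)} {u : Fin n → ℤ}

lemma IsWallGenerator.mem_maxCone (hu : Δ.IsWallGenerator l m u) :
    u ∈ Δ.dualMonoid (maxCone m) := by
  intro i hi
  rw [SimplexFan.mem_maxCone] at hi
  by_cases hil : i = l
  · exact hil ▸ hu.pos.le
  · exact (hu.eq_zero i hil hi).ge

lemma wall_le_right (l m : Fin (n + 1)) : wall l m ≤ maxCone m := Finset.inter_subset_right

/-- The only characters on `U_{σ_m}` orthogonal to the wall are the powers of `χ^u`. -/
lemma IsWallGenerator.exists_nsmul (hu : Δ.IsWallGenerator l m u) (hlm : l ≠ m)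
    (x : Δ.dualMonoid (maxCone m)) (hx : ∀ i ∈ (wall l m).1, x.1 ⬝ᵥ Δ.ray i = 0) :
    ∃ c : ℕ, x = c • (⟨u, hu.mem_maxCone⟩ : Δ.dualMonoid (maxCone m)) := by
  obtain ⟨c, hc⟩ := hu.exists_smul x.1 fun i h1 h2 => hx i (SimplexFan.mem_wall.mpr ⟨h1, h2⟩)
  have h1 := x.2 l (SimplexFan.mem_maxCone.mpr hlm)
  rw [hc, smul_dotProduct, smul_eq_mul] at h1
  have h2 : 0 ≤ c := nonneg_of_mul_nonneg_left h1 hu.pos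
  refine ⟨c.toNat, Subtype.ext ?_⟩
  rw [hc, AddSubmonoidClass.coe_nsmul, ← natCast_zsmul, Int.toNat_of_nonneg h2]

/-- Modulo the ideal of the curve the chart ring is `k[χ^u]`, since the characters that survive are
powers of `χ^u`. The constant term is separated so that vanishing at the fixed point means
divisibility by `χ^u` on the curve. -/
lemma IsWallGenerator.exists_decomposition (hu : Δ.IsWallGenerator l m u) (hlm : l ≠ m)
    (f : Δ.chartRing k (maxCone m)) :
    ∃ (a : k) (g h : Δ.chartRing k (maxCone m)),
      f = algebraMap k _ a + AddMonoidAlgebra.single ⟨u, hu.mem_maxCone⟩ 1 * g + h ∧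
        Δ.faceHom k (wall_le_right l m) h = 0 := by
  induction f using AddMonoidAlgebra.induction_linear with
  | zero => exact ⟨0, 0, 0, by simp, by simp⟩
  | add f f' hf hf' =>
    obtain ⟨a, g, h, rfl, hh⟩ := hf
    obtain ⟨a', g', h', rfl, hh'⟩ := hf'
    exact ⟨a + a', g + g', h + h', by rw [map_add]; ring, by rw [map_add, hh, hh', add_zero]⟩
  | single x a =>
    by_cases hx : ∀ i ∈ (wall l m).1, x.1 ⬝ᵥ Δ.ray i = 0
    · obtain ⟨c, rfl⟩ := hu.exists_nsmul hlm x hx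
      cases c with
      | zero => exact ⟨a, 0, 0, by simp, by simp⟩
      | succ c =>
        refine ⟨0, AddMonoidAlgebra.single (c • ⟨u, hu.mem_maxCone⟩) a, 0, ?_, by simp⟩
        rw [AddMonoidAlgebra.single_mul_single, one_mul, succ_nsmul']
        simp
    · push Not at hx
      exact ⟨0, 0, AddMonoidAlgebra.single x a, by simp,
        Δ.faceHom_single_of_exists k _ a hx⟩

/-- The coordinate `χ^u` on the curve `V(μ_{l,m})` vanishes only at the fixed point of `σ_m`. -/
lemma IsWallGenerator.eq_orbitPoint (hu : Δ.IsWallGenerator l m u) (hlm : l ≠ m)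
    {p : Δ.toricVariety k} (hp : p ∈ Δ.chartOpen k (maxCone m))
    (hc : Δ.orbitPoint k (wall l m) ⤳ p)
    (hnon : ¬ IsUnit (Δ.toStalk (maxCone m) p hp
      (AddMonoidAlgebra.single ⟨u, hu.mem_maxCone⟩ 1))) :
    p = Δ.orbitPoint k (maxCone m) := by
  obtain ⟨y, rfl⟩ := exists_chartPoint hp
  rw [Δ.orbitPoint_eq k (wall_le_right l m), chartPoint_specializes_iff] at hc
  have hmem : AddMonoidAlgebra.single ⟨u, hu.mem_maxCone⟩ 1 ∈ y.asIdeal := by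
    by_contra h
    exact hnon ((isUnit_chartToStalk_iff (Δ.chartι k (maxCone m)) y _).mpr h)
  -- The prime contains positive powers of `χ^u` and all characters not orthogonal to the wall:
  -- together, every nontrivial character of the chart.
  have hle : (Δ.facePrime k (le_refl (maxCone m))).asIdeal ≤ y.asIdeal := by
    intro f hf
    refine Δ.mem_of_faceHom_eq_zero k le_rfl (fun x hx => ?_) ((Δ.mem_facePrime k _ f).mp hf)
    by_cases hw : ∀ i ∈ (wall l m).1, x.1 ⬝ᵥ Δ.ray i = 0
    · obtain ⟨c, rfl⟩ := hu.exists_nsmul hlm x hw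
      have hc0 : c ≠ 0 := by
        rintro rfl
        obtain ⟨i, -, hi⟩ := hx
        apply hi
        rw [zero_smul]
        exact zero_dotProduct _
      have := Ideal.pow_mem_of_mem _ hmem c (Nat.pos_of_ne_zero hc0)
      rwa [AddMonoidAlgebra.single_pow, one_pow] at this
    · push Not at hw
      exact hc ((Δ.mem_facePrime k _ _).mpr (Δ.faceHom_single_of_exists k _ _ hw))
  -- The ideal of the fixed point is maximal: modulo it every function is constant, and a nonzero
  -- constant is not in a prime ideal.
  have heq : y = Δ.facePrime k (le_refl (maxCone m)) := by
    refine PrimeSpectrum.ext (le_antisymm (fun f hf => ?_) hle)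
    obtain ⟨a, ha⟩ := Δ.exists_faceHom_sub_eq_zero k m f
    have h1 := y.asIdeal.sub_mem hf (hle ((Δ.mem_facePrime k _ _).mpr ha))
    rw [sub_sub_cancel] at h1
    have ha0 : a = 0 := by
      by_contra h0
      exact y.isPrime.ne_top (Ideal.eq_top_of_isUnit_mem _ h1 ((IsUnit.mk0 a h0).map _))
    rw [ha0, map_zero, sub_zero] at ha
    exact (Δ.mem_facePrime k _ _).mpr ha
  rw [heq]
  rfl

/-- The order of `χ^u` at the points of the curve `V(μ_{l,m})` in the chart `U_{σ_m}`. -/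
lemma IsWallGenerator.hasOrd (hu : Δ.IsWallGenerator l m u) (hlm : l ≠ m)
    {p : Δ.toricVariety k} (hp : p ∈ Δ.chartOpen k (maxCone m))
    (hc : Δ.orbitPoint k (wall l m) ⤳ p) [Decidable (p = Δ.orbitPoint k (maxCone m))] :
    HasOrd (curveLocalRing hc) (((Δ.toricVariety k).residue (Δ.orbitPoint k (wall l m))).hom
      (Δ.toStalk (maxCone m) _ (Δ.orbitPoint_mem k (wall_le_right l m))
        (AddMonoidAlgebra.single ⟨u, hu.mem_maxCone⟩ 1)))
      (if p = Δ.orbitPoint k (maxCone m) then 1 else 0) := by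
  set c := Δ.orbitPoint k (wall l m) with hcdef
  have hcm := Δ.orbitPoint_mem k (wall_le_right l m)
  let ψ := ((Δ.toricVariety k).residue c).hom.comp
    ((Δ.toricVariety k).presheaf.stalkSpecializes hc).hom
  let π : (Δ.toricVariety k).presheaf.stalk p →+* curveLocalRing hc := ψ.rangeRestrict
  have hπs : Function.Surjective π := ψ.rangeRestrict_surjective
  have hπ : ∀ f : Δ.chartRing k (maxCone m), (π (Δ.toStalk (maxCone m) p hp f) :
      (Δ.toricVariety k).residueField c) =
        ((Δ.toricVariety k).residue c).hom (Δ.toStalk (maxCone m) c hcm f) := by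
    intro f
    change ((Δ.toricVariety k).residue c).hom (((Δ.toricVariety k).presheaf.stalkSpecializes hc).hom
      (Δ.toStalk (maxCone m) p hp f)) = _
    rw [Δ.stalkSpecializes_toStalk k hc hp hcm]
  set x : Δ.chartRing k (maxCone m) := AddMonoidAlgebra.single ⟨u, hu.mem_maxCone⟩ 1 with hx
  have halg : algebraMap (curveLocalRing hc) ((Δ.toricVariety k).residueField c)
      (π (Δ.toStalk (maxCone m) p hp x)) =
      ((Δ.toricVariety k).residue c).hom (Δ.toStalk (maxCone m) c hcm x) := hπ x
  rw [← halg]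
  split_ifs with hpm
  · have hxc : IsUnit (Δ.toStalk (maxCone m) c hcm x) := by
      rw [Δ.isUnit_toStalk_orbitPoint k (wall_le_right l m), hx, Δ.faceHom_single_of_forall k]
      · simp
      · intro i hi
        rw [SimplexFan.mem_wall] at hi
        exact hu.eq_zero i hi.1 hi.2
    have hunit : ∀ f, IsUnit (Δ.toStalk (maxCone m) p hp f) ↔
        Δ.faceHom k (le_refl (maxCone m)) f ≠ 0 := by
      subst hpm
      exact Δ.isUnit_toStalk_orbitPoint k le_rfl
    have hxface : Δ.faceHom k (le_refl (maxCone m)) x = 0 :=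
      Δ.faceHom_single_of_exists k _ _ ⟨l, SimplexFan.mem_maxCone.mpr hlm, hu.pos.ne'⟩
    have hloc : IsLocalRing (curveLocalRing hc) := IsLocalRing.of_surjective' π hπs
    refine hasOrd_one_of_isMaximal (halg ▸ (hxc.map _).ne_zero) ?_
    -- At the fixed point `χ^u` is a uniformizer of the curve: a non-unit comes from a function
    -- without constant term, hence is a multiple of `χ^u` after restriction.
    have heq : Ideal.span {π (Δ.toStalk (maxCone m) p hp x)} = IsLocalRing.maximalIdeal _ := by
      refine le_antisymm ?_ fun a ha => ?_
      · rw [Ideal.span_singleton_le_iff_mem, IsLocalRing.mem_maximalIdeal, mem_nonunits_iff]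
        intro hun
        obtain ⟨b, hb⟩ := hun.exists_right_inv
        obtain ⟨b, rfl⟩ := hπs b
        -- An inverse on the curve would lift to some `b`; then `1 - x b` would be a unit of the
        -- local ring of `X` restricting to zero.
        have h1 : IsUnit (1 - Δ.toStalk (maxCone m) p hp x * b) := by
          refine IsLocalRing.isUnit_one_sub_self_of_mem_nonunits _ fun h => ?_
          exact (hunit x).mp (isUnit_of_mul_isUnit_left h) hxface
        have h2 := (h1.map π).ne_zero
        rw [map_sub, map_one, map_mul, hb, sub_self] at h2
        exact h2 rfl
      · obtain ⟨a', rfl⟩ := hπs a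
        obtain ⟨f, s, hs, hfs⟩ := exists_chartToStalk_mul (Δ.chartι k (maxCone m)) p hp a'
        have hf : Δ.faceHom k (le_refl (maxCone m)) f = 0 := by
          by_contra hne
          have h1 : IsUnit (a' * chartToStalk (Δ.chartι k (maxCone m)) p hp s) :=
            hfs ▸ (hunit f).mpr hne
          exact ha ((isUnit_of_mul_isUnit_left h1).map π)
        obtain ⟨α, g, h, hdec, hh⟩ := hu.exists_decomposition hlm f
        have hα : α = 0 := by
          have h1 := congrArg (Δ.faceHom k (le_refl (maxCone m))) hdec
          rw [hf, map_add, map_add, map_mul, ← hx, hxface, zero_mul, add_zero,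
            Δ.faceHom_eq_zero_of_le k (wall_le_right l m) le_rfl hh, add_zero,
            AlgHom.commutes] at h1
          by_contra hne
          exact ((IsUnit.mk0 α hne).map (algebraMap k (AddMonoidAlgebra k (Fin n → ℤ)))).ne_zero
            h1.symm
        have hπh : π (Δ.toStalk (maxCone m) p hp h) = 0 := by
          refine Subtype.ext ((hπ h).trans ?_)
          refine (IsLocalRing.residue_eq_zero_iff _).mpr ?_
          rw [IsLocalRing.mem_maximalIdeal, mem_nonunits_iff, Δ.isUnit_toStalk_orbitPoint k,
            not_not]
          exact hh
        rw [Ideal.mem_span_singleton]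
        have h3 : π a' * π (Δ.toStalk (maxCone m) p hp s) =
            π (Δ.toStalk (maxCone m) p hp x) * π (Δ.toStalk (maxCone m) p hp g) := by
          rw [← map_mul]
          refine (congrArg π hfs).trans ?_
          change π (Δ.toStalk (maxCone m) p hp f) = _
          rw [hdec, hα, map_zero, zero_add, map_add, map_add, hπh, add_zero, map_mul, map_mul]
        exact ((hs.map π).dvd_mul_right).mp ⟨_, h3⟩
    rw [heq]
    infer_instance
  · have hun : IsUnit (Δ.toStalk (maxCone m) p hp x) := by
      by_contra h
      exact hpm (hu.eq_orbitPoint hlm hp hc h)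
    exact hasOrd_of_isUnit (hun.map π)

/-- The degree of the divisor `r ∑ D_i` on the curve `V(μ_{l,m})`. -/
lemma IsWallGenerator.hasDegree_supportDivisor (hu : Δ.IsWallGenerator l m u) (hlm : l ≠ m)
    {r : ℕ} {φ : Fin (n + 1) → Fin n → ℤ} (hφ : ∀ j i, i ≠ j → φ j ⬝ᵥ Δ.ray i = r)
    (g : (Δ.toricVariety k).functionFieldˣ)
    {jf : Δ.toricVariety k → Fin (n + 1)} (hjf : ∀ z, z ∈ Δ.chartOpen k (maxCone (jf z)))
    (hl : jf (Δ.orbitPoint k (wall l m)) = l) {s : ℤ} (hs : φ m - φ l = s • u) :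
    (supportDivisor hφ g hjf).HasDegree (Δ.toSpec k) (Δ.orbitClosure k (wall l m)) s := by
  classical
  have hcm := Δ.orbitPoint_mem k (wall_le_right l m)
  -- The equation at the generic point of the curve is that of `σ_l`. Relative to it the divisor
  -- restricts to `1` on the chart of `σ_l` and to `(χ^u)^s` on that of `σ_m`, so its cycle is `s`
  -- times the fixed point of `σ_m`.
  refine ⟨Δ.orbitPoint k (wall l m), Finsupp.single (Δ.orbitPoint k (maxCone m)) s,
    Δ.isGenericPoint_orbitPoint k _, fun p hp => ?_, fun p h hpc => ?_, ?_⟩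
  · have hp' := Finsupp.support_single_subset hp
    rw [Finset.mem_singleton] at hp'
    subst hp'
    refine ⟨Δ.orbitPoint_specializes k (wall_le_right l m), fun h => ?_⟩
    have h1 : maxCone m ≤ wall l m := by
      apply Δ.le_of_orbitPoint_mem k
      rw [h]
      exact Δ.orbitPoint_mem k le_rfl
    exact (SimplexFan.mem_wall.mp (h1 (SimplexFan.mem_maxCone.mpr hlm))).1 rfl
  · have hcj : Δ.orbitPoint k (wall l m) ∈ Δ.chartOpen k (maxCone (jf p)) :=
      h.mem_open (Δ.chartOpen k _).isOpen (hjf p)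
    have hle := Δ.le_of_orbitPoint_mem k hcj
    -- A chart containing a point of the curve contains its generic point, so the wall is a face of
    -- the chosen cone.
    have hor : jf p = l ∨ jf p = m := by
      by_contra! hne
      exact SimplexFan.mem_maxCone.mp (hle (SimplexFan.mem_wall.mpr hne)) rfl
    rcases hor with hj | hj
    · refine ⟨1, ?_, ?_⟩
      · change _ * ((g * Δ.chiHom k (.ofAdd (φ (jf _))) : (Δ.toricVariety k).functionFieldˣ) :
          (Δ.toricVariety k).functionField) = ((g * Δ.chiHom k (.ofAdd (φ (jf p))) :
            (Δ.toricVariety k).functionFieldˣ) : (Δ.toricVariety k).functionField)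
        rw [hl, hj, Units.val_one, map_one, one_mul]
      · have hne : Δ.orbitPoint k (maxCone m) ≠ p := by
          rintro rfl
          have h1 := Δ.le_of_orbitPoint_mem k (hjf (Δ.orbitPoint k (maxCone m)))
          rw [hj] at h1
          exact SimplexFan.mem_maxCone.mp (h1 (SimplexFan.mem_maxCone.mpr hlm)) rfl
        rw [Finsupp.single_eq_of_ne' hne]
        have := hasOrd_of_unit (A := curveLocalRing h)
          (L := (Δ.toricVariety k).residueField (Δ.orbitPoint k (wall l m))) 1
        simpa using this
    · have hp : p ∈ Δ.chartOpen k (maxCone m) := hj ▸ hjf p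
      have hxc : IsUnit (Δ.toStalk (maxCone m) _ hcm
          (AddMonoidAlgebra.single ⟨u, hu.mem_maxCone⟩ 1)) := by
        rw [Δ.isUnit_toStalk_orbitPoint k (wall_le_right l m), Δ.faceHom_single_of_forall k]
        · simp
        · intro i hi
          rw [SimplexFan.mem_wall] at hi
          exact hu.eq_zero i hi.1 hi.2
      obtain ⟨w₀, hw₀⟩ := hxc
      have hw₀alg : algebraMap _ (Δ.toricVariety k).functionField
          (w₀ : (Δ.toricVariety k).presheaf.stalk (Δ.orbitPoint k (wall l m))) = Δ.chi k u := by
        rw [hw₀, algebraMap_toStalk_single]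
      have hpow : ∀ {L : Type u} [Field L]
          (f : (Δ.toricVariety k).presheaf.stalk (Δ.orbitPoint k (wall l m)) →+* L),
          f ((w₀ ^ s : ((Δ.toricVariety k).presheaf.stalk (Δ.orbitPoint k (wall l m)))ˣ) :
            (Δ.toricVariety k).presheaf.stalk (Δ.orbitPoint k (wall l m))) = f w₀ ^ s := by
        intro L _ f
        have := congrArg Units.val (map_zpow (Units.map f.toMonoidHom) w₀ s)
        rw [Units.val_zpow_eq_zpow_val] at this
        exact this
      refine ⟨w₀ ^ s, ?_, ?_⟩
      · change _ * ((g * Δ.chiHom k (.ofAdd (φ (jf _))) : (Δ.toricVariety k).functionFieldˣ) :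
          (Δ.toricVariety k).functionField) = ((g * Δ.chiHom k (.ofAdd (φ (jf p))) :
            (Δ.toricVariety k).functionFieldˣ) : (Δ.toricVariety k).functionField)
        rw [hl, hj, hpow, hw₀alg, Units.val_mul, Units.val_mul, chiHom_apply, chiHom_apply,
          mul_left_comm, ← chi_zsmul, ← hs, ← chi_add, sub_add_cancel]
      · rw [hpow, hw₀]
        have := (hu.hasOrd hlm hp h).zpow s
        convert this using 1
        by_cases hpm : p = Δ.orbitPoint k (maxCone m)
        · rw [if_pos hpm, hpm, Finsupp.single_eq_same, mul_one]
        · rw [if_neg hpm, Finsupp.single_eq_of_ne' (Ne.symm hpm), mul_zero]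
  · rw [Finsupp.sum_single_index (zero_mul _), residueDegree_orbitPoint]
    simp

lemma IsWallGenerator.isAnticanonicalDegree (hu : Δ.IsWallGenerator l m u) (hlm : l ≠ m)
    {r : ℕ} (hr : 0 < r) {φ : Fin (n + 1) → Fin n → ℤ} (hφ : ∀ j i, i ≠ j → φ j ⬝ᵥ Δ.ray i = r)
    {s : ℤ} (hs : φ m - φ l = s • u) :
    IsAnticanonicalDegree (Δ.toSpec k) n (Δ.orbitClosure k (wall l m)) ((s : ℚ) / r) := by
  classical
  refine ⟨Δ.exists_isCanonicalDivisor k, fun K hK => ?_⟩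
  obtain ⟨g, hg⟩ := exists_isWeil_supportDivisor hφ hK
  choose j₀ hj₀ using exists_mem_maxCone (Δ := Δ) (k := k)
  -- Forcing the value `l` at the generic point of the curve supplies the normalisation assumed in
  -- `hasDegree_supportDivisor`.
  let jf := Function.update j₀ (Δ.orbitPoint k (wall l m)) l
  have hjf : ∀ z, z ∈ Δ.chartOpen k (maxCone (jf z)) := by
    intro z
    by_cases hz : z = Δ.orbitPoint k (wall l m)
    · subst hz
      simp only [jf, Function.update_self]
      exact Δ.orbitPoint_mem k Finset.inter_subset_left
    · simp only [jf, Function.update_of_ne hz]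
      exact hj₀ z
  exact ⟨r, supportDivisor hφ g hjf, s, hr, hg jf hjf,
    hu.hasDegree_supportDivisor hlm hφ g hjf (Function.update_self ..) hs, rfl⟩

end SimplexFan

/-! ### A criterion for isomorphisms of schemes. -/

namespace ToricGeometry

/-- A bijective morphism of schemes which is locally on the source an open immersion is an
isomorphism. -/
lemma isIso_of_bijective_of_forall_exists_isOpenImmersion {X Y : Scheme.{u}} (F : X ⟶ Y)
    (hF : Function.Bijective F)
    (h : ∀ x : X, ∃ (Z : Scheme.{u}) (g : Z ⟶ X) (_ : IsOpenImmersion g)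
      (_ : IsOpenImmersion (g ≫ F)), x ∈ Set.range g) : IsIso F := by
  have hopen : IsOpenMap F := by
    intro U hU
    rw [isOpen_iff_forall_mem_open]
    rintro _ ⟨x, hx, rfl⟩
    obtain ⟨Z, g, _, _, z, rfl⟩ := h x
    refine ⟨(g ≫ F) '' (g ⁻¹' U), ?_, ?_, ⟨z, hx, by simp⟩⟩
    · rintro _ ⟨y, hy, rfl⟩
      exact ⟨g y, hy, by simp⟩
    · exact (g ≫ F).isOpenEmbedding.isOpenMap _ (hU.preimage g.continuous)
  have hstalk : ∀ x, IsIso (F.stalkMap x) := by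
    intro x
    obtain ⟨Z, g, _, _, z, rfl⟩ := h x
    have h1 := Scheme.Hom.stalkMap_comp g F z
    have h2 : IsIso ((g ≫ F).stalkMap z) := inferInstance
    have h3 : IsIso (F.stalkMap (g z) ≫ g.stalkMap z) := h1 ▸ h2
    exact IsIso.of_isIso_comp_right (F.stalkMap (g z)) (g.stalkMap z)
  have : IsOpenImmersion F := IsOpenImmersion.iff_isIso_stalkMap.mpr
    ⟨.of_continuous_injective_isOpenMap F.continuous hF.1 hopen, hstalk⟩
  have : Surjective F := ⟨hF.2⟩
  exact (isIso_iff_isOpenImmersion_and_surjective F).mpr ⟨‹_›, ‹_›⟩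

end ToricGeometry

/-! ### The unimodular fan gives projective space. -/

namespace SimplexFan

open HomogeneousLocalization

variable {n : ℕ} (k : Type u) [Field k] (Δ : SimplexFan n)

attribute [local instance] MvPolynomial.gradedAlgebra

local notation "𝒜" => MvPolynomial.homogeneousSubmodule (Fin (n + 1)) k

/-- The map `k[x_0, …, x_n] → k[x_0^±, …, x_n^±]`. -/
noncomputable def toLaurent : MvPolynomial (Fin (n + 1)) k →+*
    AddMonoidAlgebra k (Fin (n + 1) → ℤ) :=
  AddMonoidAlgebra.mapDomainRingHom k
    ({ toFun := fun α i => (α i : ℤ), map_zero' := by ext; simp, map_add' := by intros; ext; simp } :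
      (Fin (n + 1) →₀ ℕ) →+ (Fin (n + 1) → ℤ))

lemma toLaurent_monomial (α : Fin (n + 1) →₀ ℕ) (a : k) :
    toLaurent k (MvPolynomial.monomial α a) = AddMonoidAlgebra.single (fun i => (α i : ℤ)) a :=
  AddMonoidAlgebra.mapDomain_single

lemma toLaurent_injective : Function.Injective (toLaurent (n := n) k) :=
  AddMonoidAlgebra.mapDomain_injective fun _ _ h => Finsupp.ext fun i =>
    Int.ofNat_inj.mp (congrFun h i)

/-- The monomial `∏_{i ∉ I} x_i`. -/
noncomputable def coordProd (I : Cone n) : MvPolynomial (Fin (n + 1)) k :=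
  ∏ i ∈ I.1ᶜ, MvPolynomial.X i

lemma coordProd_mem (I : Cone n) : coordProd k I ∈ 𝒜 I.1ᶜ.card := by
  have := MvPolynomial.IsHomogeneous.prod I.1ᶜ
    (fun i => (MvPolynomial.X i : MvPolynomial (Fin (n + 1)) k)) (fun _ => 1)
    fun i _ => MvPolynomial.isHomogeneous_X k i
  rw [Finset.sum_const, smul_eq_mul, mul_one] at this
  exact this

lemma card_compl_pos (I : Cone n) : 0 < I.1ᶜ.card := by
  rw [Finset.card_pos, Finset.nonempty_iff_ne_empty, ne_eq, Finset.compl_eq_empty_iff]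
  exact I.2

lemma sum_ite_notMem (I : Cone n) (N : ℕ) :
    ∑ i, (if i ∈ I.1 then 0 else (N : ℤ)) = N * I.1ᶜ.card := by
  rw [← Finset.sum_add_sum_compl I.1, Finset.sum_eq_zero fun i hi => if_pos hi, zero_add,
    Finset.sum_congr rfl fun i hi => if_neg (Finset.mem_compl.mp hi), Finset.sum_const, nsmul_eq_mul,
    mul_comm]

lemma coordProd_eq (I : Cone n) :
    coordProd k I = MvPolynomial.monomial (∑ i ∈ I.1ᶜ, Finsupp.single i 1) 1 := by
  rw [coordProd, MvPolynomial.monomial_sum_one]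
  rfl

lemma toLaurent_coordProd_pow (I : Cone n) (N : ℕ) : toLaurent k (coordProd k I ^ N) =
    AddMonoidAlgebra.single (fun i => if i ∈ I.1 then 0 else (N : ℤ)) 1 := by
  rw [coordProd_eq, MvPolynomial.monomial_pow, toLaurent_monomial, one_pow]
  congr 1
  funext i
  simp [Finsupp.single_apply]

lemma isUnit_toLaurent_coordProd (I : Cone n) : IsUnit (toLaurent k (coordProd k I)) := by
  rw [← pow_one (coordProd k I), toLaurent_coordProd_pow]
  refine IsUnit.of_mul_eq_one (AddMonoidAlgebra.single
    (-fun i => if i ∈ I.1 then 0 else ((1 : ℕ) : ℤ)) 1) ?_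
  rw [AddMonoidAlgebra.single_mul_single, add_neg_cancel, one_mul]
  rfl

/-- The coordinate ring of `D₊(∏_{i ∉ I} x_i)` as a subring of the Laurent polynomials. -/
noncomputable def awayToLaurent (I : Cone n) :
    Away 𝒜 (coordProd k I) →+* AddMonoidAlgebra k (Fin (n + 1) → ℤ) :=
  (Localization.awayLift (toLaurent k) _ (isUnit_toLaurent_coordProd k I)).comp
    (algebraMap (Away 𝒜 (coordProd k I)) (Localization.Away (coordProd k I)))

lemma awayToLaurent_mk_mul (I : Cone n) (N : ℕ) (x : MvPolynomial (Fin (n + 1)) k)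
    (hx : x ∈ 𝒜 (N • I.1ᶜ.card)) :
    awayToLaurent k I (Away.mk 𝒜 (coordProd_mem k I) N x hx) *
      toLaurent k (coordProd k I ^ N) = toLaurent k x := by
  change Localization.awayLift (toLaurent k) _ (isUnit_toLaurent_coordProd k I)
    (Localization.mk x ⟨coordProd k I ^ N, _⟩) * _ = _
  rw [Localization.mk_eq_mk', ← IsLocalization.Away.lift_eq (S := Localization.Away (coordProd k I))
    (coordProd k I) (isUnit_toLaurent_coordProd k I) (coordProd k I ^ N), Localization.awayLift,
    ← map_mul, IsLocalization.mk'_spec (Localization.Away (coordProd k I)) x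
      (⟨coordProd k I ^ N, N, rfl⟩ : Submonoid.powers (coordProd k I)), IsLocalization.Away.lift_eq]

lemma awayToLaurent_injective (I : Cone n) : Function.Injective (awayToLaurent k I) := by
  rw [injective_iff_map_eq_zero]
  intro z hz
  obtain ⟨N, x, hx, rfl⟩ := Away.mk_surjective 𝒜 (coordProd_mem k I) z
  have h := awayToLaurent_mk_mul k I N x hx
  rw [hz, zero_mul] at h
  have hx0 : x = 0 := toLaurent_injective k (by rw [← h, map_zero])
  subst hx0
  apply val_injective
  rw [Away.val_mk, Localization.mk_zero, val_zero]

/-- The coordinate ring `k[σ_I^∨ ∩ M]` as a subring of the Laurent polynomials, by the pairings of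
the characters with the rays. -/
noncomputable def chartToLaurent (I : Cone n) :
    Δ.chartRing k I →+* AddMonoidAlgebra k (Fin (n + 1) → ℤ) :=
  AddMonoidAlgebra.mapDomainRingHom k
    ({ toFun := fun m i => m.1 ⬝ᵥ Δ.ray i
       map_zero' := by ext; simp
       map_add' := by intros; ext; simp [add_dotProduct] } :
      Δ.dualMonoid I →+ (Fin (n + 1) → ℤ))

lemma chartToLaurent_single (I : Cone n) (m : Δ.dualMonoid I) (a : k) :
    Δ.chartToLaurent k I (AddMonoidAlgebra.single m a) =
      AddMonoidAlgebra.single (fun i => m.1 ⬝ᵥ Δ.ray i) a :=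
  AddMonoidAlgebra.mapDomain_single

lemma chartToLaurent_injective (I : Cone n) : Function.Injective (Δ.chartToLaurent k I) :=
  AddMonoidAlgebra.mapDomain_injective fun _ _ h =>
    Subtype.ext (Δ.ext_of_dotProduct_ray 0 fun i _ => congrFun h i)

lemma chartToLaurent_chartRingMap {I J : Cone n} (h : I ≤ J) (f : Δ.chartRing k J) :
    Δ.chartToLaurent k I (Δ.chartRingMap k h f) = Δ.chartToLaurent k J f := by
  induction f using AddMonoidAlgebra.induction_linear with
  | zero => simp
  | add f g hf hg => rw [map_add, map_add, map_add, hf, hg]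
  | single m a =>
    rw [chartRingMap_single, chartToLaurent_single, chartToLaurent_single]
    rfl

variable {Δ}

/-- Multiplying by a large power of `∏_{i ∉ I} x_i` clears the negative exponents. The numerator has
the degree of the denominator because `∑ v_i = 0` makes the pairings of a character sum to zero. -/
lemma IsUnimodular.range_chartToLaurent_le (hΔ : Δ.IsUnimodular) (I : Cone n) :
    (Δ.chartToLaurent k I).range ≤ (awayToLaurent k I).range := by
  rintro _ ⟨f, rfl⟩
  induction f using AddMonoidAlgebra.induction_linear with
  | zero => rw [map_zero]; exact zero_mem _
  | add f g hf hg => rw [map_add]; exact add_mem hf hg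
  | single m a =>
    set N : ℕ := ∑ i, (m.1 ⬝ᵥ Δ.ray i).natAbs with hN
    have hle : ∀ i, (m.1 ⬝ᵥ Δ.ray i).natAbs ≤ N := fun i =>
      Finset.single_le_sum (f := fun i => (m.1 ⬝ᵥ Δ.ray i).natAbs) (fun _ _ => Nat.zero_le _)
        (Finset.mem_univ i)
    let α : Fin (n + 1) →₀ ℕ := Finsupp.equivFunOnFinite.symm fun i =>
      (m.1 ⬝ᵥ Δ.ray i + if i ∈ I.1 then 0 else (N : ℤ)).toNat
    have hα : ∀ i, (α i : ℤ) = m.1 ⬝ᵥ Δ.ray i + if i ∈ I.1 then 0 else (N : ℤ) := by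
      intro i
      refine Int.toNat_of_nonneg ?_
      split_ifs with hi
      · simpa using m.2 i hi
      · have := hle i
        omega
    have hdeg : MvPolynomial.monomial α a ∈ 𝒜 (N • I.1ᶜ.card) := by
      refine MvPolynomial.isHomogeneous_monomial a ?_
      rw [Finsupp.degree_eq_sum]
      zify
      simp_rw [hα, Finset.sum_add_distrib]
      rw [← dotProduct_sum, hΔ.sum_ray, dotProduct_zero, zero_add, sum_ite_notMem]
      rfl
    refine ⟨Away.mk 𝒜 (coordProd_mem k I) N (MvPolynomial.monomial α a) hdeg, ?_⟩
    refine ((isUnit_toLaurent_coordProd k I).pow N).mul_right_cancel ?_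
    rw [← map_pow, awayToLaurent_mk_mul, toLaurent_monomial, toLaurent_coordProd_pow,
      chartToLaurent_single, AddMonoidAlgebra.single_mul_single, mul_one]
    congr 1
    funext i
    exact hα i

/-- The exponent vector of a homogeneous fraction of degree zero sums to zero, so unimodularity
realises it by a character. It is nonnegative on `I`, where the denominator has no factor. -/
lemma IsUnimodular.range_awayToLaurent_le (hΔ : Δ.IsUnimodular) (I : Cone n) :
    (awayToLaurent k I).range ≤ (Δ.chartToLaurent k I).range := by
  rintro _ ⟨z, rfl⟩
  obtain ⟨N, x, hx, rfl⟩ := Away.mk_surjective 𝒜 (coordProd_mem k I) z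
  have key : ∀ x : MvPolynomial (Fin (n + 1)) k, (∀ α, x.coeff α ≠ 0 → α.degree = N • I.1ᶜ.card) →
      ∃ f, Δ.chartToLaurent k I f * toLaurent k (coordProd k I ^ N) = toLaurent k x := by
    intro x hx
    rw [x.as_sum, map_sum]
    have : ∀ α ∈ x.support, ∃ f, Δ.chartToLaurent k I f * toLaurent k (coordProd k I ^ N) =
        toLaurent k (MvPolynomial.monomial α (x.coeff α)) := by
      intro α hα
      have hd := hx α (MvPolynomial.mem_support_iff.mp hα)
      obtain ⟨m, hm⟩ := hΔ.exists_dotProduct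
        (fun i => (α i : ℤ) - if i ∈ I.1 then 0 else (N : ℤ)) (by
          rw [Finsupp.degree_eq_sum] at hd
          zify at hd
          rw [Finset.sum_sub_distrib, hd, sum_ite_notMem, sub_eq_zero]
          rfl)
      refine ⟨AddMonoidAlgebra.single ⟨m, fun i hi => ?_⟩ (x.coeff α), ?_⟩
      · rw [hm, if_pos hi]
        simp
      · rw [toLaurent_monomial, toLaurent_coordProd_pow,
          chartToLaurent_single, AddMonoidAlgebra.single_mul_single, mul_one]
        congr 1
        funext i
        simp [hm]
    choose! f hf using this
    refine ⟨∑ α ∈ x.support, f α, ?_⟩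
    rw [map_sum, Finset.sum_mul]
    exact Finset.sum_congr rfl hf
  obtain ⟨f, hf⟩ := key x fun α hα => by
    rw [Finsupp.degree_eq_weight_one]
    exact hx hα
  refine ⟨f, ((isUnit_toLaurent_coordProd k I).pow N).mul_right_cancel ?_⟩
  rw [← map_pow, awayToLaurent_mk_mul, hf]

lemma IsUnimodular.exists_ringEquiv (hΔ : Δ.IsUnimodular) (I : Cone n) :
    ∃ τ : Away 𝒜 (coordProd k I) ≃+* Δ.chartRing k I,
      ∀ z, Δ.chartToLaurent k I (τ z) = awayToLaurent k I z := by
  have h := le_antisymm (hΔ.range_awayToLaurent_le k I) (hΔ.range_chartToLaurent_le k I)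
  let e := RingEquiv.ofBijective (awayToLaurent k I).rangeRestrict
    ⟨fun a b hab => awayToLaurent_injective k I (congrArg Subtype.val hab),
      RingHom.rangeRestrict_surjective _⟩
  let e' := RingEquiv.ofBijective (Δ.chartToLaurent k I).rangeRestrict
    ⟨fun a b hab => Δ.chartToLaurent_injective k I (congrArg Subtype.val hab),
      RingHom.rangeRestrict_surjective _⟩
  exact ⟨(e.trans (RingEquiv.subringCongr h)).trans e'.symm, fun z =>
    congrArg Subtype.val (e'.apply_symm_apply (RingEquiv.subringCongr h (e z)))⟩

lemma awayToLaurent_awayMap {I J : Cone n} {e : ℕ} {g : MvPolynomial (Fin (n + 1)) k}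
    (hg : g ∈ 𝒜 e) (hx : coordProd k I = coordProd k J * g) (z : Away 𝒜 (coordProd k J)) :
    awayToLaurent k I (awayMap 𝒜 hg hx z) = awayToLaurent k J z := by
  change Localization.awayLift (toLaurent k) _ (isUnit_toLaurent_coordProd k I)
    (awayMap 𝒜 hg hx z).val = 
    Localization.awayLift (toLaurent k) _ (isUnit_toLaurent_coordProd k J) z.val
  rw [val_awayMap]
  have : (Localization.awayLift (toLaurent k) _ (isUnit_toLaurent_coordProd k I)).comp
      (Localization.awayLift (algebraMap (MvPolynomial (Fin (n + 1)) k) _) _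
      (isUnit_of_dvd_unit (map_dvd _ ⟨_, hx⟩)
        (IsLocalization.Away.algebraMap_isUnit (coordProd k I)))) =
      Localization.awayLift (toLaurent k) _ (isUnit_toLaurent_coordProd k J) := by
    refine IsLocalization.ringHom_ext (Submonoid.powers (coordProd k J)) (RingHom.ext fun x => ?_)
    simp [Localization.awayLift, IsLocalization.Away.lift_eq]
  exact congrArg (fun F => F z.val) this

lemma coordProd_mul_prod {I J : Cone n} (h : I ≤ J) :
    coordProd k I = coordProd k J * ∏ i ∈ J.1 \ I.1, MvPolynomial.X i := by
  rw [coordProd, coordProd, ← Finset.prod_union]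
  · congr 1
    ext i
    have : i ∈ I.1 → i ∈ J.1 := fun hi => h hi
    simp only [Finset.mem_compl, Finset.mem_union, Finset.mem_sdiff]
    tauto
  · exact Finset.disjoint_left.mpr fun i hi hi' =>
      Finset.mem_compl.mp hi (Finset.mem_sdiff.mp hi').1

lemma awayι_congr {f : MvPolynomial (Fin (n + 1)) k} {d d' : ℕ} (hf : f ∈ 𝒜 d) (hf' : f ∈ 𝒜 d')
    (hd : 0 < d) (hd' : 0 < d') (h : d = d') :
    Proj.awayι 𝒜 f hf hd = Proj.awayι 𝒜 f hf' hd' := by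
  subst h
  rfl

/-- The isomorphism of the coordinate ring of `D₊(∏_{i ∉ I} x_i)` with `k[σ_I^∨ ∩ M]`. -/
noncomputable def IsUnimodular.ringEquiv (hΔ : Δ.IsUnimodular) (I : Cone n) :
    Away 𝒜 (coordProd k I) ≃+* Δ.chartRing k I :=
  (hΔ.exists_ringEquiv k I).choose

lemma IsUnimodular.chartToLaurent_ringEquiv (hΔ : Δ.IsUnimodular) (I : Cone n)
    (z : Away 𝒜 (coordProd k I)) :
    Δ.chartToLaurent k I (hΔ.ringEquiv k I z) = awayToLaurent k I z :=
  (hΔ.exists_ringEquiv k I).choose_spec z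

/-- The open immersion of the chart `U_I` onto `D₊(∏_{i ∉ I} x_i)`. -/
noncomputable def IsUnimodular.chartToProj (hΔ : Δ.IsUnimodular) (I : Cone n) :
    Spec (.of (Δ.chartRing k I)) ⟶ Proj 𝒜 :=
  Spec.map (hΔ.ringEquiv k I).toCommRingCatIso.hom ≫
    Proj.awayι 𝒜 (coordProd k I) (coordProd_mem k I) (card_compl_pos I)

instance (hΔ : Δ.IsUnimodular) (I : Cone n) : IsOpenImmersion (hΔ.chartToProj k I) := by
  unfold IsUnimodular.chartToProj
  infer_instance

lemma IsUnimodular.range_chartToProj (hΔ : Δ.IsUnimodular) (I : Cone n) :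
    Set.range (hΔ.chartToProj k I) = Proj.basicOpen 𝒜 (coordProd k I) := by
  rw [← Proj.opensRange_awayι 𝒜 (coordProd k I) (coordProd_mem k I) (card_compl_pos I)]
  exact congrArg (fun U : (Proj 𝒜).Opens => (U : Set (Proj 𝒜)))
    (Scheme.Hom.opensRange_comp_of_isIso (Spec.map (hΔ.ringEquiv k I).toCommRingCatIso.hom) _)

lemma IsUnimodular.mem_range_chartToProj (hΔ : Δ.IsUnimodular) (I : Cone n) (p : Proj 𝒜) :
    p ∈ Set.range (hΔ.chartToProj k I) ↔
      ∀ i ∉ I.1, p ∈ Proj.basicOpen 𝒜 (MvPolynomial.X i) := by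
  rw [hΔ.range_chartToProj k]
  change p ∈ Proj.basicOpen 𝒜 (coordProd k I) ↔ _
  simp only [Proj.mem_basicOpen, coordProd]
  have := p.isPrime
  change ¬ (_ ∈ p.asHomogeneousIdeal.toIdeal) ↔ ∀ i ∉ I.1, ¬ (_ ∈ p.asHomogeneousIdeal.toIdeal)
  rw [Ideal.IsPrime.prod_mem_iff]
  simp

/-- Both ring maps become the same inclusion inside the Laurent polynomials, into which the chart
rings embed. -/
lemma IsUnimodular.chartToProj_comp (hΔ : Δ.IsUnimodular) {I J : Cone n} (h : I ≤ J) :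
    Spec.map (CommRingCat.ofHom (Δ.chartRingMap k h).toRingHom) ≫ hΔ.chartToProj k J =
      hΔ.chartToProj k I := by
  have hg : (∏ i ∈ J.1 \ I.1, MvPolynomial.X i : MvPolynomial (Fin (n + 1)) k) ∈
      𝒜 (J.1 \ I.1).card := by
    have := MvPolynomial.IsHomogeneous.prod (J.1 \ I.1)
      (fun i => (MvPolynomial.X i : MvPolynomial (Fin (n + 1)) k)) (fun _ => 1)
      fun i _ => MvPolynomial.isHomogeneous_X k i
    rw [Finset.sum_const, smul_eq_mul, mul_one] at this
    exact this
  have hx := coordProd_mul_prod k h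
  have hcard : J.1ᶜ.card + (J.1 \ I.1).card = I.1ᶜ.card := by
    rw [← Finset.card_union_of_disjoint]
    · congr 1
      ext i
      have : i ∈ I.1 → i ∈ J.1 := fun hi => h hi
      simp only [Finset.mem_compl, Finset.mem_union, Finset.mem_sdiff]
      tauto
    · exact Finset.disjoint_left.mpr fun i hi hi' =>
        Finset.mem_compl.mp hi (Finset.mem_sdiff.mp hi').1
  have h1 := Proj.SpecMap_awayMap_awayι 𝒜 (coordProd_mem k J) (card_compl_pos J) hg hx
  rw [awayι_congr k _ (coordProd_mem k I) _ (card_compl_pos I) hcard] at h1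
  rw [chartToProj, chartToProj, ← h1, ← Spec.map_comp_assoc, ← Spec.map_comp_assoc]
  congr 2
  refine CommRingCat.hom_ext (RingHom.ext fun z => Δ.chartToLaurent_injective k I ?_)
  change Δ.chartToLaurent k I (Δ.chartRingMap k h (hΔ.ringEquiv k J z)) =
    Δ.chartToLaurent k I (hΔ.ringEquiv k I (awayMap 𝒜 hg hx z))
  rw [chartToLaurent_chartRingMap, chartToLaurent_ringEquiv, chartToLaurent_ringEquiv,
    awayToLaurent_awayMap]

lemma awayToLaurent_fromZeroRingHom (I : Cone n) (a : k) :
    awayToLaurent k I (fromZeroRingHom 𝒜 _ (algebraMap k (𝒜 0) a)) =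
      AddMonoidAlgebra.single 0 a := by
  have h : ∀ z : 𝒜 0, awayToLaurent k I (fromZeroRingHom 𝒜 _ z) = toLaurent k z.1 := by
    intro z
    have h1 : (fromZeroRingHom 𝒜 (Submonoid.powers (coordProd k I)) z).val =
      algebraMap _ _ z.1 := Localization.mk_one_eq_algebraMap z.1
    rw [awayToLaurent, RingHom.comp_apply, HomogeneousLocalization.algebraMap_apply, h1, Localization.awayLift,
      IsLocalization.Away.lift_eq]
  rw [h]
  exact toLaurent_monomial k 0 a

lemma chartToLaurent_algebraMap (I : Cone n) (a : k) :
    Δ.chartToLaurent k I (algebraMap k _ a) = AddMonoidAlgebra.single 0 a := by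
  refine (Δ.chartToLaurent_single k I 0 a).trans ?_
  congr 1
  funext i
  exact zero_dotProduct _

lemma IsUnimodular.chartToProj_toSpec (hΔ : Δ.IsUnimodular) (I : Cone n) :
    hΔ.chartToProj k I ≫ Proj.toSpecZero 𝒜 ≫ Spec.map (CommRingCat.ofHom (algebraMap k (𝒜 0))) =
      Spec.map (CommRingCat.ofHom (algebraMap k (Δ.chartRing k I))) := by
  rw [chartToProj, Category.assoc, Proj.awayι_toSpecZero_assoc, ← Spec.map_comp, ← Spec.map_comp]
  congr 1
  refine CommRingCat.hom_ext (RingHom.ext fun a => Δ.chartToLaurent_injective k I ?_)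
  exact (hΔ.chartToLaurent_ringEquiv k I _).trans
    ((awayToLaurent_fromZeroRingHom k I a).trans (chartToLaurent_algebraMap k I a).symm)

/-- The morphism `X(Δ) ⟶ ℙⁿ` glued from the charts. -/
noncomputable def IsUnimodular.toProj (hΔ : Δ.IsUnimodular) : Δ.toricVariety k ⟶ Proj 𝒜 :=
  colimit.desc (Δ.charts k) ⟨Proj 𝒜,
    { app := fun I => hΔ.chartToProj k I
      naturality := fun _ _ f =>
        (hΔ.chartToProj_comp k (leOfHom f)).trans (Category.comp_id _).symm }⟩

lemma IsUnimodular.chartι_toProj (hΔ : Δ.IsUnimodular) (I : Cone n) :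
    Δ.chartι k I ≫ hΔ.toProj k = hΔ.chartToProj k I :=
  colimit.ι_desc _ _

lemma IsUnimodular.toProj_toSpec (hΔ : Δ.IsUnimodular) :
    hΔ.toProj k ≫ Proj.toSpecZero 𝒜 ≫ Spec.map (CommRingCat.ofHom (algebraMap k (𝒜 0))) =
      Δ.toSpec k :=
  colimit.hom_ext fun I => by
    change Δ.chartι k I ≫ _ = Δ.chartι k I ≫ Δ.toSpec k
    rw [chartι_toSpec, ← Category.assoc, chartι_toProj, chartToProj_toSpec]

lemma IsUnimodular.toProj_chartι (hΔ : Δ.IsUnimodular) (I : Cone n)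
    (y : Spec (.of (Δ.chartRing k I))) :
    hΔ.toProj k (Δ.chartι k I y) = hΔ.chartToProj k I y := by
  rw [← chartι_toProj, Scheme.Hom.comp_apply]

/-- A common image lies in `D₊` of every coordinate outside `I ∩ J`, hence in the image of the chart
of `I ∩ J`. Each chart maps injectively, so both points come from that smaller chart. -/
lemma IsUnimodular.toProj_injective (hΔ : Δ.IsUnimodular) : Function.Injective (hΔ.toProj k) := by
  intro z z' h
  obtain ⟨I, y, -, rfl⟩ := exists_mem_chartOpen z
  obtain ⟨J, y', -, rfl⟩ := exists_mem_chartOpen z'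
  change hΔ.toProj k (Δ.chartι k I y) = hΔ.toProj k (Δ.chartι k J y') at h
  change Δ.chartι k I y = Δ.chartι k J y'
  rw [toProj_chartι, toProj_chartι] at h
  let K : Cone n := ⟨I.1 ∩ J.1, fun h => I.2 (Finset.eq_univ_of_forall fun i =>
    (Finset.mem_inter.mp (h ▸ Finset.mem_univ i)).1)⟩
  have hKI : K ≤ I := Finset.inter_subset_left
  have hKJ : K ≤ J := Finset.inter_subset_right
  have hK : hΔ.chartToProj k I y ∈ Set.range (hΔ.chartToProj k K) := by
    rw [mem_range_chartToProj]
    intro i hi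
    by_cases hiI : i ∈ I.1
    · exact (hΔ.mem_range_chartToProj k J _).mp (h ▸ ⟨y', rfl⟩) i
        fun hiJ => hi (Finset.mem_inter.mpr ⟨hiI, hiJ⟩)
    · exact (hΔ.mem_range_chartToProj k I _).mp ⟨y, rfl⟩ i hiI
  obtain ⟨x, hx⟩ := hK
  have key : ∀ (L : Cone n) (hKL : K ≤ L) (w : Spec (.of (Δ.chartRing k L))),
      hΔ.chartToProj k K x = hΔ.chartToProj k L w → Δ.chartι k L w = Δ.chartι k K x := by
    intro L hKL w hw
    rw [← hΔ.chartToProj_comp k hKL, Scheme.Hom.comp_apply] at hw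
    rw [← (hΔ.chartToProj k L).isOpenEmbedding.injective hw, ← Scheme.Hom.comp_apply, chartι_comp]
  rw [key I hKI y hx, key J hKJ y' (hx.trans h)]

lemma IsUnimodular.toProj_surjective (hΔ : Δ.IsUnimodular) : Function.Surjective (hΔ.toProj k) := by
  intro p
  have htop : ⨆ i : Fin (n + 1), Proj.basicOpen 𝒜 (MvPolynomial.X i) = ⊤ := by
    refine Proj.iSup_basicOpen_eq_top' 𝒜 _ (fun i => ⟨1, MvPolynomial.isHomogeneous_X k i⟩) ?_
    refine top_le_iff.mp fun x _ => ?_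
    induction x using MvPolynomial.induction_on with
    | C a => exact Subalgebra.algebraMap_mem _ (algebraMap k (𝒜 0) a)
    | add f g hf hg => exact add_mem (hf trivial) (hg trivial)
    | mul_X f i hf => exact mul_mem (hf trivial) (Algebra.subset_adjoin ⟨i, rfl⟩)
  obtain ⟨i, hi⟩ := TopologicalSpace.Opens.mem_iSup.mp (htop ▸ TopologicalSpace.Opens.mem_top p)
  have : p ∈ Set.range (hΔ.chartToProj k (maxCone i)) := by
    rw [mem_range_chartToProj]
    intro j hj
    obtain rfl : j = i := by simpa [maxCone] using hj
    exact hi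
  obtain ⟨y, rfl⟩ := this
  exact ⟨_, hΔ.toProj_chartι k _ y⟩

/-- A unimodular simplex fan is the fan of projective space. -/
lemma IsUnimodular.nonempty_iso_projectiveSpace (hΔ : Δ.IsUnimodular) :
    Nonempty (Over.mk (Δ.toSpec k) ≅ ToricGeometry.projectiveSpace n k) := by
  have : IsIso (hΔ.toProj k) := by
    refine ToricGeometry.isIso_of_bijective_of_forall_exists_isOpenImmersion _
      ⟨hΔ.toProj_injective k, hΔ.toProj_surjective k⟩ fun z => ?_
    obtain ⟨I, y, -, hy⟩ := exists_mem_chartOpen z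
    refine ⟨_, Δ.chartι k I, inferInstance, ?_, ⟨y, hy⟩⟩
    rw [chartι_toProj]
    infer_instance
  let e : Δ.toricVariety k ≅ Proj 𝒜 := asIso (hΔ.toProj k)
  exact ⟨Over.isoMk e (hΔ.toProj_toSpec k)⟩

end SimplexFan

theorem mainTheorem9 {k : Type u} [Field k] [IsAlgClosed k] {n : ℕ} (Δ : SimplexFan n)
    (hX : ¬ Nonempty (Over.mk (Δ.toSpec k) ≅ ToricGeometry.projectiveSpace n k)) :
    ∃ l m : Fin (n + 1), l ≠ m ∧ ∃ q : ℚ,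
      ToricGeometry.IsAnticanonicalDegree (Δ.toSpec k) n
        (Δ.orbitClosure k (SimplexFan.wall l m)) q ∧ q ≤ n := by
  obtain ⟨w, hpos, hw1, hw⟩ := Δ.exists_weights
  rcases Δ.exists_wall_or_isUnimodular hpos hw1 hw with ⟨l, m, u, hlm, hu, hle⟩ | hΔ
  · obtain ⟨r, φ, hr, hφ⟩ := Δ.exists_support
    obtain ⟨s, hs⟩ := hu.exists_smul (φ m - φ l) fun i hl hm => by
      rw [sub_dotProduct, hφ m i hm, hφ l i hl, sub_self]
    refine ⟨l, m, hlm, (s : ℚ) / r, hu.isAnticanonicalDegree hlm hr hφ hs, ?_⟩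
    have h := SimplexFan.IsWallGenerator.mul_eq hlm hw1 hw hφ hs
    have ha : 0 < ((u ⬝ᵥ Δ.ray l : ℤ) : ℝ) * w l := mul_pos (by exact_mod_cast hu.pos) (hpos l)
    have hr' : (0 : ℝ) < r := by exact_mod_cast hr
    -- With `a = ⟨u, v_l⟩ w_l` one has `s a = r` and `1 ≤ n a`. As `s` is nonnegative, `s ≤ s n a =
    -- n r`.
    have hsr : (s : ℝ) ≤ n * r := by
      rw [mul_assoc] at h
      have hs0 : (0 : ℝ) ≤ s := by
        by_contra! hneg
        nlinarith
      calc (s : ℝ) ≤ s * (n * (((u ⬝ᵥ Δ.ray l : ℤ) : ℝ) * w l)) := le_mul_of_one_le_right hs0 hle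
        _ = n * r := by rw [← h]; ring
    rw [div_le_iff₀ (by exact_mod_cast hr)]
    exact_mod_cast hsr
  · exact absurd (hΔ.nonempty_iso_projectiveSpace k) hX
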